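/- **Setting.** Let $G=(V,E)$ be a connected undirected graph with vertex set $V=\{1,\dots,m\}$ and diameter $d$, known to all players. Player $j\in V$ holds a vector $X_j\in\{0,1,\dots,M\}^n$, where $n,M\ge 1$; put $\mathcal X=\sum_{j=1}^m X_j$ and, for $p>0$, $F_p=\sum_{i=1}^n \mathcal X_i^{\,p}$. In a public-coin message passing protocol on $G$ all players see a common infinite string of independent fair random bits. The protocol proceeds in rounds; in each round some of the players each send one bit string across one of their edges, which only the neighbour at the other end receives. Who sends to whom in which round is fixed in advance; the content of a message depends only on the random string, on the sender's own input and on the messages it received in earlier rounds. At the end a distinguished player, fixed in advance, outputs a real number depending on the random string, its input and the messages it received. The total communication is the number of bits in all messages sent, and the max-communication is the maximum, over the edges of $G$, of the number of bits sent across that edge (in both directions) during the execution. The protocol is one-shot if every player other than the distinguished one sends exactly one message, the distinguished player sends none, each player receives messages in at most one round, and a player that receives messages in a round and itself sends a message does so in the next round. **Theorem.** Let $p\in(0,1)$. There is a constant $K>0$, depending only on $p$, such that for all integers $n,m,M\ge 1$, all $\epsilon\in(0,1)$ and every connected graph $G$ on $m$ vertices with diameter $d$ there is a one-shot public-coin message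 passing protocol on $G$ with at most $d$ rounds such that, for all inputs $X_1,\dots,X_m\in\{0,\dots,M\}^n$, 1. with probability at least $2/3$ the output $R$ satisfies $|R-F_p|\le \epsilon F_p$; 2. the max-communication is always at most $\dfrac{K}{\epsilon^2}\left(\log_2\log_2(nmM)+\log_2\dfrac{2}{\epsilon}\right)$ bits; 3. the total communication is always at most $\dfrac{Km}{\epsilon^2}\left(\log_2\log_2(nmM)+\log_2\dfrac{2}{\epsilon}\right)$ bits. Here $\log_2\log_2(nmM)$ is read as $0$ if $nmM=1$. In particular, if $m,M=O(n^c)$ for a constant $c$ and $n\ge2$, $\epsilon\le 1/2$, the max-communication is $O(\epsilon^{-2}(\log\log n+\log(1/\epsilon)))$ bits and the total communication is $O(m\epsilon^{-2}(\log\log n+\log(1/\epsilon)))$ bits, with no dependence on the topology $G$. -/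

import Mathlib

open MeasureTheory

noncomputable section

namespace MessagePassing

/-- The public random string: an infinite sequence of bits, readable by all players. -/
abbrev Coins : Type := ℕ → Bool

/-- The law of the public random string: independent fair bits. -/
def fairCoins : Measure Coins :=
  Measure.infinitePi (fun _ : ℕ => (PMF.uniformOfFintype Bool).toMeasure)

/-- The input of one player: a vector in `{0, 1, …, M}ⁿ`. -/
abbrev Input (n M : ℕ) : Type := Fin n → Fin (M + 1)

/-- What a player has received so far: one entry per past round, in chronological order. An entry
gives, for every potential sender, the message that arrived from it in that round, if any. -/
abbrev Inbox (m : ℕ) : Type := List (Fin m → Option (List Bool))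

/-- A public-coin message passing protocol on the topology `G`, for `m` players (the vertices of
`G`) holding vectors in `{0, …, M}ⁿ`. In each round every player sends at most one message, across
one of its edges. Who speaks to whom in which round is fixed in advance, so that silence and the
choice of the recipient carry no information. The content of a message (a bit string) is a function
of the public coins, of the sender's own input and of the messages it received in earlier rounds. -/
structure Protocol {m : ℕ} (G : SimpleGraph (Fin m)) (n M : ℕ) where
  /-- number of rounds -/
  rounds : ℕ
  /-- the distinguished player who holds the estimate at the end -/
  center : Fin m
  /-- `schedule r v = some w`: in round `r` (counted from 0) player `v` sends a message to `w` -/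
  schedule : ℕ → Fin m → Option (Fin m)
  /-- messages travel along edges only -/
  adj_of_schedule : ∀ r v w, schedule r v = some w → G.Adj v w
  /-- the message that `v` sends in round `r` (used only if `v` is scheduled to speak) -/
  message : ℕ → Fin m → Coins → Input n M → Inbox m → List Bool
  /-- the output of the distinguished player -/
  output : Coins → Input n M → Inbox m → ℝ
  measurable_message : ∀ r v x h s, MeasurableSet {ω : Coins | message r v ω x h = s}
  measurable_output : ∀ x h, Measurable (fun ω : Coins => output ω x h)

namespace Protocol

variable {m n M : ℕ} {G : SimpleGraph (Fin m)} (P : Protocol G n M)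

/-- The inbox of each player just before round `r`, on inputs `X` and coins `ω`. -/
def inbox (X : Fin m → Input n M) (ω : Coins) : ℕ → Fin m → Inbox m
  | 0, _ => []
  | r + 1, v => inbox X ω r v ++
      [fun u => if P.schedule r u = some v then some (P.message r u ω (X u) (inbox X ω r u))
        else none]

/-- The value that the distinguished player holds when the protocol ends. -/
def result (X : Fin m → Input n M) (ω : Coins) : ℝ :=
  P.output ω (X P.center) (P.inbox X ω P.rounds P.center)

/-- Number of bits sent from `u` to `v` in round `r`. -/
def bits (X : Fin m → Input n M) (ω : Coins) (r : ℕ) (u v : Fin m) : ℕ :=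
  if P.schedule r u = some v then (P.message r u ω (X u) (P.inbox X ω r u)).length else 0

/-- Total number of bits sent in all the messages of one execution. -/
def totalCommunication (X : Fin m → Input n M) (ω : Coins) : ℕ :=
  ∑ r ∈ Finset.range P.rounds, ∑ u, ∑ v, P.bits X ω r u v

/-- Number of bits sent across the edge `{u, v}`, in both directions, during one execution. -/
def edgeCommunication (X : Fin m → Input n M) (ω : Coins) (u v : Fin m) : ℕ :=
  ∑ r ∈ Finset.range P.rounds, (P.bits X ω r u v + P.bits X ω r v u)

/-- Maximum number of bits sent across any edge during one execution (non-edges contribute `0`). -/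
def maxCommunication (X : Fin m → Input n M) (ω : Coins) : ℕ :=
  Finset.univ.sup fun e : Fin m × Fin m => P.edgeCommunication X ω e.1 e.2

/-- One-shot protocols: every player except the distinguished one sends exactly one message, the
distinguished player sends none, each player receives messages in at most one round, and a player
who receives messages in some round and speaks does so in the next round. -/
def IsOneShot : Prop :=
  (∀ v, v ≠ P.center → ∃! r, r < P.rounds ∧ (P.schedule r v).isSome) ∧
  (∀ r < P.rounds, P.schedule r P.center = none) ∧
  (∀ r < P.rounds, ∀ s < P.rounds, ∀ u w v,
    P.schedule r u = some v → P.schedule s w = some v → r = s) ∧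
  (∀ r < P.rounds, ∀ s < P.rounds, ∀ u v,
    P.schedule r u = some v → (P.schedule s v).isSome → s = r + 1)

end Protocol

/-- The frequency moment `F_p = ∑ i, 𝒳_i ^ p` of the aggregate vector `𝒳 = ∑ j, X_j`. -/
def frequencyMoment (p : ℝ) {m n M : ℕ} (X : Fin m → Input n M) : ℝ :=
  ∑ i : Fin n, ((∑ j : Fin m, (X j i : ℕ) : ℕ) : ℝ) ^ p

end MessagePassing

end

/-!
From the common coins the players draw nonnegative coefficients `a i` that approximate independent
one-sided `p`-stable variables: sums of `N` jumps `(N u) ^ (-1 / p)` with `u` uniform, for a large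
`N`. The sketch `∑ i, a i * x i` is linear in `x`, and its moment of order `p / 3` at the aggregate
vector tends to `C * F_p ^ (1 / 3)`, as its Laplace transform tends to `exp (-c F_p t ^ p)`.

The sketches are added up along a breadth-first tree. Before sending its partial sum a player rounds
it at random, without bias, to a geometric grid of ratio `1 + γ`, where `γ` is of order `ε ^ 2`; the
index of a grid point takes `O(log log (n m M) + log (1 / ε))` bits. The rounding errors do not
accumulate with the depth of the tree: a grid point `y w` received from a child is at most the grid
point below the sum `S`, so rounding `S` has variance about `γ (S ^ 2 - ∑ w, y w ^ 2)` at most, and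
these quantities telescope to `γ` times the square of the total.

Averaging `O(ε ^ (-2))` independent copies of the `p / 3`-th power of the total and Chebyshev's
inequality yield `F_p ^ (1 / 3)` up to a factor `1 ± O(ε)`; its cube is the output.
-/

noncomputable section

namespace MessagePassing

/-! ### Uniform variables from coins -/

/-- The law of one fair bit. -/
abbrev fairBit : Measure Bool := (PMF.uniformOfFintype Bool).toMeasure

/-- The uniform distribution on the unit interval, taken half-open so that binary expansions are
unique. -/
def unitUniform : Measure ℝ := volume.restrict (Set.Ico 0 1)

instance : IsProbabilityMeasure unitUniform := ⟨by simp [unitUniform]⟩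

/-- The joint law of independent uniform numbers in `[0, 1)` indexed by `ι`. -/
abbrev unitUniforms (ι : Type*) [Fintype ι] : Measure (ι → ℝ) := Measure.pi fun _ => unitUniform

instance : IsProbabilityMeasure fairCoins := by unfold fairCoins; infer_instance

lemma ae_mem_Ico_unitUniform : ∀ᵐ u ∂unitUniform, u ∈ Set.Ico (0 : ℝ) 1 :=
  ae_restrict_mem measurableSet_Ico

lemma unitUniform_real_Iio {θ : ℝ} (hθ : θ ∈ Set.Icc (0 : ℝ) 1) :
    unitUniform.real (Set.Iio θ) = θ := by
  have hinter : Set.Iio θ ∩ Set.Ico 0 1 = Set.Ico 0 θ := by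
    rw [← Set.Ici_inter_Iio, ← Set.Ici_inter_Iio, Set.inter_left_comm, Set.Iio_inter_Iio,
      min_eq_left hθ.2]
  rw [unitUniform, measureReal_restrict_apply measurableSet_Iio, hinter]
  simp [hθ.1]

lemma measurable_half_add : Measurable fun z : Bool × ℝ => ((z.1.toNat : ℝ) + z.2) / 2 := by
  have h : Measurable fun z : Bool × ℝ => (z.1.toNat : ℝ) :=
    (measurable_of_countable fun b : Bool => (b.toNat : ℝ)).comp measurable_fst
  fun_prop

lemma unitUniform_preimage_half_add {s : Set ℝ} (hs : MeasurableSet s) (b : ℝ) :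
    unitUniform ((fun x => (b + x) / 2) ⁻¹' s) =
      2 * volume (s ∩ Set.Ico (b / 2) ((b + 1) / 2)) := by
  have hpre : (fun x => (b + x) / 2) ⁻¹' s ∩ Set.Ico 0 1 =
      (fun x => x * 2⁻¹) ⁻¹' ((fun x => x + b / 2) ⁻¹' (s ∩ Set.Ico (b / 2) ((b + 1) / 2))) := by
    ext x
    have hx : x * 2⁻¹ + b / 2 = (b + x) / 2 := by ring
    simp only [Set.mem_inter_iff, Set.mem_preimage, Set.mem_Ico, hx]
    refine and_congr_right fun _ => and_congr ?_ ?_ <;> constructor <;> intro h <;> linarith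
  rw [unitUniform, Measure.restrict_apply (by measurability), hpre,
    Real.volume_preimage_mul_right (by norm_num), measure_preimage_add_right]
  norm_num

lemma measurePreserving_half_add :
    MeasurePreserving (fun z : Bool × ℝ => ((z.1.toNat : ℝ) + z.2) / 2)
      (fairBit.prod unitUniform) unitUniform := by
  refine ⟨measurable_half_add, Measure.ext fun s hs => ?_⟩
  have hsplit : volume (s ∩ Set.Ico 0 (1 / 2)) + volume (s ∩ Set.Ico (1 / 2) 1) =
      volume (s ∩ Set.Ico (0 : ℝ) 1) := by
    rw [← measure_union, ← Set.inter_union_distrib_left,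
      Set.Ico_union_Ico_eq_Ico (by norm_num) (by norm_num)]
    · exact (Set.Ico_disjoint_Ico_same).mono Set.inter_subset_right Set.inter_subset_right
    · exact hs.inter measurableSet_Ico
  rw [Measure.map_apply measurable_half_add hs, Measure.prod_apply (measurable_half_add hs),
    lintegral_fintype]
  have hfalse := unitUniform_preimage_half_add hs 0
  have htrue := unitUniform_preimage_half_add hs 1
  rw [zero_div, zero_add] at hfalse
  rw [show ((1 : ℝ) + 1) / 2 = 1 by norm_num] at htrue
  simp only [Fintype.sum_bool, ← Set.preimage_comp, Function.comp_def, Bool.toNat_true,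
    Bool.toNat_false, Nat.cast_one, Nat.cast_zero, hfalse, htrue,
    (PMF.uniformOfFintype Bool).toMeasure_apply_singleton _ (measurableSet_singleton _),
    PMF.uniformOfFintype_apply, Fintype.card_bool, Nat.cast_ofNat]
  have hhalf (a : ENNReal) : 2 * a * 2⁻¹ = a := by
    rw [mul_right_comm, ENNReal.mul_inv_cancel two_ne_zero ENNReal.ofNat_ne_top, one_mul]
  rw [unitUniform, Measure.restrict_apply hs, ← hsplit, hhalf, hhalf, add_comm]

/-- The binary expansion of the fractional part of a nonnegative real number. -/
def binDigits (x : ℝ) : Coins := fun i => decide (⌊x * 2 ^ (i + 1)⌋₊ % 2 = 1)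

lemma measurable_binDigits : Measurable binDigits := by
  refine measurable_pi_lambda _ fun i => ?_
  have hfloor : Measurable fun x : ℝ => ⌊x * 2 ^ (i + 1)⌋₊ :=
    Nat.measurable_floor.comp (measurable_id.mul_const _)
  exact (measurable_of_countable fun k : ℕ => decide (k % 2 = 1)).comp hfloor

lemma binDigits_half_add_zero (b : Bool) {x : ℝ} (hx : x ∈ Set.Ico (0 : ℝ) 1) :
    binDigits ((b.toNat + x) / 2) 0 = b := by
  have hfloor : ⌊((b.toNat : ℝ) + x) / 2 * 2 ^ (0 + 1)⌋₊ = b.toNat := by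
    rw [show ((b.toNat : ℝ) + x) / 2 * 2 ^ (0 + 1) = x + b.toNat by ring,
      Nat.floor_add_natCast hx.1, Nat.floor_eq_zero.2 hx.2, zero_add]
  simp only [binDigits, hfloor]
  cases b <;> rfl

lemma binDigits_half_add_succ (b : Bool) {x : ℝ} (hx : 0 ≤ x) (i : ℕ) :
    binDigits ((b.toNat + x) / 2) (i + 1) = binDigits x i := by
  have hfloor : ⌊((b.toNat : ℝ) + x) / 2 * 2 ^ (i + 1 + 1)⌋₊ =
      ⌊x * 2 ^ (i + 1)⌋₊ + 2 * (b.toNat * 2 ^ i) := by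
    rw [← Nat.floor_add_natCast (by positivity)]
    push_cast
    ring_nf
  simp only [binDigits, hfloor, Nat.add_mul_mod_self_left]

lemma unitUniform_binDigits_mem (N : ℕ) (t : ℕ → Set Bool) :
    unitUniform {x | ∀ i < N, binDigits x i ∈ t i} = ∏ i ∈ Finset.range N, fairBit (t i) := by
  induction N generalizing t with
  | zero => simp
  | succ N ih =>
    have hmeas (N : ℕ) (t : ℕ → Set Bool) :
        MeasurableSet {x : ℝ | ∀ i < N, binDigits x i ∈ t i} := by
      simp only [Set.ofPred_forall]
      exact .iInter fun i => .iInter fun _ =>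
        ((measurable_pi_apply i).comp measurable_binDigits) (t i).toFinite.measurableSet
    have hcons : (fun z : Bool × ℝ => ((z.1.toNat : ℝ) + z.2) / 2) ⁻¹'
          {x | ∀ i < N + 1, binDigits x i ∈ t i} =ᵐ[fairBit.prod unitUniform]
        t 0 ×ˢ {x | ∀ i < N, binDigits x i ∈ t (i + 1)} := by
      have hIco : ∀ᵐ z ∂fairBit.prod unitUniform, z.2 ∈ Set.Ico (0 : ℝ) 1 :=
        Measure.quasiMeasurePreserving_snd.ae ae_mem_Ico_unitUniform
      refine Filter.eventuallyEq_set.2 (hIco.mono fun z hz => ?_)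
      simp only [Set.mem_preimage, Set.mem_ofPred_eq, Set.mem_prod, Nat.forall_lt_succ_left,
        binDigits_half_add_zero z.1 hz, binDigits_half_add_succ z.1 hz.1]
    rw [← measurePreserving_half_add.measure_preimage (hmeas _ _).nullMeasurableSet,
      measure_congr hcons, Measure.prod_prod, ih, Finset.prod_range_succ', mul_comm]

lemma measurePreserving_binDigits : MeasurePreserving binDigits unitUniform fairCoins := by
  refine ⟨measurable_binDigits, Measure.eq_infinitePi _ fun s t ht => ?_⟩
  have hmeas : MeasurableSet (Set.pi (s : Set ℕ) t) :=
    MeasurableSet.pi s.countable_toSet fun i _ => ht i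
  obtain ⟨N, hN⟩ := s.exists_nat_subset_range
  have hpre : binDigits ⁻¹' Set.pi (s : Set ℕ) t =
      {x | ∀ i < N, binDigits x i ∈ if i ∈ s then t i else Set.univ} := by
    ext x
    refine ⟨fun h i _ => ?_, fun h i hi => ?_⟩
    · split_ifs with his
      exacts [h i his, trivial]
    · simpa [Finset.mem_coe.1 hi] using h i (Finset.mem_range.1 (hN hi))
  rw [Measure.map_apply measurable_binDigits hmeas, hpre, unitUniform_binDigits_mem,
    ← Finset.prod_subset hN fun i _ hi => by rw [if_neg hi, measure_univ]]
  exact Finset.prod_congr rfl fun i hi => by rw [if_pos hi]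

/-- The real number in `[0, 1]` whose binary digits are the coins. -/
def coinsToReal (ω : Coins) : ℝ := Real.ofDigits fun i => if ω i then (1 : Fin 2) else 0

lemma measurable_coinsToReal : Measurable coinsToReal := by
  refine Real.continuous_ofDigits.measurable.comp (measurable_pi_lambda _ fun i => ?_)
  exact (measurable_of_countable fun b : Bool => if b then (1 : Fin 2) else 0).comp
    (measurable_pi_apply i)

lemma coinsToReal_binDigits {x : ℝ} (hx : x ∈ Set.Ico (0 : ℝ) 1) :
    coinsToReal (binDigits x) = x := by
  conv_rhs => rw [← Real.ofDigits_digits (b := 2) (by norm_num) hx]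
  rw [coinsToReal]
  congr 1
  ext i
  simp only [binDigits, Real.digits, Fin.ofNat]
  rcases Nat.mod_two_eq_zero_or_one ⌊x * 2 ^ (i + 1)⌋₊ with h | h <;> simp [h]

lemma measurePreserving_coinsToReal : MeasurePreserving coinsToReal fairCoins unitUniform := by
  have hid : coinsToReal ∘ binDigits =ᵐ[unitUniform] id :=
    ae_mem_Ico_unitUniform.mono fun x hx => coinsToReal_binDigits hx
  refine ⟨measurable_coinsToReal, ?_⟩
  rw [← measurePreserving_binDigits.map_eq,
    Measure.map_map measurable_coinsToReal measurable_binDigits, Measure.map_congr hid,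
    Measure.map_id]

/-- The coins split into disjoint infinite subsequences, one for each index. -/
lemma exists_measurePreserving_pi (ι : Type*) [Fintype ι] [Nonempty ι] {Ω : Type*}
    [MeasurableSpace Ω] {ν : Measure Ω} [IsProbabilityMeasure ν] {f : Coins → Ω}
    (hf : MeasurePreserving f fairCoins ν) :
    ∃ F : Coins → ι → Ω, MeasurePreserving F fairCoins (Measure.pi fun _ => ν) := by
  obtain ⟨e⟩ : Nonempty (ι × ℕ ≃ ℕ) := nonempty_equiv_of_countable
  have hreindex : MeasurePreserving (MeasurableEquiv.piCongrLeft (fun _ => Bool) e.symm)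
      fairCoins (Measure.infinitePi fun _ : ι × ℕ => fairBit) :=
    ⟨MeasurableEquiv.measurable _,
      Measure.infinitePi_map_piCongrLeft (fun _ : ι × ℕ => fairBit) e.symm⟩
  have hcurry : MeasurePreserving (MeasurableEquiv.curry ι ℕ Bool)
      (Measure.infinitePi fun _ : ι × ℕ => fairBit)
      (Measure.infinitePi fun _ : ι => fairCoins) :=
    ⟨MeasurableEquiv.measurable _, Measure.infinitePi_map_curry fun _ _ => fairBit⟩
  have hmap : MeasurePreserving (fun (y : ι → Coins) i => f (y i))
      (Measure.infinitePi fun _ => fairCoins) (Measure.pi fun _ => ν) := by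
    refine ⟨by have := hf.measurable; fun_prop, ?_⟩
    rw [Measure.infinitePi_map_pi _ fun _ => hf.measurable, hf.map_eq, Measure.infinitePi_eq_pi]
  exact ⟨_, hmap.comp (hcurry.comp hreindex)⟩

lemma exists_measurePreserving_pi_prod (k ι κ : Type*) [Fintype k] [Nonempty k] [Fintype ι]
    [Fintype κ] [Nonempty κ] :
    ∃ F : Coins → k → (ι → ℝ) × (κ → ℝ), MeasurePreserving F fairCoins
      (Measure.pi fun _ => (unitUniforms ι).prod (unitUniforms κ)) := by
  obtain ⟨F, hF⟩ := exists_measurePreserving_pi (ι ⊕ κ) measurePreserving_coinsToReal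
  exact exists_measurePreserving_pi k
    ((measurePreserving_sumPiEquivProdPi fun _ : ι ⊕ κ => unitUniform).comp hF)

/-! ### Randomized rounding -/

section UpdateCoordinate

variable {ι : Type*} [Fintype ι] [DecidableEq ι] {X : ι → Type*} [∀ i, MeasurableSpace (X i)]
  (μ : ∀ i, Measure (X i)) [∀ i, IsProbabilityMeasure (μ i)]

lemma measurePreserving_update_pi (i : ι) :
    MeasurePreserving (fun z : (∀ j, X j) × X i => Function.update z.1 i z.2)
      ((Measure.pi μ).prod (μ i)) (Measure.pi μ) := by
  refine ⟨measurable_update', (Measure.pi_eq fun t ht => ?_).symm⟩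
  have hpre : (fun z : (∀ j, X j) × X i => Function.update z.1 i z.2) ⁻¹' Set.pi Set.univ t =
      Set.pi Set.univ (Function.update t i Set.univ) ×ˢ t i := by
    ext ⟨b, s⟩
    have hl := Function.forall_update_iff b (a := i) (b := s) fun j y => y ∈ t j
    have hr := Function.forall_update_iff t (a := i) (b := Set.univ) fun j y => b j ∈ y
    simp only [Set.mem_preimage, Set.mem_univ_pi, Set.mem_prod, hl, hr, Set.mem_univ, true_and,
      and_comm]
  rw [Measure.map_apply measurable_update' (MeasurableSet.univ_pi ht), hpre, Measure.prod_prod,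
    Measure.pi_pi, ← Finset.prod_erase_mul _ _ (Finset.mem_univ i),
    ← Finset.prod_erase_mul _ (fun j => μ j (t j)) (Finset.mem_univ i), Function.update_self,
    measure_univ, mul_one]
  congr 1
  exact Finset.prod_congr rfl fun j hj => by
    rw [Function.update_of_ne (Finset.ne_of_mem_erase hj)]

lemma integral_pi_eq_integral_integral_update {E : Type*} [NormedAddCommGroup E]
    [NormedSpace ℝ E] (i : ι) {F : (∀ j, X j) → E} (hF : Integrable F (Measure.pi μ)) :
    ∫ b, F b ∂Measure.pi μ = ∫ b, ∫ s, F (Function.update b i s) ∂μ i ∂Measure.pi μ := by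
  have hupd := measurePreserving_update_pi μ i
  have hint : Integrable F (((Measure.pi μ).prod (μ i)).map
      fun z : (∀ j, X j) × X i => Function.update z.1 i z.2) := by rwa [hupd.map_eq]
  calc ∫ b, F b ∂Measure.pi μ
      = ∫ z : (∀ j, X j) × X i, F (Function.update z.1 i z.2) ∂(Measure.pi μ).prod (μ i) := by
        rw [← integral_map hupd.measurable.aemeasurable hint.aestronglyMeasurable, hupd.map_eq]
    _ = _ := integral_prod _ (hint.comp_measurable hupd.measurable)

end UpdateCoordinate

/-- Randomized rounding of `S` to the grid `g 0 < ⋯ < g L` by means of a uniform random number `u`: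
the index of the grid point chosen. Between two consecutive grid points the upper one is chosen with
the probability that makes the rounding unbiased. The absolute value has no effect for `u ∈ [0, 1)`;
it makes `0` round to `0` for every `u`. -/
def roundIdx (g : ℕ → ℝ) (L : ℕ) (S u : ℝ) : ℕ :=
  ∑ i ∈ Finset.range L, if g i + |u| * (g (i + 1) - g i) < S then 1 else 0

lemma roundIdx_le (g : ℕ → ℝ) (L : ℕ) (S u : ℝ) : roundIdx g L S u ≤ L := by
  calc roundIdx g L S u ≤ ∑ i ∈ Finset.range L, 1 :=
        Finset.sum_le_sum fun i _ => by split_ifs <;> simp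
    _ = L := by simp

lemma measurable_roundIdx (g : ℕ → ℝ) (L : ℕ) :
    Measurable fun z : ℝ × ℝ => roundIdx g L z.1 z.2 := by
  refine Finset.measurable_sum _ fun i _ => ?_
  refine Measurable.ite (measurableSet_lt ?_ measurable_fst) measurable_const measurable_const
  exact measurable_const.add (measurable_snd.abs.mul_const _)

section Rounding

variable {g : ℕ → ℝ} {L : ℕ} {S u : ℝ}

lemma roundIdx_zero (hg : Monotone g) (hg0 : g 0 = 0) (L : ℕ) (u : ℝ) :
    roundIdx g L 0 u = 0 := by
  refine Finset.sum_eq_zero fun i _ => if_neg (not_lt.2 ?_)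
  have hgi : 0 ≤ g i := hg0 ▸ hg (Nat.zero_le i)
  exact add_nonneg hgi (mul_nonneg (abs_nonneg u) (sub_nonneg.2 (hg (Nat.le_succ i))))

lemma roundIdx_eq_of_iff (hu : 0 ≤ u) {J : ℕ} (hJ : J ≤ L)
    (h : ∀ i < L, g i + u * (g (i + 1) - g i) < S ↔ i < J) : roundIdx g L S u = J := by
  have hfilter : (Finset.range L).filter (fun i => g i + u * (g (i + 1) - g i) < S) =
      Finset.range J := by
    ext i
    simp only [Finset.mem_filter, Finset.mem_range]
    exact ⟨fun hi => (h i hi.1).1 hi.2, fun hi => ⟨hi.trans_le hJ, (h i (hi.trans_le hJ)).2 hi⟩⟩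
  rw [roundIdx, abs_of_nonneg hu, ← Finset.card_filter, hfilter, Finset.card_range]

lemma add_mul_sub_lt_of_le (hg : StrictMono g) (hu : u < 1) {i j : ℕ} (hij : i < j)
    (hS : g j ≤ S) : g i + u * (g (i + 1) - g i) < S := by
  have hstep : 0 < g (i + 1) - g i := sub_pos.2 (hg i.lt_succ_self)
  have hle : g (i + 1) ≤ g j := hg.monotone hij
  nlinarith

lemma roundIdx_eq_of_mem_Ico (hg : StrictMono g) (hu : u ∈ Set.Ico (0 : ℝ) 1) {j : ℕ} (hj : j < L)
    (hS : S ∈ Set.Ico (g j) (g (j + 1))) :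
    roundIdx g L S u = if u * (g (j + 1) - g j) < S - g j then j + 1 else j := by
  have hbelow {i : ℕ} (hij : i < j) : g i + u * (g (i + 1) - g i) < S :=
    add_mul_sub_lt_of_le hg hu.2 hij hS.1
  have habove {i : ℕ} (hij : j < i) : ¬g i + u * (g (i + 1) - g i) < S := by
    have hstep := mul_nonneg hu.1 (sub_nonneg.2 (hg.monotone i.le_succ))
    have hle : g (j + 1) ≤ g i := hg.monotone hij
    linarith [hS.2]
  refine roundIdx_eq_of_iff hu.1 (by split_ifs <;> omega) fun i _ => ?_
  rcases lt_trichotomy i j with hij | rfl | hij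
  · exact iff_of_true (hbelow hij) (by split_ifs <;> omega)
  · rw [← lt_sub_iff_add_lt']
    split_ifs with h
    exacts [iff_of_true h i.lt_succ_self, iff_of_false h (lt_irrefl i)]
  · exact iff_of_false (habove hij) (by split_ifs <;> omega)

lemma roundIdx_eq_of_le (hg : StrictMono g) (hu : u ∈ Set.Ico (0 : ℝ) 1) (hS : g L ≤ S) :
    roundIdx g L S u = L :=
  roundIdx_eq_of_iff hu.1 le_rfl fun _ hi =>
    iff_of_true (add_mul_sub_lt_of_le hg hu.2 hi hS) hi

lemma integral_comp_roundIdx_of_mem_Ico (hg : StrictMono g) {j : ℕ} (hj : j < L)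
    (hS : S ∈ Set.Ico (g j) (g (j + 1))) (f : ℕ → ℝ) :
    ∫ u, f (roundIdx g L S u) ∂unitUniform =
      f j + (S - g j) / (g (j + 1) - g j) * (f (j + 1) - f j) := by
  have hstep : 0 < g (j + 1) - g j := sub_pos.2 (hg j.lt_succ_self)
  have hθ : (S - g j) / (g (j + 1) - g j) ∈ Set.Icc (0 : ℝ) 1 :=
    ⟨div_nonneg (sub_nonneg.2 hS.1) hstep.le, (div_le_one hstep).2 (by linarith [hS.2])⟩
  have hae : ∀ᵐ u ∂unitUniform, f (roundIdx g L S u) = f j +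
      (Set.Iio ((S - g j) / (g (j + 1) - g j))).indicator (fun _ => f (j + 1) - f j) u := by
    filter_upwards [ae_mem_Ico_unitUniform] with u hu
    rw [roundIdx_eq_of_mem_Ico hg hu hj hS]
    simp only [Set.indicator, Set.mem_Iio, lt_div_iff₀ hstep]
    split_ifs <;> simp
  rw [integral_congr_ae hae, integral_add (integrable_const _)
    ((integrable_const _).indicator measurableSet_Iio),
    integral_indicator_const _ measurableSet_Iio, unitUniform_real_Iio hθ]
  simp

lemma integral_comp_roundIdx_of_le (hg : StrictMono g) (hS : g L ≤ S) (f : ℕ → ℝ) :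
    ∫ u, f (roundIdx g L S u) ∂unitUniform = f L := by
  have hae : ∀ᵐ u ∂unitUniform, f (roundIdx g L S u) = f L :=
    ae_mem_Ico_unitUniform.mono fun u hu => by rw [roundIdx_eq_of_le hg hu hS]
  simp [integral_congr_ae hae]

lemma exists_mem_Ico_succ (hS : g 0 ≤ S) (hSL : S < g L) :
    ∃ j < L, S ∈ Set.Ico (g j) (g (j + 1)) := by
  induction L with
  | zero => exact absurd hSL (not_lt.2 hS)
  | succ L ih =>
    rcases lt_or_ge S (g L) with h | h
    · obtain ⟨j, hj, hmem⟩ := ih h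
      exact ⟨j, hj.trans L.lt_succ_self, hmem⟩
    · exact ⟨L, L.lt_succ_self, h, hSL⟩

lemma integral_round (hg : StrictMono g) (hS : g 0 ≤ S) :
    ∫ u, g (roundIdx g L S u) ∂unitUniform = min S (g L) := by
  rcases lt_or_ge S (g L) with h | h
  · obtain ⟨j, hj, hmem⟩ := exists_mem_Ico_succ hS h
    have hstep : g (j + 1) - g j ≠ 0 := (sub_pos.2 (hg j.lt_succ_self)).ne'
    rw [integral_comp_roundIdx_of_mem_Ico hg hj hmem, min_eq_left h.le, div_mul_cancel₀ _ hstep,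
      add_sub_cancel]
  · rw [integral_comp_roundIdx_of_le hg h, min_eq_right h]

lemma integral_round_sq_of_mem_Ico (hg : StrictMono g) {j : ℕ} (hj : j < L)
    (hS : S ∈ Set.Ico (g j) (g (j + 1))) :
    ∫ u, g (roundIdx g L S u) ^ 2 ∂unitUniform = S ^ 2 + (S - g j) * (g (j + 1) - S) := by
  have hstep : g (j + 1) - g j ≠ 0 := (sub_pos.2 (hg j.lt_succ_self)).ne'
  rw [integral_comp_roundIdx_of_mem_Ico hg hj hS fun i => g i ^ 2]
  field_simp
  ring

end Rounding

/-- The grid `0, τ, τ (1 + γ), τ (1 + γ)², …` to which the counters are rounded. -/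
def grid (τ γ : ℝ) : ℕ → ℝ
  | 0 => 0
  | i + 1 => τ * (1 + γ) ^ i

lemma grid_zero (τ γ : ℝ) : grid τ γ 0 = 0 := rfl

lemma grid_succ (τ γ : ℝ) (i : ℕ) : grid τ γ (i + 1) = τ * (1 + γ) ^ i := rfl

section Grid

variable {τ γ : ℝ}

lemma grid_strictMono (hτ : 0 < τ) (hγ : 0 < γ) : StrictMono (grid τ γ) := by
  refine strictMono_nat_of_lt_succ fun i => ?_
  cases i with
  | zero => simpa [grid] using hτ
  | succ i =>
    rw [grid_succ, grid_succ]
    gcongr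
    · linarith
    · exact i.lt_succ_self

lemma grid_nonneg (hτ : 0 < τ) (hγ : 0 < γ) (i : ℕ) : 0 ≤ grid τ γ i :=
  (grid_strictMono hτ hγ).monotone (Nat.zero_le i)

variable {W : Type*} {s : Finset W} {y : W → ℕ} {x₀ S : ℝ}

/-- Summands that are grid points do not exceed the grid point `j` below `S`. This is why repeated
rounding along a tree does not accumulate errors. -/
lemma sub_grid_mul_grid_sub_le (hτ : 0 < τ) (hγ : 0 < γ) (hx₀ : 0 ≤ x₀)
    (hS : S = x₀ + ∑ w ∈ s, grid τ γ (y w)) {j : ℕ}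
    (hj : S ∈ Set.Ico (grid τ γ j) (grid τ γ (j + 1))) :
    (S - grid τ γ j) * (grid τ γ (j + 1) - S) ≤
      γ * (S ^ 2 - ∑ w ∈ s, grid τ γ (y w) ^ 2) + τ * x₀ := by
  have hg := grid_strictMono hτ hγ
  have hnonneg := grid_nonneg hτ hγ
  have hle : ∀ w ∈ s, grid τ γ (y w) ≤ grid τ γ j := fun w hw => by
    have hwS : grid τ γ (y w) ≤ S := by
      have := Finset.single_le_sum (f := fun w => grid τ γ (y w)) (fun w _ => hnonneg _) hw
      linarith
    exact hg.monotone (Nat.lt_succ_iff.1 (hg.lt_iff_lt.1 (hwS.trans_lt hj.2)))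
  have hsq : ∑ w ∈ s, grid τ γ (y w) ^ 2 ≤ grid τ γ j * (S - x₀) := by
    rw [hS, add_sub_cancel_left, Finset.mul_sum]
    exact Finset.sum_le_sum fun w hw => by nlinarith [hnonneg (y w), hle w hw]
  cases j with
  | zero =>
    simp only [grid_zero, zero_add, grid_succ, pow_zero, mul_one, sub_zero] at hj hle hsq ⊢
    have hsum : ∑ w ∈ s, grid τ γ (y w) = 0 :=
      le_antisymm (Finset.sum_nonpos hle) (Finset.sum_nonneg fun w _ => hnonneg _)
    have hSx : S = x₀ := by rw [hS, hsum, add_zero]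
    nlinarith [sq_nonneg S, hj.1, hSx]
  | succ i =>
    set a := grid τ γ (i + 1) with ha
    have ha0 : 0 ≤ a := hnonneg _
    have hnext : grid τ γ (i + 1 + 1) = (1 + γ) * a := by
      rw [ha, grid_succ, grid_succ, pow_succ]; ring
    have hgap : (S - a) * (grid τ γ (i + 1 + 1) - S) ≤ γ * ((S - a) * a) := by
      rw [hnext]; nlinarith [hj.1]
    have hdiag : (S - a) * a ≤ S ^ 2 - ∑ w ∈ s, grid τ γ (y w) ^ 2 := by nlinarith [hj.1]
    nlinarith [mul_le_mul_of_nonneg_left hdiag hγ.le, mul_nonneg hτ.le hx₀]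

lemma integral_round_sq_le (hτ : 0 < τ) (hγ : 0 < γ) (hx₀ : 0 ≤ x₀)
    (hS : S = x₀ + ∑ w ∈ s, grid τ γ (y w)) (L : ℕ) :
    ∫ u, grid τ γ (roundIdx (grid τ γ) L S u) ^ 2 ∂unitUniform ≤
      (1 + γ) * (S ^ 2 - ∑ w ∈ s, grid τ γ (y w) ^ 2) + ∑ w ∈ s, grid τ γ (y w) ^ 2 +
        τ * x₀ := by
  have hg := grid_strictMono hτ hγ
  have hnonneg := grid_nonneg hτ hγ
  have hsum : 0 ≤ ∑ w ∈ s, grid τ γ (y w) := Finset.sum_nonneg fun w _ => hnonneg _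
  have hS0 : 0 ≤ S := by linarith
  rcases lt_or_ge S (grid τ γ L) with h | h
  · obtain ⟨j, hj, hmem⟩ := exists_mem_Ico_succ (g := grid τ γ) hS0 h
    rw [integral_round_sq_of_mem_Ico hg hj hmem]
    linarith [sub_grid_mul_grid_sub_le hτ hγ hx₀ hS hmem]
  · rw [integral_comp_roundIdx_of_le hg h fun i => grid τ γ i ^ 2]
    have hsq : ∑ w ∈ s, grid τ γ (y w) ^ 2 ≤ S ^ 2 := by
      refine (Finset.sum_sq_le_sq_sum_of_nonneg fun w _ => hnonneg (y w)).trans ?_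
      gcongr
      linarith
    have hLS : grid τ γ L ^ 2 ≤ S ^ 2 := by gcongr; exact hnonneg L
    linarith [mul_nonneg hτ.le hx₀, mul_nonneg hγ.le (sub_nonneg.2 hsq)]

end Grid

/-! ### Rounded sums along a tree -/

/-- A rooted tree on the vertex set `V`, encoded by the parent map, which fixes the root, and by the
distances to the root. -/
structure ParentTree (V : Type*) where
  root : V
  parent : V → V
  depth : V → ℕ
  parent_root : parent root = root
  depth_root : depth root = 0
  depth_parent : ∀ v, v ≠ root → depth v = depth (parent v) + 1

namespace ParentTree

variable {V : Type*} (T : ParentTree V)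

lemma depth_iterate_parent (k : ℕ) (u : V) : T.depth (T.parent^[k] u) = T.depth u - k := by
  induction k generalizing u with
  | zero => simp
  | succ k ih =>
    rw [Function.iterate_succ_apply, ih]
    by_cases h : u = T.root
    · simp [h, T.parent_root, T.depth_root]
    · rw [T.depth_parent u h]; omega

variable [Fintype V]

/-- The height of the tree. -/
def maxDepth : ℕ := Finset.univ.sup T.depth

lemma depth_le_maxDepth (v : V) : T.depth v ≤ T.maxDepth := Finset.le_sup (Finset.mem_univ v)

/-- The descendants of `v`, including `v` itself. -/
def subtree (v : V) : Finset V :=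
  open Classical in Finset.univ.filter fun u => ∃ k, T.parent^[k] u = v

/-- The sum of `x` over the descendants of `v`. -/
def subtreeSum (x : V → ℝ) (v : V) : ℝ := ∑ u ∈ T.subtree v, x u

variable {T}

lemma mem_subtree {u v : V} : u ∈ T.subtree v ↔ ∃ k, T.parent^[k] u = v := by
  simp [subtree]

lemma self_mem_subtree (v : V) : v ∈ T.subtree v := mem_subtree.2 ⟨0, rfl⟩

lemma subtree_root : T.subtree T.root = Finset.univ := by
  refine Finset.eq_univ_of_forall fun u => mem_subtree.2 ⟨T.depth u, ?_⟩
  by_contra h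
  have hdepth := T.depth_parent _ h
  rw [depth_iterate_parent] at hdepth
  omega

lemma subtreeSum_nonneg {x : V → ℝ} (hx : ∀ v, 0 ≤ x v) (v : V) : 0 ≤ T.subtreeSum x v :=
  Finset.sum_nonneg fun a _ => hx a

lemma subtreeSum_le_sum {x : V → ℝ} (hx : ∀ v, 0 ≤ x v) (v : V) : T.subtreeSum x v ≤ ∑ a, x a :=
  Finset.sum_le_sum_of_subset_of_nonneg (Finset.subset_univ _) fun a _ _ => hx a

lemma subtreeSum_root (x : V → ℝ) : T.subtreeSum x T.root = ∑ a, x a := by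
  rw [subtreeSum, subtree_root]

variable [DecidableEq V]

variable (T) in
/-- The vertices whose parent is `v`, where the root counts as nobody's child. -/
def children (v : V) : Finset V := Finset.univ.filter fun u => u ≠ T.root ∧ T.parent u = v

lemma mem_children {u v : V} : u ∈ T.children v ↔ u ≠ T.root ∧ T.parent u = v := by
  simp [children]

lemma depth_of_mem_children {u v : V} (h : u ∈ T.children v) : T.depth u = T.depth v + 1 := by
  obtain ⟨hroot, hparent⟩ := mem_children.1 h
  rw [T.depth_parent u hroot, hparent]

lemma subtree_eq (v : V) : T.subtree v = insert v ((T.children v).biUnion T.subtree) := by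
  ext u
  simp only [Finset.mem_insert, Finset.mem_biUnion, mem_subtree]
  constructor
  · rintro ⟨k, hk⟩
    induction k with
    | zero => exact Or.inl hk
    | succ k ih =>
      by_cases h : T.parent^[k] u = v
      · exact ih h
      · rw [Function.iterate_succ_apply'] at hk
        have hroot : T.parent^[k] u ≠ T.root := fun hr =>
          h (by rw [← hk, hr, T.parent_root])
        exact Or.inr ⟨T.parent^[k] u, mem_children.2 ⟨hroot, hk⟩, k, rfl⟩
  · rintro (rfl | ⟨w, hw, k, hk⟩)
    · exact ⟨0, rfl⟩
    · exact ⟨k + 1, by rw [Function.iterate_succ_apply', hk, (mem_children.1 hw).2]⟩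

lemma subtree_subset {u v : V} (h : u ∈ T.children v) : T.subtree u ⊆ T.subtree v := by
  rw [T.subtree_eq v]
  exact (Finset.subset_biUnion_of_mem T.subtree h).trans (Finset.subset_insert _ _)

lemma notMem_subtree_of_mem_children {u v : V} (h : u ∈ T.children v) : v ∉ T.subtree u := by
  intro hv
  obtain ⟨k, hk⟩ := mem_subtree.1 hv
  have hdepth := T.depth_iterate_parent k v
  rw [hk, depth_of_mem_children h] at hdepth
  omega

lemma disjoint_subtree {u w v : V} (hu : u ∈ T.children v) (hw : w ∈ T.children v)
    (h : u ≠ w) : Disjoint (T.subtree u) (T.subtree w) := by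
  rw [Finset.disjoint_left]
  intro a hau haw
  obtain ⟨k, hk⟩ := mem_subtree.1 hau
  obtain ⟨l, hl⟩ := mem_subtree.1 haw
  have hdu := T.depth_iterate_parent k a
  have hdw := T.depth_iterate_parent l a
  rw [hk, depth_of_mem_children hu] at hdu
  rw [hl, depth_of_mem_children hw] at hdw
  obtain rfl : k = l := by omega
  exact h (hk.symm.trans hl)

lemma subtreeSum_eq (x : V → ℝ) (v : V) :
    T.subtreeSum x v = x v + ∑ w ∈ T.children v, T.subtreeSum x w := by
  simp only [subtreeSum]
  rw [T.subtree_eq v, Finset.sum_insert, Finset.sum_biUnion]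
  · exact fun u hu w hw h => disjoint_subtree hu hw h
  · simp only [Finset.mem_biUnion, not_exists, not_and]
    exact fun w hw => notMem_subtree_of_mem_children hw

lemma maxDepth_sub_depth_lt {w v : V} (h : w ∈ T.children v) :
    T.maxDepth - T.depth w < T.maxDepth - T.depth v := by
  have hw := T.depth_le_maxDepth w
  have hdepth := depth_of_mem_children h
  omega

lemma induction_children {P : V → Prop} (h : ∀ v, (∀ w ∈ T.children v, P w) → P v) (v : V) :
    P v :=
  h v fun w _hw => induction_children h w
termination_by T.maxDepth - T.depth v
decreasing_by exact maxDepth_sub_depth_lt _hw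

/-- The index of the grid point computed at `v` when every vertex adds its own number to the grid
points received from its children and rounds the sum, using the random number `b v`. -/
def treeIdx (T : ParentTree V) (g : ℕ → ℝ) (L : ℕ) (x b : V → ℝ) (v : V) : ℕ :=
  roundIdx g L (x v + ∑ w : T.children v, g (treeIdx T g L x b w)) (b v)
termination_by T.maxDepth - T.depth v
decreasing_by exact maxDepth_sub_depth_lt w.2

/-- The sum formed at `v` in `treeIdx`, before rounding. -/
def treeSum (T : ParentTree V) (g : ℕ → ℝ) (L : ℕ) (x b : V → ℝ) (v : V) : ℝ :=
  x v + ∑ w ∈ T.children v, g (T.treeIdx g L x b w)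

section TreeRounding

variable {g : ℕ → ℝ} {L : ℕ} {x b : V → ℝ} {v : V}

variable (T g L x b v) in
lemma treeIdx_eq : T.treeIdx g L x b v = roundIdx g L (T.treeSum g L x b v) (b v) := by
  rw [treeIdx, treeSum, Finset.sum_coe_sort (T.children v) fun w => g (T.treeIdx g L x b w)]

variable (T g L x b v) in
lemma treeIdx_le : T.treeIdx g L x b v ≤ L := by
  rw [treeIdx_eq]; exact roundIdx_le _ _ _ _

variable (T g L v) in
lemma measurable_treeIdx :
    Measurable fun z : (V → ℝ) × (V → ℝ) => T.treeIdx g L z.1 z.2 v := by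
  induction v using T.induction_children with
  | h v ih =>
    simp only [fun z : (V → ℝ) × (V → ℝ) => T.treeIdx_eq g L z.1 z.2 v, treeSum]
    refine (measurable_roundIdx g L).comp (Measurable.prodMk (.add ?_ ?_) ?_)
    · exact (measurable_pi_apply v).comp measurable_fst
    · exact Finset.measurable_sum _ fun w hw => (measurable_of_countable g).comp (ih w hw)
    · exact (measurable_pi_apply v).comp measurable_snd

variable (T L b v) in
lemma treeIdx_zero (hg : Monotone g) (hg0 : g 0 = 0) : T.treeIdx g L (fun _ => 0) b v = 0 := by
  induction v using T.induction_children with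
  | h v ih =>
    have hsum : T.treeSum g L (fun _ => 0) b v = 0 := by
      rw [treeSum, Finset.sum_eq_zero fun w hw => by rw [ih w hw, hg0], add_zero]
    rw [treeIdx_eq, hsum, roundIdx_zero hg hg0]

variable (g L x b) in
lemma treeIdx_update_of_notMem {a : V} (ha : a ∉ T.subtree v) (s : ℝ) :
    T.treeIdx g L x (Function.update b a s) v = T.treeIdx g L x b v := by
  induction v using T.induction_children with
  | h v ih =>
    have hva : v ≠ a := fun hv => ha (hv ▸ self_mem_subtree v)
    rw [treeIdx_eq, treeIdx_eq, Function.update_of_ne hva, treeSum, treeSum]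
    congr 2
    exact Finset.sum_congr rfl fun w hw => by
      rw [ih w hw fun haw => ha (subtree_subset hw haw)]

variable (T g L x b v) in
lemma treeSum_update (s : ℝ) :
    T.treeSum g L x (Function.update b v s) v = T.treeSum g L x b v := by
  rw [treeSum, treeSum]
  congr 1
  exact Finset.sum_congr rfl fun w hw => by
    rw [treeIdx_update_of_notMem g L x b (notMem_subtree_of_mem_children hw)]

variable (T g L x b v) in
lemma treeIdx_update_self (s : ℝ) :
    T.treeIdx g L x (Function.update b v s) v = roundIdx g L (T.treeSum g L x b v) s := by
  rw [treeIdx_eq, treeSum_update, Function.update_self]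

variable (T g L x) in
lemma integrable_comp_treeIdx (F : (V → ℕ) → ℝ) :
    Integrable (fun b => F (T.treeIdx g L x b)) (unitUniforms V) := by
  have hmeas : Measurable (T.treeIdx g L x) :=
    measurable_pi_lambda _ fun v => (T.measurable_treeIdx g L v).comp measurable_prodMk_left
  refine .of_bound (C := ∑ i ∈ Fintype.piFinset fun _ => Finset.range (L + 1), |F i|)
    ((measurable_of_countable F).comp hmeas).aestronglyMeasurable (.of_forall fun b => ?_)
  exact Finset.single_le_sum (f := fun i => |F i|) (fun i _ => abs_nonneg _)
    (Fintype.mem_piFinset.2 fun v =>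
      Finset.mem_range.2 (Nat.lt_succ_of_le (T.treeIdx_le g L x b v)))

lemma treeSum_nonneg (hg : Monotone g) (hg0 : g 0 = 0) (hx : ∀ v, 0 ≤ x v) (b : V → ℝ) (v : V) :
    0 ≤ T.treeSum g L x b v :=
  add_nonneg (hx v) (Finset.sum_nonneg fun _ _ => hg0 ▸ hg (Nat.zero_le _))

lemma integral_treeIdx_mul_eq (hg : StrictMono g) (hg0 : g 0 = 0) (hx : ∀ v, 0 ≤ x v)
    (F : (V → ℕ) → ℝ)
    (hF : ∀ b s, F (T.treeIdx g L x (Function.update b v s)) = F (T.treeIdx g L x b)) :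
    ∫ b, g (T.treeIdx g L x b v) * F (T.treeIdx g L x b) ∂unitUniforms V =
      ∫ b, min (T.treeSum g L x b v) (g L) * F (T.treeIdx g L x b)
        ∂unitUniforms V := by
  rw [integral_pi_eq_integral_integral_update _ v
    (T.integrable_comp_treeIdx g L x fun i => g (i v) * F i)]
  congr with b
  simp only [hF, treeIdx_update_self]
  rw [integral_mul_const, integral_round hg (hg0 ▸ treeSum_nonneg hg.monotone hg0 hx b v)]

/-- The rounded value at `v` is at most unbiased (the loss comes from the largest grid point),
conditionally on everything outside the subtree of `v`. -/
lemma integral_treeIdx_mul_le (hg : StrictMono g) (hg0 : g 0 = 0) (hx : ∀ v, 0 ≤ x v)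
    (F : (V → ℕ) → ℝ) (hF0 : ∀ i, 0 ≤ F i) (hF : ∀ a ∈ T.subtree v, ∀ b s,
      F (T.treeIdx g L x (Function.update b a s)) = F (T.treeIdx g L x b)) :
    ∫ b, g (T.treeIdx g L x b v) * F (T.treeIdx g L x b) ∂unitUniforms V ≤
      T.subtreeSum x v * ∫ b, F (T.treeIdx g L x b) ∂unitUniforms V := by
  have hint := T.integrable_comp_treeIdx g L x
  induction v using T.induction_children with
  | h v ih =>
    calc ∫ b, g (T.treeIdx g L x b v) * F (T.treeIdx g L x b) ∂unitUniforms V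
        = ∫ b, min (T.treeSum g L x b v) (g L) * F (T.treeIdx g L x b)
            ∂unitUniforms V :=
          integral_treeIdx_mul_eq hg hg0 hx F (hF v (self_mem_subtree v))
      _ ≤ ∫ b, (x v * F (T.treeIdx g L x b) + ∑ w ∈ T.children v,
            g (T.treeIdx g L x b w) * F (T.treeIdx g L x b))
            ∂unitUniforms V := by
          refine integral_mono (hint fun i => min (x v + ∑ w ∈ T.children v, g (i w)) (g L) * F i)
            (hint fun i => x v * F i + ∑ w ∈ T.children v, g (i w) * F i) fun b => ?_
          simp only [← Finset.sum_mul, ← add_mul]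
          exact mul_le_mul_of_nonneg_right (min_le_left _ _) (hF0 _)
      _ = x v * ∫ b, F (T.treeIdx g L x b) ∂unitUniforms V +
            ∑ w ∈ T.children v, ∫ b, g (T.treeIdx g L x b w) * F (T.treeIdx g L x b)
              ∂unitUniforms V := by
          rw [integral_add (hint fun i => x v * F i)
            (hint fun i => ∑ w ∈ T.children v, g (i w) * F i), integral_const_mul,
            integral_finsetSum _ fun w _ => hint fun i => g (i w) * F i]
      _ ≤ _ := by
          rw [subtreeSum_eq, add_mul, Finset.sum_mul]
          gcongr with w hw
          exact ih w hw fun a ha => hF a (subtree_subset hw ha)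

lemma integral_treeIdx_le (hg : StrictMono g) (hg0 : g 0 = 0) (hx : ∀ v, 0 ≤ x v) (v : V) :
    ∫ b, g (T.treeIdx g L x b v) ∂unitUniforms V ≤ T.subtreeSum x v := by
  simpa using integral_treeIdx_mul_le (L := L) hg hg0 hx (fun _ => 1) (fun _ => zero_le_one)
    (v := v) fun _ _ _ _ => rfl

end TreeRounding

end ParentTree

lemma sq_add_sum_sub_sum_sq {W : Type*} [DecidableEq W] (s : Finset W) (a : ℝ) (y : W → ℝ) :
    (a + ∑ w ∈ s, y w) ^ 2 - ∑ w ∈ s, y w ^ 2 =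
      a ^ 2 + 2 * a * ∑ w ∈ s, y w + ∑ w ∈ s, ∑ w' ∈ s.erase w, y w * y w' := by
  have hsq : (∑ w ∈ s, y w) ^ 2 = ∑ w ∈ s, y w ^ 2 + ∑ w ∈ s, ∑ w' ∈ s.erase w, y w * y w' := by
    rw [sq, Finset.sum_mul_sum, ← Finset.sum_add_distrib]
    exact Finset.sum_congr rfl fun w hw => by rw [← Finset.add_sum_erase s _ hw]; ring
  linear_combination hsq

namespace ParentTree

variable {V : Type*} [Fintype V] [DecidableEq V] {T : ParentTree V} {g : ℕ → ℝ} {L : ℕ}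
  {x : V → ℝ} {τ γ : ℝ}

lemma integral_treeIdx_mul_treeIdx_le (hg : StrictMono g) (hg0 : g 0 = 0) (hx : ∀ v, 0 ≤ x v)
    {v w : V} (hvw : Disjoint (T.subtree v) (T.subtree w)) :
    ∫ b, g (T.treeIdx g L x b v) * g (T.treeIdx g L x b w) ∂unitUniforms V ≤
      T.subtreeSum x v * T.subtreeSum x w := by
  refine (integral_treeIdx_mul_le hg hg0 hx (fun i => g (i w))
    (fun _ => hg0 ▸ hg.monotone (Nat.zero_le _)) fun a ha b s => ?_).trans
      (mul_le_mul_of_nonneg_left (integral_treeIdx_le hg hg0 hx w) (subtreeSum_nonneg hx v))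
  rw [treeIdx_update_of_notMem g L x b (Finset.disjoint_left.1 hvw ha)]

lemma integral_treeSum_sq_sub_le (hg : StrictMono g) (hg0 : g 0 = 0) (hx : ∀ v, 0 ≤ x v) (v : V) :
    ∫ b, (T.treeSum g L x b v ^ 2 - ∑ w ∈ T.children v, g (T.treeIdx g L x b w) ^ 2)
        ∂unitUniforms V ≤
      T.subtreeSum x v ^ 2 - ∑ w ∈ T.children v, T.subtreeSum x w ^ 2 := by
  have hint := T.integrable_comp_treeIdx g L x
  simp only [treeSum, subtreeSum_eq x v, sq_add_sum_sub_sum_sq]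
  rw [integral_add (hint fun i => x v ^ 2 + 2 * x v * ∑ w ∈ T.children v, g (i w))
      (hint fun i => ∑ w ∈ T.children v, ∑ w' ∈ (T.children v).erase w, g (i w) * g (i w')),
    integral_add (integrable_const _) (hint fun i => 2 * x v * ∑ w ∈ T.children v, g (i w)),
    integral_const_mul, integral_finsetSum _ fun w _ => hint fun i => g (i w),
    integral_finsetSum _ fun w _ => hint fun i =>
      ∑ w' ∈ (T.children v).erase w, g (i w) * g (i w')]
  have hxv := hx v
  gcongr with w _ w hw
  · simp
  · exact integral_treeIdx_le hg hg0 hx w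
  · rw [integral_finsetSum _ fun w' _ => hint fun i => g (i w) * g (i w')]
    refine Finset.sum_le_sum fun w' hw' => ?_
    obtain ⟨hne, hchild⟩ := Finset.mem_erase.1 hw'
    exact integral_treeIdx_mul_treeIdx_le hg hg0 hx (disjoint_subtree hw hchild hne.symm)

lemma integral_treeIdx_sq_le_children (hτ : 0 < τ) (hγ : 0 < γ) (hx : ∀ v, 0 ≤ x v) (v : V) :
    ∫ b, grid τ γ (T.treeIdx (grid τ γ) L x b v) ^ 2 ∂unitUniforms V ≤
      (1 + γ) * (T.subtreeSum x v ^ 2 - ∑ w ∈ T.children v, T.subtreeSum x w ^ 2) +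
        ∑ w ∈ T.children v, ∫ b, grid τ γ (T.treeIdx (grid τ γ) L x b w) ^ 2 ∂unitUniforms V +
        τ * x v := by
  have hint := T.integrable_comp_treeIdx (grid τ γ) L x
  let offDiag (i : V → ℕ) : ℝ := (x v + ∑ w ∈ T.children v, grid τ γ (i w)) ^ 2 -
    ∑ w ∈ T.children v, grid τ γ (i w) ^ 2
  calc ∫ b, grid τ γ (T.treeIdx (grid τ γ) L x b v) ^ 2 ∂unitUniforms V
      = ∫ b, ∫ s, grid τ γ (roundIdx (grid τ γ) L (T.treeSum (grid τ γ) L x b v) s) ^ 2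
          ∂unitUniform ∂unitUniforms V := by
        rw [integral_pi_eq_integral_integral_update _ v (hint fun i => grid τ γ (i v) ^ 2)]
        simp only [treeIdx_update_self]
    _ ≤ ∫ b, ((1 + γ) * offDiag (T.treeIdx (grid τ γ) L x b) +
          ∑ w ∈ T.children v, grid τ γ (T.treeIdx (grid τ γ) L x b w) ^ 2 + τ * x v)
          ∂unitUniforms V :=
        integral_mono_of_nonneg (.of_forall fun b => integral_nonneg fun s => sq_nonneg _)
          (hint fun i => (1 + γ) * offDiag i + ∑ w ∈ T.children v, grid τ γ (i w) ^ 2 + τ * x v)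
          (.of_forall fun b => integral_round_sq_le hτ hγ (hx v) rfl L)
    _ = (1 + γ) * ∫ b, offDiag (T.treeIdx (grid τ γ) L x b) ∂unitUniforms V +
          ∑ w ∈ T.children v, ∫ b, grid τ γ (T.treeIdx (grid τ γ) L x b w) ^ 2 ∂unitUniforms V +
          τ * x v := by
        rw [integral_add (hint fun i => (1 + γ) * offDiag i +
            ∑ w ∈ T.children v, grid τ γ (i w) ^ 2) (integrable_const _),
          integral_add (hint fun i => (1 + γ) * offDiag i)
            (hint fun i => ∑ w ∈ T.children v, grid τ γ (i w) ^ 2), integral_const_mul,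
          integral_finsetSum _ fun w _ => hint fun i => grid τ γ (i w) ^ 2]
        simp
    _ ≤ _ := by
        gcongr
        exact integral_treeSum_sq_sub_le (grid_strictMono hτ hγ) rfl hx v

lemma integral_treeIdx_sq_le (hτ : 0 < τ) (hγ : 0 < γ) (hx : ∀ v, 0 ≤ x v) (v : V) :
    ∫ b, grid τ γ (T.treeIdx (grid τ γ) L x b v) ^ 2 ∂unitUniforms V ≤
      (1 + γ) * T.subtreeSum x v ^ 2 + τ * T.subtreeSum x v := by
  induction v using T.induction_children with
  | h v ih =>
    have hsum := Finset.sum_le_sum ih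
    rw [Finset.sum_add_distrib, ← Finset.mul_sum, ← Finset.mul_sum] at hsum
    have hmul : τ * T.subtreeSum x v = τ * x v + τ * ∑ w ∈ T.children v, T.subtreeSum x w := by
      rw [subtreeSum_eq, mul_add]
    linarith [integral_treeIdx_sq_le_children (T := T) (L := L) hτ hγ hx v]

lemma integral_treeSum_sq_le (hτ : 0 < τ) (hγ : 0 < γ) (hx : ∀ v, 0 ≤ x v) (v : V) :
    ∫ b, T.treeSum (grid τ γ) L x b v ^ 2 ∂unitUniforms V ≤
      (1 + γ) * T.subtreeSum x v ^ 2 + τ * T.subtreeSum x v := by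
  have hint := T.integrable_comp_treeIdx (grid τ γ) L x
  have hoff := integral_treeSum_sq_sub_le (T := T) (L := L) (grid_strictMono hτ hγ) rfl hx v
  have hsum_sq : Integrable (fun b => T.treeSum (grid τ γ) L x b v ^ 2) (unitUniforms V) :=
    hint fun i => (x v + ∑ w ∈ T.children v, grid τ γ (i w)) ^ 2
  rw [integral_sub hsum_sq (hint fun i => ∑ w ∈ T.children v, grid τ γ (i w) ^ 2),
    integral_finsetSum _ fun w _ => hint fun i => grid τ γ (i w) ^ 2] at hoff
  have hchildren := Finset.sum_le_sum fun w (_ : w ∈ T.children v) =>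
    integral_treeIdx_sq_le (T := T) (L := L) hτ hγ hx w
  rw [Finset.sum_add_distrib, ← Finset.mul_sum, ← Finset.mul_sum] at hchildren
  have hX := T.subtreeSum_eq x v
  have hle : ∑ w ∈ T.children v, T.subtreeSum x w ≤ T.subtreeSum x v := by linarith [hx v]
  have hsq : ∑ w ∈ T.children v, T.subtreeSum x w ^ 2 ≤ T.subtreeSum x v ^ 2 := by
    refine (Finset.sum_sq_le_sq_sum_of_nonneg fun w _ => subtreeSum_nonneg hx w).trans ?_
    exact pow_le_pow_left₀ (Finset.sum_nonneg fun w _ => subtreeSum_nonneg hx w) hle 2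
  linarith [mul_le_mul_of_nonneg_left hsq hγ.le, mul_le_mul_of_nonneg_left hle hτ.le]

lemma integral_treeSum_sub_le (hg : StrictMono g) (hg0 : g 0 = 0) (hx : ∀ v, 0 ≤ x v) (hL : 0 < L)
    (v : V) :
    ∫ b, T.treeSum g L x b v ∂unitUniforms V -
        (∫ b, T.treeSum g L x b v ^ 2 ∂unitUniforms V) / g L ≤
      ∫ b, g (T.treeIdx g L x b v) ∂unitUniforms V := by
  have hint := T.integrable_comp_treeIdx g L x
  have hgL : 0 < g L := hg0 ▸ hg hL
  have hmean := integral_treeIdx_mul_eq (T := T) (L := L) (v := v) hg hg0 hx (fun _ => 1)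
    fun _ _ => rfl
  simp only [mul_one, treeSum] at hmean ⊢
  rw [hmean, ← integral_div, ← integral_sub (hint fun i => x v + ∑ w ∈ T.children v, g (i w))
    (hint fun i => (x v + ∑ w ∈ T.children v, g (i w)) ^ 2 / g L)]
  refine integral_mono
    (hint fun i => (x v + ∑ w ∈ T.children v, g (i w)) -
      (x v + ∑ w ∈ T.children v, g (i w)) ^ 2 / g L)
    (hint fun i => min (x v + ∑ w ∈ T.children v, g (i w)) (g L)) fun b => le_min ?_ ?_
  · exact sub_le_self _ (div_nonneg (sq_nonneg _) hgL.le)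
  · rw [sub_le_iff_le_add, ← sub_le_iff_le_add', le_div_iff₀ hgL]
    nlinarith [sq_nonneg ((x v + ∑ w ∈ T.children v, g (T.treeIdx g L x b w)) - g L)]

/-- Each vertex of the subtree contributes at most `((1 + γ) X ^ 2 + τ X) / g L` to the bias, by
Markov's inequality for the square of its sum. -/
lemma le_integral_treeIdx (hτ : 0 < τ) (hγ : 0 < γ) (hx : ∀ v, 0 ≤ x v) (hL : 0 < L) (v : V) :
    T.subtreeSum x v - (T.subtree v).card *
        (((1 + γ) * (∑ a, x a) ^ 2 + τ * ∑ a, x a) / grid τ γ L) ≤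
      ∫ b, grid τ γ (T.treeIdx (grid τ γ) L x b v) ∂unitUniforms V := by
  have hint := T.integrable_comp_treeIdx (grid τ γ) L x
  have hg := grid_strictMono hτ hγ
  induction v using T.induction_children with
  | h v ih =>
    have hloss : (∫ b, T.treeSum (grid τ γ) L x b v ^ 2 ∂unitUniforms V) / grid τ γ L ≤
        ((1 + γ) * (∑ a, x a) ^ 2 + τ * ∑ a, x a) / grid τ γ L := by
      have hX0 := T.subtreeSum_nonneg hx v
      have hX := T.subtreeSum_le_sum hx v
      refine div_le_div_of_nonneg_right ((integral_treeSum_sq_le hτ hγ hx v).trans ?_)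
        (grid_nonneg hτ hγ L)
      gcongr
    have hsum : ∫ b, T.treeSum (grid τ γ) L x b v ∂unitUniforms V = x v +
        ∑ w ∈ T.children v, ∫ b, grid τ γ (T.treeIdx (grid τ γ) L x b w) ∂unitUniforms V := by
      simp only [treeSum]
      rw [integral_add (integrable_const _) (hint fun i => ∑ w ∈ T.children v, grid τ γ (i w)),
        integral_finsetSum _ fun w _ => hint fun i => grid τ γ (i w)]
      simp
    have hchildren := Finset.sum_le_sum ih
    rw [Finset.sum_sub_distrib, ← Finset.sum_mul] at hchildren
    have hcard : ((T.subtree v).card : ℝ) = 1 + ∑ w ∈ T.children v, ((T.subtree w).card : ℝ) := by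
      simpa [subtreeSum] using T.subtreeSum_eq (fun _ => 1) v
    rw [hcard, subtreeSum_eq]
    linarith [integral_treeSum_sub_le (T := T) hg rfl hx hL v]

lemma integral_treeIdx_root_sub_sq_le (hτ : 0 < τ) (hγ : 0 < γ) (hx : ∀ v, 0 ≤ x v) (hL : 0 < L)
    {z : ℝ} (hz : z = ∑ a, x a) :
    ∫ b, (grid τ γ (T.treeIdx (grid τ γ) L x b T.root) - z) ^ 2 ∂unitUniforms V ≤
      γ * z ^ 2 + τ * z +
        2 * z * (Fintype.card V * (((1 + γ) * z ^ 2 + τ * z) / grid τ γ L)) := by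
  have hint := T.integrable_comp_treeIdx (grid τ γ) L x
  have hsecond := integral_treeIdx_sq_le (T := T) (L := L) hτ hγ hx T.root
  have hfirst := le_integral_treeIdx (T := T) hτ hγ hx hL T.root
  rw [subtreeSum_root, ← hz] at hsecond hfirst
  rw [subtree_root, Finset.card_univ] at hfirst
  have hz0 : 0 ≤ z := hz ▸ Finset.sum_nonneg fun a _ => hx a
  have hexpand : ∫ b, (grid τ γ (T.treeIdx (grid τ γ) L x b T.root) - z) ^ 2 ∂unitUniforms V =
      ∫ b, grid τ γ (T.treeIdx (grid τ γ) L x b T.root) ^ 2 ∂unitUniforms V -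
        2 * z * ∫ b, grid τ γ (T.treeIdx (grid τ γ) L x b T.root) ∂unitUniforms V + z ^ 2 := by
    simp only [sub_sq', mul_assoc, mul_comm _ z]
    rw [integral_sub (hint fun i => grid τ γ (i T.root) ^ 2 + z ^ 2)
        (hint fun i => z * (2 * grid τ γ (i T.root))),
      integral_add (hint fun i => grid τ γ (i T.root) ^ 2) (integrable_const _),
      integral_const_mul, integral_const_mul]
    simp only [integral_const, probReal_univ, one_smul]
    ring
  rw [hexpand]
  nlinarith [mul_le_mul_of_nonneg_left hfirst hz0]

end ParentTree

/-! ### Moments via the Laplace transform -/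

lemma integrableOn_rpow_mul_min {q r C : ℝ} (hq : 0 < q) (hqr : q < r) (hC : 0 ≤ C) :
    IntegrableOn (fun t : ℝ => t ^ (-1 - q) * min 1 (C * t ^ r)) (Set.Ioi 0) := by
  have hmeas : Measurable fun t : ℝ => t ^ (-1 - q) * min 1 (C * t ^ r) := by fun_prop
  have hnorm {t : ℝ} (ht : 0 < t) : ‖t ^ (-1 - q) * min 1 (C * t ^ r)‖ =
      t ^ (-1 - q) * min 1 (C * t ^ r) := Real.norm_of_nonneg (by positivity)
  rw [← Set.Ioc_union_Ioi_eq_Ioi zero_le_one]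
  refine IntegrableOn.union ?_ ?_
  · have hdom : IntegrableOn (fun t : ℝ => C * t ^ (r - 1 - q)) (Set.Ioc 0 1) := by
      refine Integrable.const_mul ?_ _
      rw [← IntegrableOn, ← intervalIntegrable_iff_integrableOn_Ioc_of_le zero_le_one]
      exact intervalIntegral.intervalIntegrable_rpow' (by linarith)
    refine hdom.mono' hmeas.aestronglyMeasurable ?_
    filter_upwards [ae_restrict_mem measurableSet_Ioc] with t ht
    calc ‖t ^ (-1 - q) * min 1 (C * t ^ r)‖ = t ^ (-1 - q) * min 1 (C * t ^ r) := hnorm ht.1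
      _ ≤ t ^ (-1 - q) * (C * t ^ r) :=
          mul_le_mul_of_nonneg_left (min_le_right _ _) (Real.rpow_nonneg ht.1.le _)
      _ = C * t ^ (r - 1 - q) := by
          rw [show r - 1 - q = (-1 - q) + r by ring, Real.rpow_add ht.1]; ring
  · refine (integrableOn_Ioi_rpow_of_lt (a := -1 - q) (by linarith) zero_lt_one).mono'
      hmeas.aestronglyMeasurable ?_
    filter_upwards [ae_restrict_mem measurableSet_Ioi] with t ht
    have ht0 : 0 < t := zero_lt_one.trans ht
    rw [hnorm ht0]
    exact mul_le_of_le_one_right (Real.rpow_nonneg ht0.le _) (min_le_left _ _)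

lemma integral_rpow_mul_comp_mul (q : ℝ) (H : ℝ → ℝ) {s : ℝ} (hs : 0 < s) :
    ∫ t in Set.Ioi (0 : ℝ), t ^ (-1 - q) * H (s * t) =
      s ^ q * ∫ t in Set.Ioi (0 : ℝ), t ^ (-1 - q) * H t := by
  have hsubst := integral_comp_mul_left_Ioi (fun t => t ^ (-1 - q) * H t) 0 hs
  calc ∫ t in Set.Ioi (0 : ℝ), t ^ (-1 - q) * H (s * t)
      = s ^ (1 + q) * ∫ t in Set.Ioi (0 : ℝ), (s * t) ^ (-1 - q) * H (s * t) := by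
        rw [← integral_const_mul]
        refine setIntegral_congr_fun measurableSet_Ioi fun t ht => ?_
        have hcancel : s ^ (1 + q) * s ^ (-1 - q) = 1 := by rw [← Real.rpow_add hs]; norm_num
        simp only [Real.mul_rpow hs.le (le_of_lt ht)]
        linear_combination -(t ^ (-1 - q) * H (s * t)) * hcancel
    _ = s ^ q * ∫ t in Set.Ioi (0 : ℝ), t ^ (-1 - q) * H t := by
        rw [hsubst, mul_zero, smul_eq_mul, ← mul_assoc, Real.rpow_add hs, Real.rpow_one]
        field_simp

/-- The normalizing constant in `z ^ q = (laplaceConst q)⁻¹ ∫ t ^ (-1 - q) (1 - exp (-tz)) dt`, the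
formula that expresses fractional moments by the Laplace transform. -/
def laplaceConst (q : ℝ) : ℝ := ∫ t in Set.Ioi (0 : ℝ), t ^ (-1 - q) * (1 - Real.exp (-t))

lemma one_sub_exp_neg_nonneg {t : ℝ} (ht : 0 ≤ t) : 0 ≤ 1 - Real.exp (-t) :=
  sub_nonneg.2 (Real.exp_le_one_iff.2 (neg_nonpos.2 ht))

lemma one_sub_exp_neg_le_min (t : ℝ) : 1 - Real.exp (-t) ≤ min 1 t :=
  le_min (by linarith [Real.exp_pos (-t)]) (by linarith [Real.add_one_le_exp (-t)])

lemma integrableOn_rpow_mul {q r C : ℝ} (hq : 0 < q) (hqr : q < r) {G : ℝ → ℝ}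
    (hG : Measurable G) (hG0 : ∀ t, 0 < t → 0 ≤ G t)
    (hG1 : ∀ t, 0 < t → G t ≤ min 1 (C * t ^ r)) :
    IntegrableOn (fun t : ℝ => t ^ (-1 - q) * G t) (Set.Ioi 0) := by
  refine (integrableOn_rpow_mul_min hq hqr (abs_nonneg C)).mono'
    ((by fun_prop : Measurable fun t : ℝ => t ^ (-1 - q) * G t).aestronglyMeasurable) ?_
  filter_upwards [ae_restrict_mem measurableSet_Ioi] with t (ht : 0 < t)
  rw [Real.norm_of_nonneg (mul_nonneg (by positivity) (hG0 t ht))]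
  gcongr
  refine (hG1 t ht).trans (min_le_min le_rfl ?_)
  gcongr
  exact le_abs_self C

lemma integral_rpow_mul_pos {q r C : ℝ} (hq : 0 < q) (hqr : q < r) {G : ℝ → ℝ}
    (hG : Measurable G) (hG0 : ∀ t, 0 < t → 0 < G t)
    (hG1 : ∀ t, 0 < t → G t ≤ min 1 (C * t ^ r)) :
    0 < ∫ t in Set.Ioi (0 : ℝ), t ^ (-1 - q) * G t := by
  have hpos : ∀ t ∈ Set.Ioi (0 : ℝ), 0 < t ^ (-1 - q) * G t := fun t ht =>
    mul_pos (Real.rpow_pos_of_pos ht _) (hG0 t ht)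
  have hsupport : Function.support (fun t : ℝ => t ^ (-1 - q) * G t) ∩ Set.Ioi 0 = Set.Ioi 0 :=
    Set.inter_eq_right.2 fun t ht => (hpos t ht).ne'
  rw [setIntegral_pos_iff_support_of_nonneg_ae
    ((ae_restrict_mem measurableSet_Ioi).mono fun t ht => (hpos t ht).le)
    (integrableOn_rpow_mul hq hqr hG (fun t ht => (hG0 t ht).le) hG1), hsupport]
  simp

lemma laplaceConst_pos {q : ℝ} (hq : 0 < q) (hq1 : q < 1) : 0 < laplaceConst q := by
  refine integral_rpow_mul_pos (C := 1) hq hq1 (by fun_prop) (fun t ht => ?_) fun t _ => ?_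
  · exact sub_pos.2 (Real.exp_lt_one_iff.2 (by linarith))
  · simpa using one_sub_exp_neg_le_min t

lemma integral_rpow_mul_one_sub_exp {q : ℝ} (hq : 0 < q) {z : ℝ} (hz : 0 ≤ z) :
    ∫ t in Set.Ioi (0 : ℝ), t ^ (-1 - q) * (1 - Real.exp (-(t * z))) =
      z ^ q * laplaceConst q := by
  rcases hz.eq_or_lt with rfl | hz
  · simp [Real.zero_rpow hq.ne']
  · rw [laplaceConst, ← integral_rpow_mul_comp_mul q (fun t => 1 - Real.exp (-t)) hz]
    simp only [mul_comm z]

lemma rpow_mul_one_sub_exp_nonneg {t z : ℝ} (ht : 0 ≤ t) (hz : 0 ≤ z) (q : ℝ) :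
    0 ≤ t ^ (-1 - q) * (1 - Real.exp (-(t * z))) :=
  mul_nonneg (Real.rpow_nonneg ht _) (one_sub_exp_neg_nonneg (mul_nonneg ht hz))

lemma ofReal_rpow_mul_laplaceConst {q : ℝ} (hq : 0 < q) (hq1 : q < 1) {z : ℝ} (hz : 0 ≤ z) :
    ENNReal.ofReal (z ^ q * laplaceConst q) =
      ∫⁻ t in Set.Ioi (0 : ℝ), ENNReal.ofReal (t ^ (-1 - q) * (1 - Real.exp (-(t * z)))) := by
  rw [← integral_rpow_mul_one_sub_exp hq hz, ofReal_integral_eq_lintegral_ofReal]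
  · refine integrableOn_rpow_mul (C := z) hq hq1 (by fun_prop) (fun t ht => ?_) fun t _ => ?_
    · exact one_sub_exp_neg_nonneg (mul_nonneg ht.le hz)
    · simpa [mul_comm] using one_sub_exp_neg_le_min (t * z)
  · exact (ae_restrict_mem measurableSet_Ioi).mono fun t ht =>
      rpow_mul_one_sub_exp_nonneg (le_of_lt ht) hz q

section LaplaceTransform

variable {Ω : Type*} [MeasurableSpace Ω] {μ : Measure Ω} {q r C : ℝ} {Z : Ω → ℝ}

lemma integrable_one_sub_exp [IsFiniteMeasure μ] (hZ : Measurable Z) (hZ0 : ∀ ω, 0 ≤ Z ω) {t : ℝ}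
    (ht : 0 ≤ t) : Integrable (fun ω => 1 - Real.exp (-(t * Z ω))) μ := by
  refine .of_bound (C := 1) (by fun_prop) (.of_forall fun ω => ?_)
  rw [Real.norm_of_nonneg (one_sub_exp_neg_nonneg (mul_nonneg ht (hZ0 ω)))]
  exact (one_sub_exp_neg_le_min _).trans (min_le_left _ _)

lemma measurable_integral_one_sub_exp [SFinite μ] (hZ : Measurable Z) :
    Measurable fun t : ℝ => ∫ ω, (1 - Real.exp (-(t * Z ω))) ∂μ := by
  have hjoint : Measurable fun z : ℝ × Ω => 1 - Real.exp (-(z.1 * Z z.2)) := by fun_prop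
  exact hjoint.stronglyMeasurable.integral_prod_right.measurable

lemma integral_one_sub_exp_nonneg (hZ0 : ∀ ω, 0 ≤ Z ω) {t : ℝ} (ht : 0 ≤ t) :
    0 ≤ ∫ ω, (1 - Real.exp (-(t * Z ω))) ∂μ :=
  integral_nonneg fun ω => one_sub_exp_neg_nonneg (mul_nonneg ht (hZ0 ω))

lemma integral_one_sub_exp_le_one [IsProbabilityMeasure μ] (hZ : Measurable Z)
    (hZ0 : ∀ ω, 0 ≤ Z ω) {t : ℝ} (ht : 0 ≤ t) : ∫ ω, (1 - Real.exp (-(t * Z ω))) ∂μ ≤ 1 := by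
  calc ∫ ω, (1 - Real.exp (-(t * Z ω))) ∂μ ≤ ∫ _, (1 : ℝ) ∂μ :=
        integral_mono (integrable_one_sub_exp hZ hZ0 ht) (integrable_const _)
          fun ω => (one_sub_exp_neg_le_min _).trans (min_le_left _ _)
    _ = 1 := by simp

lemma integral_exp_neg_eq_one_sub [IsProbabilityMeasure μ] (hZ : Measurable Z)
    (hZ0 : ∀ ω, 0 ≤ Z ω) {t : ℝ} (ht : 0 ≤ t) :
    ∫ ω, Real.exp (-(t * Z ω)) ∂μ = 1 - ∫ ω, (1 - Real.exp (-(t * Z ω))) ∂μ := by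
  have hsub := integral_sub (integrable_const (1 : ℝ)) (integrable_one_sub_exp (μ := μ) hZ hZ0 ht)
  simpa only [sub_sub_cancel, integral_const, probReal_univ, one_smul] using hsub

lemma lintegral_rpow_mul_laplaceConst [IsFiniteMeasure μ] (hq : 0 < q) (hq1 : q < 1)
    (hZ : Measurable Z) (hZ0 : ∀ ω, 0 ≤ Z ω) :
    ∫⁻ ω, ENNReal.ofReal (Z ω ^ q * laplaceConst q) ∂μ = ∫⁻ t in Set.Ioi (0 : ℝ),
      ENNReal.ofReal (t ^ (-1 - q) * ∫ ω, (1 - Real.exp (-(t * Z ω))) ∂μ) := by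
  simp only [fun ω => ofReal_rpow_mul_laplaceConst hq hq1 (hZ0 ω)]
  rw [lintegral_lintegral_swap (by simp only [Function.uncurry_def]; fun_prop)]
  refine setLIntegral_congr_fun measurableSet_Ioi fun t ht => ?_
  rw [← integral_const_mul, ofReal_integral_eq_lintegral_ofReal
    ((integrable_one_sub_exp hZ hZ0 (le_of_lt ht)).const_mul _)
    (.of_forall fun ω => rpow_mul_one_sub_exp_nonneg (le_of_lt ht) (hZ0 ω) q)]

lemma integral_rpow_eq_laplace [IsProbabilityMeasure μ] (hq : 0 < q) (hq1 : q < 1) (hqr : q < r)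
    (hZ : Measurable Z) (hZ0 : ∀ ω, 0 ≤ Z ω)
    (hC : ∀ t, 0 < t → ∫ ω, (1 - Real.exp (-(t * Z ω))) ∂μ ≤ C * t ^ r) :
    Integrable (fun ω => Z ω ^ q) μ ∧ (∫ ω, Z ω ^ q ∂μ) * laplaceConst q =
      ∫ t in Set.Ioi (0 : ℝ), t ^ (-1 - q) * ∫ ω, (1 - Real.exp (-(t * Z ω))) ∂μ := by
  have hI := laplaceConst_pos hq hq1
  have hGint := integrableOn_rpow_mul hq hqr (measurable_integral_one_sub_exp (μ := μ) hZ)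
    (fun t ht => integral_one_sub_exp_nonneg hZ0 ht.le)
    fun t ht => le_min (integral_one_sub_exp_le_one hZ hZ0 ht.le) (hC t ht)
  have hG0 : 0 ≤ᵐ[volume.restrict (Set.Ioi (0 : ℝ))]
      fun t => t ^ (-1 - q) * ∫ ω, (1 - Real.exp (-(t * Z ω))) ∂μ :=
    (ae_restrict_mem measurableSet_Ioi).mono fun t ht =>
      mul_nonneg (Real.rpow_nonneg (le_of_lt ht) _) (integral_one_sub_exp_nonneg hZ0 (le_of_lt ht))
  have hlintegral := lintegral_rpow_mul_laplaceConst (μ := μ) hq hq1 hZ hZ0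
  rw [← ofReal_integral_eq_lintegral_ofReal hGint hG0] at hlintegral
  have hnonneg : 0 ≤ᵐ[μ] fun ω => Z ω ^ q * laplaceConst q :=
    .of_forall fun ω => mul_nonneg (Real.rpow_nonneg (hZ0 ω) _) hI.le
  have hmeas : AEStronglyMeasurable (fun ω => Z ω ^ q * laplaceConst q) μ :=
    (by fun_prop : Measurable fun ω => Z ω ^ q * laplaceConst q).aestronglyMeasurable
  have hint : Integrable (fun ω => Z ω ^ q * laplaceConst q) μ := by
    refine ⟨hmeas, ?_⟩
    rw [hasFiniteIntegral_iff_ofReal hnonneg, hlintegral]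
    exact ENNReal.ofReal_lt_top
  refine ⟨by simpa [mul_assoc, hI.ne'] using hint.mul_const (laplaceConst q)⁻¹, ?_⟩
  rw [← integral_mul_const, integral_eq_lintegral_of_nonneg_ae hnonneg hmeas, hlintegral,
    ENNReal.toReal_ofReal (integral_nonneg_of_ae hG0)]

end LaplaceTransform

/-! ### The stable sketch -/

section Stable

open Filter Topology

/-- The function whose integral over `(0, ∞)` is the exponent of the one-sided stable law: `v` is
the arrival time of a jump of size `v ^ (-1 / p)`. -/
def stableDensity (p v : ℝ) : ℝ := 1 - Real.exp (-(v ^ (-p⁻¹)))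

lemma measurable_stableDensity (p : ℝ) : Measurable (stableDensity p) := by
  unfold stableDensity; fun_prop

lemma stableDensity_pos (p : ℝ) {v : ℝ} (hv : 0 < v) : 0 < stableDensity p v :=
  sub_pos.2 (Real.exp_lt_one_iff.2 (neg_lt_zero.2 (Real.rpow_pos_of_pos hv _)))

variable {p : ℝ}

lemma integrableOn_stableDensity (hp0 : 0 < p) (hp1 : p < 1) :
    IntegrableOn (stableDensity p) (Set.Ioi 0) := by
  have hmeas := measurable_stableDensity p
  rw [← Set.Ioc_union_Ioi_eq_Ioi zero_le_one]
  refine IntegrableOn.union ?_ ?_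
  · refine (integrable_const (1 : ℝ)).mono' hmeas.aestronglyMeasurable ?_
    filter_upwards [ae_restrict_mem measurableSet_Ioc] with t ht
    rw [Real.norm_of_nonneg (stableDensity_pos p ht.1).le]
    exact (one_sub_exp_neg_le_min _).trans (min_le_left _ _)
  · have hp : 1 < p⁻¹ := (one_lt_inv₀ hp0).2 hp1
    refine (integrableOn_Ioi_rpow_of_lt (a := -p⁻¹) (by linarith) zero_lt_one).mono'
      hmeas.aestronglyMeasurable ?_
    filter_upwards [ae_restrict_mem measurableSet_Ioi] with t ht
    rw [Real.norm_of_nonneg (stableDensity_pos p (zero_lt_one.trans ht)).le]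
    exact (one_sub_exp_neg_le_min _).trans (min_le_right _ _)

/-- The constant `c` in the Laplace transform `exp (-c t ^ p)` of the one-sided stable law. -/
def stableConst (p : ℝ) : ℝ := ∫ v in Set.Ioi (0 : ℝ), stableDensity p v

lemma stableConst_pos (hp0 : 0 < p) (hp1 : p < 1) : 0 < stableConst p := by
  have hsupport : Function.support (stableDensity p) ∩ Set.Ioi 0 = Set.Ioi 0 :=
    Set.inter_eq_right.2 fun t ht => (stableDensity_pos p ht).ne'
  rw [stableConst, setIntegral_pos_iff_support_of_nonneg_ae
    ((ae_restrict_mem measurableSet_Ioi).mono fun t ht => (stableDensity_pos p ht).le)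
    (integrableOn_stableDensity hp0 hp1), hsupport]
  simp

lemma integral_stableDensity_le (hp0 : 0 < p) (hp1 : p < 1) {K : ℝ} (hK : 0 ≤ K) :
    ∫ v in (0 : ℝ)..K, stableDensity p v ≤ stableConst p := by
  rw [intervalIntegral.integral_of_le hK, stableConst]
  refine setIntegral_mono_set (integrableOn_stableDensity hp0 hp1) ?_
    Set.Ioc_subset_Ioi_self.eventuallyLE
  exact (ae_restrict_mem measurableSet_Ioi).mono fun t ht => (stableDensity_pos p ht).le

/-- The jump `(N u) ^ (-1 / p)`: for independent uniform `u₁, …, u_N` the sum of these jumps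
converges in law to the one-sided `p`-stable law as `N → ∞`. -/
def stableJump (p : ℝ) (N : ℕ) (u : ℝ) : ℝ := (N : ℝ) ^ (-p⁻¹) * |u| ^ (-p⁻¹)

lemma measurable_stableJump (p : ℝ) (N : ℕ) : Measurable (stableJump p N) := by
  unfold stableJump; fun_prop

lemma stableJump_nonneg (p : ℝ) (N : ℕ) (u : ℝ) : 0 ≤ stableJump p N u := by
  unfold stableJump; positivity

/-- One minus the Laplace transform of a single jump. -/
def jumpExponent (p : ℝ) (N : ℕ) (s : ℝ) : ℝ :=
  ∫ u, (1 - Real.exp (-(s * stableJump p N u))) ∂unitUniform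

lemma jumpExponent_zero (p : ℝ) (N : ℕ) : jumpExponent p N 0 = 0 := by simp [jumpExponent]

lemma jumpExponent_nonneg (p : ℝ) (N : ℕ) {s : ℝ} (hs : 0 ≤ s) : 0 ≤ jumpExponent p N s :=
  integral_one_sub_exp_nonneg (stableJump_nonneg p N) hs

lemma jumpExponent_le_one (p : ℝ) (N : ℕ) {s : ℝ} (hs : 0 ≤ s) : jumpExponent p N s ≤ 1 :=
  integral_one_sub_exp_le_one (measurable_stableJump p N) (stableJump_nonneg p N) hs

lemma mul_jumpExponent_eq (hp0 : 0 < p) {s : ℝ} (hs : 0 < s) {N : ℕ} (hN : 0 < N) :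
    N * jumpExponent p N s = s ^ p * ∫ v in (0 : ℝ)..(N / s ^ p), stableDensity p v := by
  have hN' : (0 : ℝ) < N := Nat.cast_pos.2 hN
  have hsp : 0 < s ^ p := Real.rpow_pos_of_pos hs p
  have hK : 0 < N / s ^ p := div_pos hN' hsp
  have hdensity : jumpExponent p N s = ∫ u in (0 : ℝ)..1, stableDensity p (N / s ^ p * u) := by
    rw [jumpExponent, unitUniform, integral_Ico_eq_integral_Ioo,
      intervalIntegral.integral_of_le zero_le_one, integral_Ioc_eq_integral_Ioo]
    refine setIntegral_congr_fun measurableSet_Ioo fun u hu => ?_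
    simp only [stableDensity, stableJump]
    congr 3
    rw [abs_of_pos hu.1, Real.mul_rpow hK.le hu.1.le, Real.div_rpow hN'.le hsp.le,
      ← Real.rpow_mul hs.le, mul_neg, mul_inv_cancel₀ hp0.ne', Real.rpow_neg_one]
    field_simp
  rw [hdensity, intervalIntegral.integral_comp_mul_left _ hK.ne', mul_zero, mul_one, smul_eq_mul]
  field_simp

lemma mul_jumpExponent_le (hp0 : 0 < p) (hp1 : p < 1) {s : ℝ} (hs : 0 ≤ s) {N : ℕ}
    (hN : 0 < N) : N * jumpExponent p N s ≤ stableConst p * s ^ p := by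
  rcases hs.eq_or_lt with rfl | hs
  · simp [jumpExponent_zero, Real.zero_rpow hp0.ne']
  · rw [mul_jumpExponent_eq hp0 hs hN, mul_comm]
    gcongr
    exact integral_stableDensity_le hp0 hp1 (by positivity)

lemma tendsto_mul_jumpExponent (hp0 : 0 < p) (hp1 : p < 1) {s : ℝ} (hs : 0 ≤ s) :
    Tendsto (fun N : ℕ => N * jumpExponent p N s) atTop (𝓝 (stableConst p * s ^ p)) := by
  rcases hs.eq_or_lt with rfl | hs
  · simp [jumpExponent_zero, Real.zero_rpow hp0.ne']
  · have hcutoff : Tendsto (fun N : ℕ => (N : ℝ) / s ^ p) atTop atTop :=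
      tendsto_natCast_atTop_atTop.atTop_div_const (Real.rpow_pos_of_pos hs p)
    have hlim := (intervalIntegral_tendsto_integral_Ioi 0 (integrableOn_stableDensity hp0 hp1)
      hcutoff).const_mul (s ^ p)
    rw [mul_comm (stableConst p)]
    exact hlim.congr' ((eventually_gt_atTop 0).mono fun N hN =>
      (mul_jumpExponent_eq hp0 hs hN).symm)

lemma one_sub_prod_le_sum {ι : Type*} (s : Finset ι) (f : ι → ℝ) (h0 : ∀ i ∈ s, 0 ≤ f i)
    (h1 : ∀ i ∈ s, f i ≤ 1) : 1 - ∏ i ∈ s, f i ≤ ∑ i ∈ s, (1 - f i) := by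
  classical
  induction s using Finset.induction_on with
  | empty => simp
  | insert a s ha ih =>
    rw [Finset.forall_mem_insert] at h0 h1
    rw [Finset.prod_insert ha, Finset.sum_insert ha]
    nlinarith [ih h0.2 h1.2, Finset.prod_le_one h0.2 h1.2]

end Stable

section Sketch

open Filter Topology

variable {ι : Type*}

/-- The coefficient of coordinate `i` in the sketch: a sum of `N` jumps, which is approximately
`p`-stable for large `N`. -/
def sketchCoeff (p : ℝ) (N : ℕ) (a : ι × Fin N → ℝ) (i : ι) : ℝ := ∑ l, stableJump p N (a (i, l))

lemma sketchCoeff_nonneg (p : ℝ) {N : ℕ} (a : ι × Fin N → ℝ) (i : ι) : 0 ≤ sketchCoeff p N a i :=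
  Finset.sum_nonneg fun _ _ => stableJump_nonneg _ _ _

lemma measurable_sketchCoeff (p : ℝ) {N : ℕ} (i : ι) :
    Measurable fun a : ι × Fin N → ℝ => sketchCoeff p N a i :=
  Finset.measurable_sum _ fun l _ => (measurable_stableJump p N).comp (measurable_pi_apply (i, l))

variable [Fintype ι] {x : ι → ℝ} {p : ℝ}

/-- Indyk's linear sketch of a vector, with approximately `p`-stable coefficients. -/
def sketch (p : ℝ) (N : ℕ) (a : ι × Fin N → ℝ) (x : ι → ℝ) : ℝ := ∑ i, x i * sketchCoeff p N a i

lemma sketch_zero (p : ℝ) {N : ℕ} (a : ι × Fin N → ℝ) : sketch p N a 0 = 0 := by simp [sketch]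

lemma sketch_sum {V : Type*} (p : ℝ) {N : ℕ} (a : ι × Fin N → ℝ) (s : Finset V) (X : V → ι → ℝ) :
    sketch p N a (∑ v ∈ s, X v) = ∑ v ∈ s, sketch p N a (X v) := by
  simp only [sketch, Finset.sum_apply, Finset.sum_mul]
  exact Finset.sum_comm

lemma sketch_nonneg (p : ℝ) {N : ℕ} (hx : ∀ i, 0 ≤ x i) (a : ι × Fin N → ℝ) :
    0 ≤ sketch p N a x :=
  Finset.sum_nonneg fun i _ => mul_nonneg (hx i) (sketchCoeff_nonneg p a i)

lemma measurable_sketch (p : ℝ) (N : ℕ) (x : ι → ℝ) :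
    Measurable fun a : ι × Fin N → ℝ => sketch p N a x :=
  Finset.measurable_sum _ fun i _ => (measurable_sketchCoeff p i).const_mul _

lemma integral_exp_sketch (p : ℝ) (N : ℕ) (hx : ∀ i, 0 ≤ x i) {t : ℝ} (ht : 0 ≤ t) :
    ∫ a, Real.exp (-(t * sketch p N a x)) ∂unitUniforms (ι × Fin N) =
      ∏ i, (1 - jumpExponent p N (t * x i)) ^ N := by
  have hprod (a : ι × Fin N → ℝ) : Real.exp (-(t * sketch p N a x)) =
      ∏ j, Real.exp (-(t * x j.1 * stableJump p N (a j))) := by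
    simp only [← Real.exp_sum, Fintype.sum_prod_type, sketch, sketchCoeff, Finset.mul_sum,
      Finset.sum_neg_distrib, mul_assoc]
  simp only [hprod]
  rw [integral_fintype_prod_eq_prod (μ := fun _ : ι × Fin N => unitUniform)
    (fun j u => Real.exp (-(t * x j.1 * stableJump p N u))), Fintype.prod_prod_type]
  refine Finset.prod_congr rfl fun i _ => ?_
  simp only [integral_exp_neg_eq_one_sub (measurable_stableJump p N) (stableJump_nonneg p N)
    (mul_nonneg ht (hx i)), Finset.prod_const, Finset.card_univ, Fintype.card_fin, jumpExponent]

lemma integral_one_sub_exp_sketch (p : ℝ) (N : ℕ) (hx : ∀ i, 0 ≤ x i) {t : ℝ} (ht : 0 ≤ t) :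
    ∫ a, (1 - Real.exp (-(t * sketch p N a x))) ∂unitUniforms (ι × Fin N) =
      1 - ∏ i, (1 - jumpExponent p N (t * x i)) ^ N := by
  rw [← integral_exp_sketch p N hx ht, integral_exp_neg_eq_one_sub (measurable_sketch p N x)
    (sketch_nonneg p hx) ht, sub_sub_cancel]

lemma integral_one_sub_exp_sketch_le (hp0 : 0 < p) (hp1 : p < 1) {N : ℕ} (hN : 0 < N)
    (hx : ∀ i, 0 ≤ x i) {t : ℝ} (ht : 0 ≤ t) :
    ∫ a, (1 - Real.exp (-(t * sketch p N a x))) ∂unitUniforms (ι × Fin N) ≤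
      stableConst p * (∑ i, x i ^ p) * t ^ p := by
  have hs (i : ι) : 0 ≤ t * x i := mul_nonneg ht (hx i)
  have h0 (i : ι) : 0 ≤ 1 - jumpExponent p N (t * x i) :=
    sub_nonneg.2 (jumpExponent_le_one p N (hs i))
  have h1 (i : ι) : 1 - jumpExponent p N (t * x i) ≤ 1 :=
    sub_le_self _ (jumpExponent_nonneg p N (hs i))
  calc ∫ a, (1 - Real.exp (-(t * sketch p N a x))) ∂unitUniforms (ι × Fin N)
      = 1 - ∏ i, (1 - jumpExponent p N (t * x i)) ^ N := integral_one_sub_exp_sketch p N hx ht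
    _ ≤ ∑ i, (1 - (1 - jumpExponent p N (t * x i)) ^ N) :=
        one_sub_prod_le_sum _ _ (fun i _ => pow_nonneg (h0 i) N)
          fun i _ => pow_le_one₀ (h0 i) (h1 i)
    _ ≤ ∑ i, N * jumpExponent p N (t * x i) := by
        refine Finset.sum_le_sum fun i _ => ?_
        have hbernoulli :=
          one_add_mul_le_pow (a := -jumpExponent p N (t * x i)) (by linarith [h0 i]) N
        rw [← sub_eq_add_neg] at hbernoulli
        linarith
    _ ≤ ∑ i, stableConst p * (t * x i) ^ p :=
        Finset.sum_le_sum fun i _ => mul_jumpExponent_le hp0 hp1 (hs i) hN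
    _ = stableConst p * (∑ i, x i ^ p) * t ^ p := by
        simp only [Real.mul_rpow ht (hx _), ← Finset.mul_sum]
        ring

lemma tendsto_integral_one_sub_exp_sketch (hp0 : 0 < p) (hp1 : p < 1) (hx : ∀ i, 0 ≤ x i) {t : ℝ}
    (ht : 0 ≤ t) :
    Tendsto (fun N : ℕ => ∫ a, (1 - Real.exp (-(t * sketch p N a x))) ∂unitUniforms (ι × Fin N))
      atTop (𝓝 (1 - Real.exp (-(stableConst p * ((∑ i, x i ^ p) * t ^ p))))) := by
  have hprod : Real.exp (-(stableConst p * ((∑ i, x i ^ p) * t ^ p))) =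
      ∏ i, Real.exp (-(stableConst p * (t * x i) ^ p)) := by
    simp only [← Real.exp_sum, Finset.sum_neg_distrib, Real.mul_rpow ht (hx _), ← Finset.mul_sum,
      mul_comm (∑ i, x i ^ p)]
  simp only [integral_one_sub_exp_sketch p _ hx ht, hprod]
  refine tendsto_const_nhds.sub (tendsto_finsetProd _ fun i _ => ?_)
  simp only [sub_eq_add_neg]
  refine Real.tendsto_one_add_pow_exp_of_tendsto ?_
  simpa using (tendsto_mul_jumpExponent hp0 hp1 (mul_nonneg ht (hx i))).neg

end Sketch

section SketchMoments

open Filter Topology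

variable {ι : Type*} [Fintype ι] {x : ι → ℝ} {p q : ℝ}

lemma integral_rpow_mul_comp_mul_rpow (hp0 : 0 < p) (hq : 0 < q) {H : ℝ → ℝ} (hH : H 0 = 0)
    {F : ℝ} (hF : 0 ≤ F) :
    ∫ t in Set.Ioi (0 : ℝ), t ^ (-1 - q) * H (F * t ^ p) =
      F ^ (q / p) * ∫ t in Set.Ioi (0 : ℝ), t ^ (-1 - q) * H (t ^ p) := by
  rcases hF.eq_or_lt with rfl | hF
  · simp [hH, Real.zero_rpow (div_pos hq hp0).ne']
  · have hs : 0 < F ^ p⁻¹ := Real.rpow_pos_of_pos hF _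
    have hscale := integral_rpow_mul_comp_mul q (fun t => H (t ^ p)) hs
    rw [← Real.rpow_mul hF.le, inv_mul_eq_div] at hscale
    rw [← hscale]
    refine setIntegral_congr_fun measurableSet_Ioi fun t ht => ?_
    rw [Real.mul_rpow hs.le (le_of_lt ht), ← Real.rpow_mul hF.le, inv_mul_cancel₀ hp0.ne',
      Real.rpow_one]

lemma integral_sketch_rpow_eq_laplace (hp0 : 0 < p) (hp1 : p < 1) (hq : 0 < q) (hqp : q < p)
    {N : ℕ} (hN : 0 < N) (hx : ∀ i, 0 ≤ x i) :
    Integrable (fun a => sketch p N a x ^ q) (unitUniforms (ι × Fin N)) ∧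
      (∫ a, sketch p N a x ^ q ∂unitUniforms (ι × Fin N)) * laplaceConst q =
        ∫ t in Set.Ioi (0 : ℝ), t ^ (-1 - q) *
          ∫ a, (1 - Real.exp (-(t * sketch p N a x))) ∂unitUniforms (ι × Fin N) :=
  integral_rpow_eq_laplace hq (hqp.trans hp1) hqp (measurable_sketch p N x) (sketch_nonneg p hx)
    fun _ ht => integral_one_sub_exp_sketch_le hp0 hp1 hN hx ht.le

lemma integral_one_sub_exp_sketch_le_min (hp0 : 0 < p) (hp1 : p < 1) {N : ℕ} (hN : 0 < N)
    (hx : ∀ i, 0 ≤ x i) {t : ℝ} (ht : 0 ≤ t) :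
    ∫ a, (1 - Real.exp (-(t * sketch p N a x))) ∂unitUniforms (ι × Fin N) ≤
      min 1 (stableConst p * ((∑ i, x i ^ p) * t ^ p)) := by
  rw [← mul_assoc]
  exact le_min (integral_one_sub_exp_le_one (measurable_sketch p N x) (sketch_nonneg p hx) ht)
    (integral_one_sub_exp_sketch_le hp0 hp1 hN hx ht)

/-- A bound, uniform in the number of jumps, for the `q`-th moment of the sketch of a vector with
`F_p = 1`. -/
def sketchMomentBound (p q : ℝ) : ℝ :=
  (∫ t in Set.Ioi (0 : ℝ), t ^ (-1 - q) * min 1 (stableConst p * t ^ p)) / laplaceConst q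

/-- The `q`-th moment of the one-sided stable law with Laplace transform
`exp (-stableConst p * t ^ p)`. -/
def stableMoment (p q : ℝ) : ℝ :=
  (∫ t in Set.Ioi (0 : ℝ), t ^ (-1 - q) * (1 - Real.exp (-(stableConst p * t ^ p)))) /
    laplaceConst q

lemma sketchMomentBound_pos (hp0 : 0 < p) (hp1 : p < 1) (hq : 0 < q) (hqp : q < p) :
    0 < sketchMomentBound p q := by
  have hc := stableConst_pos hp0 hp1
  refine div_pos (integral_rpow_mul_pos (C := stableConst p) hq hqp (by fun_prop)
    (fun t ht => by positivity) fun t _ => le_rfl) (laplaceConst_pos hq (hqp.trans hp1))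

lemma stableMoment_pos (hp0 : 0 < p) (hp1 : p < 1) (hq : 0 < q) (hqp : q < p) :
    0 < stableMoment p q := by
  refine div_pos (integral_rpow_mul_pos (C := stableConst p) hq hqp (by fun_prop)
    (fun t ht => ?_) fun t _ => one_sub_exp_neg_le_min _) (laplaceConst_pos hq (hqp.trans hp1))
  have hexponent : 0 < stableConst p * t ^ p :=
    mul_pos (stableConst_pos hp0 hp1) (Real.rpow_pos_of_pos ht _)
  exact sub_pos.2 (Real.exp_lt_one_iff.2 (neg_lt_zero.2 hexponent))

lemma integral_sketch_rpow_le (hp0 : 0 < p) (hp1 : p < 1) (hq : 0 < q) (hqp : q < p) {N : ℕ}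
    (hN : 0 < N) (hx : ∀ i, 0 ≤ x i) :
    ∫ a, sketch p N a x ^ q ∂unitUniforms (ι × Fin N) ≤
      sketchMomentBound p q * (∑ i, x i ^ p) ^ (q / p) := by
  have hF : 0 ≤ ∑ i, x i ^ p := Finset.sum_nonneg fun i _ => Real.rpow_nonneg (hx i) _
  have hc := stableConst_pos hp0 hp1
  have hscale := integral_rpow_mul_comp_mul_rpow hp0 hq (H := fun y => min 1 (stableConst p * y))
    (by simp) hF
  have hbound {t : ℝ} (ht : 0 < t) := integral_one_sub_exp_sketch_le_min hp0 hp1 hN hx ht.le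
  rw [sketchMomentBound, div_mul_eq_mul_div, le_div_iff₀ (laplaceConst_pos hq (hqp.trans hp1)),
    (integral_sketch_rpow_eq_laplace hp0 hp1 hq hqp hN hx).2, mul_comm (∫ _ in _, _), ← hscale]
  simp only [← mul_assoc (stableConst p)] at hbound ⊢
  refine setIntegral_mono_on
    (integrableOn_rpow_mul hq hqp (measurable_integral_one_sub_exp (measurable_sketch p N x))
      (fun t ht => integral_one_sub_exp_nonneg (sketch_nonneg p hx) ht.le) fun t => hbound)
    (integrableOn_rpow_mul_min hq hqp (mul_nonneg hc.le hF)) measurableSet_Ioi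
    fun t (ht : 0 < t) => ?_
  exact mul_le_mul_of_nonneg_left (hbound ht) (Real.rpow_nonneg ht.le _)

lemma tendsto_integral_rpow_mul_integral_one_sub_exp_sketch (hp0 : 0 < p) (hp1 : p < 1)
    (hq : 0 < q) (hqp : q < p) (hx : ∀ i, 0 ≤ x i) :
    Tendsto (fun N : ℕ => ∫ t in Set.Ioi (0 : ℝ), t ^ (-1 - q) *
        ∫ a, (1 - Real.exp (-(t * sketch p N a x))) ∂unitUniforms (ι × Fin N)) atTop
      (𝓝 (∫ t in Set.Ioi (0 : ℝ), t ^ (-1 - q) *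
        (1 - Real.exp (-(stableConst p * ((∑ i, x i ^ p) * t ^ p)))))) := by
  have hF : 0 ≤ ∑ i, x i ^ p := Finset.sum_nonneg fun i _ => Real.rpow_nonneg (hx i) _
  have hdom := integrableOn_rpow_mul_min hq hqp (mul_nonneg (stableConst_pos hp0 hp1).le hF)
  refine tendsto_integral_filter_of_dominated_convergence _ ?_ ?_ hdom ?_
  · exact .of_forall fun N => ((Measurable.pow_const measurable_id _).mul
      (measurable_integral_one_sub_exp (measurable_sketch p N x))).aestronglyMeasurable
  · filter_upwards [eventually_gt_atTop 0] with N hN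
    filter_upwards [ae_restrict_mem measurableSet_Ioi] with t (ht : 0 < t)
    rw [Real.norm_of_nonneg (mul_nonneg (Real.rpow_nonneg ht.le _)
      (integral_one_sub_exp_nonneg (sketch_nonneg p hx) ht.le)), mul_assoc (stableConst p)]
    gcongr
    exact integral_one_sub_exp_sketch_le_min hp0 hp1 hN hx ht.le
  · filter_upwards [ae_restrict_mem measurableSet_Ioi] with t ht
    exact (tendsto_integral_one_sub_exp_sketch hp0 hp1 hx (le_of_lt ht)).const_mul _

lemma tendsto_integral_sketch_rpow (hp0 : 0 < p) (hp1 : p < 1) (hq : 0 < q) (hqp : q < p)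
    (hx : ∀ i, 0 ≤ x i) :
    Tendsto (fun N : ℕ => ∫ a, sketch p N a x ^ q ∂unitUniforms (ι × Fin N)) atTop
      (𝓝 (stableMoment p q * (∑ i, x i ^ p) ^ (q / p))) := by
  have hF : 0 ≤ ∑ i, x i ^ p := Finset.sum_nonneg fun i _ => Real.rpow_nonneg (hx i) _
  have hlaplace := laplaceConst_pos hq (hqp.trans hp1)
  have hlim := (tendsto_integral_rpow_mul_integral_one_sub_exp_sketch hp0 hp1 hq hqp hx).div_const
    (laplaceConst q)
  rw [integral_rpow_mul_comp_mul_rpow hp0 hq (H := fun y => 1 - Real.exp (-(stableConst p * y)))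
    (by simp) hF, mul_div_assoc, ← stableMoment, mul_comm] at hlim
  refine hlim.congr' ((eventually_gt_atTop 0).mono fun N hN => ?_)
  rw [← (integral_sketch_rpow_eq_laplace hp0 hp1 hq hqp hN hx).2, mul_div_cancel_right₀ _
    hlaplace.ne']

end SketchMoments

/-! ### Tree protocols -/

section BreadthFirstTree

variable {V : Type*} [Fintype V]

lemma exists_adj_dist_eq_add_one {W : Type*} {G : SimpleGraph W} (hG : G.Connected) {v c : W}
    (hv : v ≠ c) : ∃ w, G.Adj v w ∧ G.dist v c = G.dist w c + 1 := by
  obtain ⟨walk, hwalk⟩ := hG.exists_walk_length_eq_dist v c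
  cases walk with
  | nil => exact absurd rfl hv
  | @cons _ w _ hadj tail =>
    refine ⟨w, hadj, le_antisymm ?_ ?_⟩
    · have htriangle := hG.dist_triangle (u := v) (v := w) (w := c)
      rw [SimpleGraph.dist_eq_one_iff_adj.2 hadj] at htriangle
      omega
    · have htail := SimpleGraph.dist_le tail
      rw [SimpleGraph.Walk.length_cons] at hwalk
      omega

lemma exists_parentTree_adj_maxDepth_le_diam {G : SimpleGraph V} (hG : G.Connected) :
    ∃ T : ParentTree V, (∀ v, v ≠ T.root → G.Adj v (T.parent v)) ∧ T.maxDepth ≤ G.diam := by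
  classical
  have := hG.nonempty
  obtain ⟨c⟩ := hG.nonempty
  choose! par hadj hdist using fun v hv => exists_adj_dist_eq_add_one hG (v := v) (c := c) hv
  refine ⟨⟨c, fun v => if v = c then c else par v, fun v => G.dist v c, by simp, by simp,
    fun v hv => by simpa [hv] using hdist v hv⟩, fun v hv => ?_, Finset.sup_le fun v _ => ?_⟩
  · simpa [hv] using hadj v hv
  · exact SimpleGraph.dist_le_diam (SimpleGraph.connected_iff_ediam_ne_top.1 hG)

end BreadthFirstTree

lemma exists_injective_forall_length_eq {α : Type*} [Fintype α] {ℓ : ℕ}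
    (h : Fintype.card α ≤ 2 ^ ℓ) :
    ∃ code : α → List Bool, Function.Injective code ∧ ∀ x, (code x).length = ℓ := by
  obtain ⟨f⟩ : Nonempty (α ↪ (Fin ℓ → Bool)) :=
    Function.Embedding.nonempty_of_card_le (by simpa using h)
  exact ⟨fun x => List.ofFn (f x), List.ofFn_injective.comp f.injective, fun x => by simp⟩

/-- The data of a protocol that sums `k` real numbers per player, `value ω x` for a player with
input `x`, along the tree `tree`. The partial sums are rounded to the grid points
`g 0, …, g L` with the coins `rnd`, their indices are transmitted as bit strings of length `len`
by the injective code `code`, and the root applies the estimator `est` to its own indices. -/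
structure TreeProtocolData {m : ℕ} (G : SimpleGraph (Fin m)) (n M : ℕ) where
  k : ℕ
  L : ℕ
  len : ℕ
  g : ℕ → ℝ
  tree : ParentTree (Fin m)
  adj_parent : ∀ v, v ≠ tree.root → G.Adj v (tree.parent v)
  value : Coins → Input n M → Fin k → ℝ
  measurable_value : ∀ x j, Measurable fun ω => value ω x j
  rnd : Coins → Fin k → Fin m → ℝ
  measurable_rnd : ∀ j v, Measurable fun ω => rnd ω j v
  code : (Fin k → Fin (L + 1)) → List Bool
  injective_code : Function.Injective code
  length_code : ∀ x, (code x).length = len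
  est : (Fin k → ℕ) → ℝ

namespace TreeProtocolData

variable {m n M : ℕ} {G : SimpleGraph (Fin m)} (A : TreeProtocolData G n M)

/-- The indices encoded by a message. -/
def decode (s : List Bool) : Fin A.k → Fin (A.L + 1) := Function.invFun A.code s

/-- The sum of the grid points that a player has received so far for the `j`-th number. -/
def received (h : Inbox m) (j : Fin A.k) : ℝ :=
  (h.map fun entry => ∑ u, (entry u).elim 0 fun s => A.g (A.decode s j)).sum

/-- The grid index of the `j`-th partial sum computed by player `v`. -/
def counter (v : Fin m) (ω : Coins) (x : Input n M) (h : Inbox m) (j : Fin A.k) : Fin (A.L + 1) :=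
  ⟨roundIdx A.g A.L (A.value ω x j + A.received h j) (A.rnd ω j v),
    Nat.lt_succ_of_le (roundIdx_le _ _ _ _)⟩

lemma measurable_counter (v : Fin m) (x : Input n M) (h : Inbox m) :
    Measurable fun ω => A.counter v ω x h := by
  refine measurable_pi_lambda _ fun j => measurable_to_countable' fun i => ?_
  have hidx : Measurable fun ω =>
      roundIdx A.g A.L (A.value ω x j + A.received h j) (A.rnd ω j v) :=
    (measurable_roundIdx A.g A.L).comp
      (((A.measurable_value x j).add_const _).prodMk (A.measurable_rnd j v))
  convert hidx (measurableSet_singleton (i : ℕ)) using 1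
  ext ω
  simp [counter, Fin.ext_iff]

/-- The protocol in which a player at depth `δ` sends its counters to its parent in round
`maxDepth - δ`, once all its children have spoken. -/
def protocol : Protocol G n M where
  rounds := A.tree.maxDepth
  center := A.tree.root
  schedule r v := open Classical in
    if v ≠ A.tree.root ∧ r + A.tree.depth v = A.tree.maxDepth then some (A.tree.parent v) else none
  adj_of_schedule r v w h := by
    split_ifs at h with hv
    exact Option.some.inj h ▸ A.adj_parent v hv.1
  message _ v ω x h := A.code (A.counter v ω x h)
  output ω x h := A.est fun j => A.counter A.tree.root ω x h j
  measurable_message _ v x h s :=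
    A.measurable_counter v x h (Set.toFinite {y | A.code y = s}).measurableSet
  measurable_output x h :=
    (measurable_of_countable fun c : Fin A.k → Fin (A.L + 1) => A.est fun j => c j).comp
      (A.measurable_counter _ x h)

lemma schedule_eq_some {r : ℕ} {v w : Fin m} :
    A.protocol.schedule r v = some w ↔
      v ≠ A.tree.root ∧ r + A.tree.depth v = A.tree.maxDepth ∧ A.tree.parent v = w := by
  simp only [protocol]
  split_ifs with h
  · simp [h]
  · simp only [false_iff]
    tauto

lemma schedule_isSome {r : ℕ} {v : Fin m} :
    (A.protocol.schedule r v).isSome ↔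
      v ≠ A.tree.root ∧ r + A.tree.depth v = A.tree.maxDepth := by
  simp [Option.isSome_iff_exists, A.schedule_eq_some]

lemma round_add_depth_add_one {r : ℕ} {u v : Fin m} (h : A.protocol.schedule r u = some v) :
    r + A.tree.depth v + 1 = A.tree.maxDepth := by
  obtain ⟨hroot, hround, rfl⟩ := A.schedule_eq_some.1 h
  have hdepth := A.tree.depth_parent u hroot
  omega

lemma isOneShot : A.protocol.IsOneShot := by
  refine ⟨fun v hv => ?_, fun r _ => by simp [protocol], fun r _ s _ u w v hu hw => ?_,
    fun r _ s _ u v hu hv => ?_⟩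
  · have hpos := A.tree.depth_parent v hv
    have hle := A.tree.depth_le_maxDepth v
    refine ⟨A.tree.maxDepth - A.tree.depth v,
      ⟨show _ < A.tree.maxDepth by omega, A.schedule_isSome.2 ⟨hv, by omega⟩⟩, ?_⟩
    rintro r ⟨_, hr⟩
    have hround := (A.schedule_isSome.1 hr).2
    omega
  · have hround := A.round_add_depth_add_one hu
    have hround' := A.round_add_depth_add_one hw
    omega
  · have hround := A.round_add_depth_add_one hu
    have hround' := (A.schedule_isSome.1 hv).2
    omega

lemma received_inbox (X : Fin m → Input n M) (ω : Coins) (r : ℕ) (v : Fin m) (j : Fin A.k) :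
    A.received (A.protocol.inbox X ω r v) j = ∑ s ∈ Finset.range r, ∑ u,
      if u ≠ A.tree.root ∧ s + A.tree.depth u = A.tree.maxDepth ∧ A.tree.parent u = v then
        A.g (A.counter u ω (X u) (A.protocol.inbox X ω s u) j) else 0 := by
  induction r with
  | zero => simp [Protocol.inbox, received]
  | succ r ih =>
    rw [Finset.sum_range_succ, ← ih, Protocol.inbox, received, List.map_append, List.sum_append]
    congr 1
    simp only [List.map_cons, List.map_nil, List.sum_cons, List.sum_nil, add_zero,
      A.schedule_eq_some]
    refine Finset.sum_congr rfl fun u _ => ?_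
    split_ifs with h
    · have hdecode := Function.leftInverse_invFun A.injective_code
        (A.counter u ω (X u) (A.protocol.inbox X ω r u))
      exact congrArg (fun c : Fin A.k → Fin (A.L + 1) => A.g (c j)) hdecode
    · rfl

lemma counter_inbox (X : Fin m → Input n M) (ω : Coins) (j : Fin A.k) (v : Fin m) :
    A.counter v ω (X v) (A.protocol.inbox X ω (A.tree.maxDepth - A.tree.depth v) v) j =
      A.tree.treeIdx A.g A.L (fun w => A.value ω (X w) j) (A.rnd ω j) v := by
  induction v using A.tree.induction_children with
  | h v ih =>
    simp only [counter]
    rw [ParentTree.treeIdx_eq, ParentTree.treeSum, received_inbox, Finset.sum_comm,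
      ParentTree.children, Finset.sum_filter]
    congr 2
    refine Finset.sum_congr rfl fun u _ => ?_
    split_ifs with h
    · have hu := ParentTree.mem_children.2 h
      have hdepth := ParentTree.depth_of_mem_children hu
      have hle := A.tree.depth_le_maxDepth u
      rw [Finset.sum_eq_single_of_mem (A.tree.maxDepth - A.tree.depth u)
        (Finset.mem_range.2 (by omega)), if_pos ⟨h.1, by omega, h.2⟩, ih u hu]
      exact fun s _ hs => if_neg fun h' => hs (by omega)
    · exact Finset.sum_eq_zero fun s _ => if_neg fun h' => h ⟨h'.1, h'.2.2⟩

lemma result_eq (X : Fin m → Input n M) (ω : Coins) :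
    A.protocol.result X ω = A.est fun j =>
      A.tree.treeIdx A.g A.L (fun w => A.value ω (X w) j) (A.rnd ω j) A.tree.root := by
  simp only [← A.counter_inbox X ω, A.tree.depth_root, Nat.sub_zero]
  rfl

lemma bits_le (X : Fin m → Input n M) (ω : Coins) (r : ℕ) (u v : Fin m) :
    A.protocol.bits X ω r u v ≤
      if r = A.tree.maxDepth - A.tree.depth u then (if A.tree.parent u = v then A.len else 0)
        else 0 := by
  rw [Protocol.bits]
  split_ifs with h hr hv hv
  · exact (A.length_code _).le
  · exact absurd (A.schedule_eq_some.1 h).2.2 hv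
  · exact absurd (by have := (A.schedule_eq_some.1 h).2.1; omega) hr
  all_goals exact Nat.zero_le _

lemma sum_bits_le (X : Fin m → Input n M) (ω : Coins) (R : ℕ) (u v : Fin m) :
    ∑ r ∈ Finset.range R, A.protocol.bits X ω r u v ≤ if A.tree.parent u = v then A.len else 0 := by
  refine (Finset.sum_le_sum fun r _ => A.bits_le X ω r u v).trans ?_
  rw [Finset.sum_ite_eq']
  split_ifs <;> simp

lemma totalCommunication_le (X : Fin m → Input n M) (ω : Coins) :
    A.protocol.totalCommunication X ω ≤ m * A.len := by
  rw [Protocol.totalCommunication, Finset.sum_comm]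
  calc ∑ u, ∑ r ∈ Finset.range A.protocol.rounds, ∑ v, A.protocol.bits X ω r u v
      = ∑ u, ∑ v, ∑ r ∈ Finset.range A.protocol.rounds, A.protocol.bits X ω r u v :=
        Finset.sum_congr rfl fun u _ => Finset.sum_comm
    _ ≤ ∑ u, ∑ v, if A.tree.parent u = v then A.len else 0 :=
        Finset.sum_le_sum fun u _ => Finset.sum_le_sum fun v _ => A.sum_bits_le X ω _ u v
    _ = m * A.len := by simp

lemma maxCommunication_le (X : Fin m → Input n M) (ω : Coins) :
    A.protocol.maxCommunication X ω ≤ 2 * A.len := by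
  have hsend (u v : Fin m) :
      ∑ r ∈ Finset.range A.protocol.rounds, A.protocol.bits X ω r u v ≤ A.len :=
    (A.sum_bits_le X ω _ u v).trans (by split_ifs <;> simp)
  refine Finset.sup_le fun e _ => ?_
  rw [Protocol.edgeCommunication, Finset.sum_add_distrib, two_mul]
  exact add_le_add (hsend _ _) (hsend _ _)

end TreeProtocolData

/-! ### Powers of rounded sums -/

section PowerError

lemma rpow_two_mul {y : ℝ} (hy : 0 ≤ y) (q : ℝ) : y ^ (2 * q) = (y ^ q) ^ 2 := by
  rw [mul_comm, Real.rpow_mul hy, Real.rpow_two]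

lemma abs_rpow_sub_one_le {r q : ℝ} (hr : 0 ≤ r) (hq0 : 0 < q) (hq1 : q ≤ 1) :
    |r ^ q - 1| ≤ |r - 1| := by
  rcases le_total r 1 with h | h
  · have hle : r ^ q ≤ 1 := Real.rpow_le_one hr h hq0.le
    have hge : r ≤ r ^ q := Real.self_le_rpow_of_le_one hr h hq1
    rw [abs_of_nonpos (by linarith), abs_of_nonpos (by linarith)]
    linarith
  · have hge : 1 ≤ r ^ q := Real.one_le_rpow h hq0.le
    have hle : r ^ q ≤ r := Real.rpow_le_self_of_one_le h hq1
    rw [abs_of_nonneg (by linarith), abs_of_nonneg (by linarith)]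
    linarith

lemma rpow_sub_rpow_sq_le_mul {y z q : ℝ} (hy : 0 ≤ y) (hz : 0 < z) (hq0 : 0 < q) (hq1 : q ≤ 1) :
    (y ^ q - z ^ q) ^ 2 ≤ z ^ (2 * q - 2) * (y - z) ^ 2 := by
  obtain ⟨r, hr, rfl⟩ : ∃ r, 0 ≤ r ∧ y = z * r := ⟨y / z, by positivity, by field_simp⟩
  have hzq : (z ^ q) ^ 2 = z ^ (2 * q - 2) * z ^ 2 := by
    rw [← rpow_two_mul hz.le, ← Real.rpow_two z, ← Real.rpow_add hz, sub_add_cancel]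
  calc ((z * r) ^ q - z ^ q) ^ 2 = (z ^ q) ^ 2 * (r ^ q - 1) ^ 2 := by
        rw [Real.mul_rpow hz.le hr]; ring
    _ ≤ (z ^ q) ^ 2 * (r - 1) ^ 2 :=
        mul_le_mul_of_nonneg_left (sq_le_sq.2 (abs_rpow_sub_one_le hr hq0 hq1)) (sq_nonneg _)
    _ = z ^ (2 * q - 2) * (z * r - z) ^ 2 := by rw [hzq]; ring

lemma rpow_sub_rpow_sq_le_rpow {y z q : ℝ} (hy : 0 ≤ y) (hz : 0 ≤ z) (hq0 : 0 ≤ q) (hq1 : q ≤ 1) :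
    (y ^ q - z ^ q) ^ 2 ≤ ((y - z) ^ 2) ^ q := by
  wlog hzy : z ≤ y generalizing y z
  · have := this hz hy (le_of_not_ge hzy)
    rwa [sub_sq_comm (y ^ q), sub_sq_comm y]
  have hsub := Real.rpow_add_le_add_rpow hz (sub_nonneg.2 hzy) hq0 hq1
  rw [add_sub_cancel] at hsub
  have hmono : z ^ q ≤ y ^ q := Real.rpow_le_rpow hz hzy hq0
  calc (y ^ q - z ^ q) ^ 2 ≤ ((y - z) ^ q) ^ 2 := by gcongr; linarith
    _ = ((y - z) ^ 2) ^ q := by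
        rw [← rpow_two_mul (sub_nonneg.2 hzy), Real.rpow_mul (sub_nonneg.2 hzy), Real.rpow_two]

variable {Ω : Type*} [MeasurableSpace Ω] {ν : Measure Ω} {Y : Ω → ℝ} {q z : ℝ}

lemma integral_rpow_sub_sq_le_mul (hY : ∀ ω, 0 ≤ Y ω) (hz : 0 < z) (hq0 : 0 < q) (hq1 : q ≤ 1)
    (hint : Integrable (fun ω => (Y ω - z) ^ 2) ν) :
    ∫ ω, (Y ω ^ q - z ^ q) ^ 2 ∂ν ≤ z ^ (2 * q - 2) * ∫ ω, (Y ω - z) ^ 2 ∂ν := by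
  rw [← integral_const_mul]
  exact integral_mono_of_nonneg (.of_forall fun ω => sq_nonneg _) (hint.const_mul _)
    (.of_forall fun ω => rpow_sub_rpow_sq_le_mul (hY ω) hz hq0 hq1)

variable [IsProbabilityMeasure ν]

lemma integrable_rpow_of_le_one (hY : ∀ ω, 0 ≤ Y ω) (hint : Integrable Y ν) (hq0 : 0 ≤ q)
    (hq1 : q ≤ 1) : Integrable (fun ω => Y ω ^ q) ν := by
  refine ((integrable_const (1 : ℝ)).add hint).mono'
    (hint.aemeasurable.pow_const q).aestronglyMeasurable (.of_forall fun ω => ?_)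
  rw [Real.norm_of_nonneg (Real.rpow_nonneg (hY ω) q), Pi.add_apply]
  rcases le_total (Y ω) 1 with h | h
  · linarith [Real.rpow_le_one (hY ω) h hq0, hY ω]
  · linarith [Real.rpow_le_self_of_one_le h hq1]

lemma integral_rpow_le_rpow (hY : ∀ ω, 0 ≤ Y ω) (hint : Integrable Y ν) (hYz : ∫ ω, Y ω ∂ν ≤ z)
    (hq0 : 0 ≤ q) (hq1 : q ≤ 1) : ∫ ω, Y ω ^ q ∂ν ≤ z ^ q :=
  ((Real.concaveOn_rpow hq0 hq1).le_map_integral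
    (Real.continuous_rpow_const hq0).continuousOn isClosed_Ici (.of_forall hY) hint
    (integrable_rpow_of_le_one hY hint hq0 hq1)).trans
    (Real.rpow_le_rpow (integral_nonneg hY) hYz hq0)

lemma integral_rpow_sub_sq_le_rpow (hY : ∀ ω, 0 ≤ Y ω) (hz : 0 ≤ z) (hq0 : 0 ≤ q) (hq1 : q ≤ 1)
    (hint : Integrable (fun ω => (Y ω - z) ^ 2) ν) {s : ℝ} (hs : ∫ ω, (Y ω - z) ^ 2 ∂ν ≤ s) :
    ∫ ω, (Y ω ^ q - z ^ q) ^ 2 ∂ν ≤ s ^ q :=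
  (integral_mono_of_nonneg (.of_forall fun _ => sq_nonneg _)
    (integrable_rpow_of_le_one (fun _ => sq_nonneg _) hint hq0 hq1)
    (.of_forall fun ω => rpow_sub_rpow_sq_le_rpow (hY ω) hz hq0 hq1)).trans
    (integral_rpow_le_rpow (fun _ => sq_nonneg _) hint hs hq0 hq1)

lemma integral_rpow_sub_sq_le_two_mul (hY : ∀ ω, 0 ≤ Y ω) (hint : Integrable Y ν)
    (hYz : ∫ ω, Y ω ∂ν ≤ z) (hq0 : 0 ≤ q) (hq1 : 2 * q ≤ 1) :
    ∫ ω, (Y ω ^ q - z ^ q) ^ 2 ∂ν ≤ 2 * z ^ (2 * q) := by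
  have hz : 0 ≤ z := (integral_nonneg hY).trans hYz
  have hintq := integrable_rpow_of_le_one hY hint (by linarith) hq1
  calc ∫ ω, (Y ω ^ q - z ^ q) ^ 2 ∂ν ≤ ∫ ω, (Y ω ^ (2 * q) + z ^ (2 * q)) ∂ν := by
        refine integral_mono_of_nonneg (.of_forall fun _ => sq_nonneg _)
          (hintq.add (integrable_const _)) (.of_forall fun ω => ?_)
        simp only [rpow_two_mul (hY ω), rpow_two_mul hz]
        nlinarith [mul_nonneg (Real.rpow_nonneg (hY ω) q) (Real.rpow_nonneg hz q)]
    _ = ∫ ω, Y ω ^ (2 * q) ∂ν + z ^ (2 * q) := by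
        rw [integral_add hintq (integrable_const _), integral_const, probReal_univ, one_smul]
    _ ≤ 2 * z ^ (2 * q) := by
        linarith [integral_rpow_le_rpow hY hint hYz (by linarith) hq1]

end PowerError

namespace ParentTree

variable {V : Type*} [Fintype V] [DecidableEq V] {T : ParentTree V} {L : ℕ} {x : V → ℝ}
  {τ γ z B q r : ℝ}

lemma integral_treeIdx_root_le (hτ : 0 < τ) (hγ : 0 < γ) (hx : ∀ v, 0 ≤ x v)
    (hz : z = ∑ a, x a) :
    ∫ b, grid τ γ (T.treeIdx (grid τ γ) L x b T.root) ∂unitUniforms V ≤ z := by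
  rw [hz, ← T.subtreeSum_root]
  exact integral_treeIdx_le (grid_strictMono hτ hγ) (grid_zero τ γ) hx T.root

lemma integral_treeIdx_root_rpow_le (hτ : 0 < τ) (hγ : 0 < γ) (hx : ∀ v, 0 ≤ x v)
    (hz : z = ∑ a, x a) (hq0 : 0 ≤ q) (hq1 : q ≤ 1) :
    ∫ b, grid τ γ (T.treeIdx (grid τ γ) L x b T.root) ^ q ∂unitUniforms V ≤ z ^ q :=
  integral_rpow_le_rpow (fun _ => grid_nonneg hτ hγ _)
    (T.integrable_comp_treeIdx (grid τ γ) L x fun i => grid τ γ (i T.root))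
    (integral_treeIdx_root_le hτ hγ hx hz) hq0 hq1

lemma integral_treeIdx_root_sub_sq_le_of_le (hτ : 0 < τ) (hτ1 : τ ≤ 1) (hγ : 0 < γ) (hγ1 : γ ≤ 1)
    (hx : ∀ v, 0 ≤ x v) (hL : 0 < L) (hz : z = ∑ a, x a) (hB : 1 ≤ B) (hzB : z ≤ B)
    (hBL : 6 * Fintype.card V * B / γ ≤ grid τ γ L) :
    ∫ b, (grid τ γ (T.treeIdx (grid τ γ) L x b T.root) - z) ^ 2 ∂unitUniforms V ≤
      2 * γ * z ^ 2 + τ * z := by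
  have hz0 : 0 ≤ z := hz ▸ Finset.sum_nonneg fun a _ => hx a
  have hcut : (1 + γ) * z ^ 2 + τ * z ≤ z * (3 * B) := by
    nlinarith [mul_nonneg hz0 (sub_nonneg.2 hzB), mul_nonneg hz0 (sub_nonneg.2 hτ1),
      mul_nonneg hz0 (sub_nonneg.2 hB), mul_nonneg (mul_nonneg hz0 hz0) (sub_nonneg.2 hγ1)]
  have htrunc : Fintype.card V * (((1 + γ) * z ^ 2 + τ * z) / grid τ γ L) ≤ γ * z / 2 := by
    rw [← mul_div_assoc, div_le_iff₀ (grid_strictMono hτ hγ hL)]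
    rw [div_le_iff₀ hγ] at hBL
    nlinarith [mul_le_mul_of_nonneg_left hcut (Nat.cast_nonneg (α := ℝ) (Fintype.card V)),
      mul_le_mul_of_nonneg_left hBL hz0]
  refine (integral_treeIdx_root_sub_sq_le hτ hγ hx hL hz).trans ?_
  nlinarith

/-- The three terms cover totals between `τ / γ` and `B`, where the relative error is small, totals
below `τ / γ`, where the absolute error is small, and totals above the cutoff `B`. -/
lemma integral_treeIdx_root_rpow_sub_sq_le (hτ : 0 < τ) (hτ1 : τ ≤ 1) (hγ : 0 < γ) (hγ1 : γ ≤ 1)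
    (hx : ∀ v, 0 ≤ x v) (hL : 0 < L) (hz : z = ∑ a, x a) (hB : 1 ≤ B)
    (hBL : 6 * Fintype.card V * B / γ ≤ grid τ γ L) (hq0 : 0 < q) (hq1 : 2 * q ≤ 1) (hr : 0 ≤ r) :
    ∫ b, (grid τ γ (T.treeIdx (grid τ γ) L x b T.root) ^ q - z ^ q) ^ 2 ∂unitUniforms V ≤
      3 * γ * z ^ (2 * q) + (3 * τ ^ 2 / γ) ^ q + 2 * (z ^ (2 * q + r) * B ^ (-r)) := by
  have hY (b : V → ℝ) := grid_nonneg hτ hγ (T.treeIdx (grid τ γ) L x b T.root)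
  have hz0 : 0 ≤ z := hz ▸ Finset.sum_nonneg fun a _ => hx a
  have hint := T.integrable_comp_treeIdx (grid τ γ) L x
  have hmid0 : 0 ≤ 3 * γ * z ^ (2 * q) := by positivity
  have hlow0 : 0 ≤ (3 * τ ^ 2 / γ) ^ q := by positivity
  have hhigh0 : 0 ≤ 2 * (z ^ (2 * q + r) * B ^ (-r)) := by positivity
  rcases le_or_gt z B with hzB | hzB
  · have hmse := integral_treeIdx_root_sub_sq_le_of_le (T := T) hτ hτ1 hγ hγ1 hx hL hz hB hzB hBL
    rcases le_or_gt τ (γ * z) with hτz | hτz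
    · have hzpos : 0 < z := pos_of_mul_pos_right (hτ.trans_le hτz) hγ.le
      have hbound := integral_rpow_sub_sq_le_mul hY hzpos hq0 (by linarith)
        (hint fun i => (grid τ γ (i T.root) - z) ^ 2)
      have hscale : z ^ (2 * q - 2) * (3 * γ * z ^ 2) = 3 * γ * z ^ (2 * q) := by
        rw [mul_left_comm, ← Real.rpow_two z, ← Real.rpow_add hzpos, sub_add_cancel]
      have hmul := mul_le_mul_of_nonneg_left (hmse.trans (by nlinarith : _ ≤ 3 * γ * z ^ 2))
        (Real.rpow_nonneg hz0 (2 * q - 2))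
      linarith
    · have hsmall : 2 * γ * z ^ 2 + τ * z ≤ 3 * τ ^ 2 / γ := by
        rw [le_div_iff₀ hγ]
        nlinarith [mul_nonneg hγ.le hz0]
      linarith [integral_rpow_sub_sq_le_rpow hY hz0 hq0.le (by linarith)
        (hint fun i => (grid τ γ (i T.root) - z) ^ 2) (hmse.trans hsmall)]
  · have hB0 : 0 < B := by linarith
    have htail : z ^ (2 * q) ≤ z ^ (2 * q + r) * B ^ (-r) := by
      rw [Real.rpow_add (hB0.trans hzB), mul_assoc, Real.rpow_neg hB0.le, ← div_eq_mul_inv]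
      refine le_mul_of_one_le_right (by positivity) ((one_le_div (by positivity)).2 ?_)
      exact Real.rpow_le_rpow hB0.le hzB.le hr
    linarith [integral_rpow_sub_sq_le_two_mul hY (hint fun i => grid τ γ (i T.root))
      (integral_treeIdx_root_le hτ hγ hx hz) hq0.le hq1]

end ParentTree

/-! ### Sample means -/

section SampleMean

open ProbabilityTheory

variable {Ω : Type*} [MeasurableSpace Ω] {ν : Measure Ω} [IsProbabilityMeasure ν]

lemma integral_sub_sq_eq_variance_add {W : Ω → ℝ} (hW : MemLp W 2 ν) (t : ℝ) :
    ∫ ω, (W ω - t) ^ 2 ∂ν = variance W ν + (∫ ω, W ω ∂ν - t) ^ 2 := by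
  have hshift := variance_eq_sub (hW.sub (memLp_const t))
  have hmean : ∫ ω, (W ω - t) ∂ν = ∫ ω, W ω ∂ν - t := by
    rw [integral_sub (hW.integrable one_le_two) (integrable_const t)]
    simp
  simp only [Pi.sub_apply, Pi.pow_apply, hmean] at hshift
  rw [← variance_sub_const hW.aestronglyMeasurable t]
  linarith! [hshift]

lemma sq_integral_le_integral_sq {W : Ω → ℝ} (hW : MemLp W 2 ν) :
    (∫ ω, W ω ∂ν) ^ 2 ≤ ∫ ω, W ω ^ 2 ∂ν := by
  simpa using (le_add_of_nonneg_left (variance_nonneg W ν)).trans_eq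
    (integral_sub_sq_eq_variance_add hW 0).symm

lemma sq_integral_prod_sub_le {Ω' : Type*} [MeasurableSpace Ω'] {ν' : Measure Ω'}
    [IsProbabilityMeasure ν'] {h : Ω × Ω' → ℝ} (hh : MemLp h 2 (ν.prod ν')) {f : Ω → ℝ}
    (hf : MemLp f 2 ν) :
    (∫ z, h z ∂ν.prod ν' - ∫ ω, f ω ∂ν) ^ 2 ≤ ∫ ω, ∫ ω', (h (ω, ω') - f ω) ^ 2 ∂ν' ∂ν := by
  have hfst : MemLp (fun z : Ω × Ω' => f z.1) 2 (ν.prod ν') :=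
    hf.comp_measurePreserving measurePreserving_fst
  have hsub : MemLp (fun z => h z - f z.1) 2 (ν.prod ν') := hh.sub hfst
  calc (∫ z, h z ∂ν.prod ν' - ∫ ω, f ω ∂ν) ^ 2 = (∫ z, (h z - f z.1) ∂ν.prod ν') ^ 2 := by
        rw [integral_sub (hh.integrable one_le_two) (hfst.integrable one_le_two),
          integral_fun_fst, probReal_univ, one_smul]
    _ ≤ ∫ z, (h z - f z.1) ^ 2 ∂ν.prod ν' := sq_integral_le_integral_sq hsub
    _ = ∫ ω, ∫ ω', (h (ω, ω') - f ω) ^ 2 ∂ν' ∂ν := integral_prod _ hsub.integrable_sq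

lemma one_sub_div_le_measureReal_abs_sub_le {W : Ω → ℝ} (hWm : Measurable W) (hW : MemLp W 2 ν)
    (t : ℝ) {ρ : ℝ} (hρ : 0 < ρ) :
    1 - (∫ ω, (W ω - t) ^ 2 ∂ν) / ρ ^ 2 ≤ ν.real {ω | |W ω - t| ≤ ρ} := by
  have hset : MeasurableSet {ω | |W ω - t| ≤ ρ} := measurableSet_le (by fun_prop) measurable_const
  have hmarkov := mul_meas_ge_le_integral_of_nonneg (.of_forall fun ω => sq_nonneg (W ω - t))
    (hW.sub (memLp_const t)).integrable_sq (ρ ^ 2)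
  have hcompl : ν.real {ω | |W ω - t| ≤ ρ}ᶜ ≤ ν.real {ω | ρ ^ 2 ≤ (W ω - t) ^ 2} :=
    measureReal_mono fun ω hω => by
      have hlt : ρ < |W ω - t| := by simpa using hω
      simpa using pow_le_pow_left₀ hρ.le hlt.le 2
  rw [probReal_compl_eq_one_sub hset] at hcompl
  have hdiv := (le_div_iff₀' (by positivity)).2 hmarkov
  linarith

variable {κ : Type*} [Fintype κ]

/-- The average of `h` over a family of sample points. -/
def sampleMean (h : Ω → ℝ) (ω : κ → Ω) : ℝ := (∑ j, h (ω j)) / Fintype.card κ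

lemma memLp_sampleMean {h : Ω → ℝ} (hh : MemLp h 2 ν) :
    MemLp (sampleMean h) 2 (Measure.pi fun _ : κ => ν) := by
  have hsum : MemLp (fun ω : κ → Ω => ∑ j, h (ω j)) 2 (Measure.pi fun _ : κ => ν) :=
    memLp_finsetSum _ fun j _ => hh.comp_measurePreserving (measurePreserving_eval _ j)
  unfold sampleMean
  simpa only [div_eq_mul_inv] using hsum.mul_const (Fintype.card κ : ℝ)⁻¹

variable [Nonempty κ]

lemma integral_sampleMean {h : Ω → ℝ} (hh : MemLp h 2 ν) :
    ∫ ω, sampleMean h ω ∂(Measure.pi fun _ : κ => ν) = ∫ ω, h ω ∂ν := by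
  simp only [sampleMean]
  have hint (j : κ) : Integrable (fun ω : κ → Ω => h (ω j)) (Measure.pi fun _ : κ => ν) :=
    (hh.comp_measurePreserving (measurePreserving_eval _ j)).integrable one_le_two
  rw [integral_div, integral_finsetSum _ fun j _ => hint j]
  simp only [integral_comp_eval (μ := fun _ : κ => ν) hh.aestronglyMeasurable]
  simp

lemma variance_sampleMean_le {h : Ω → ℝ} (hh : MemLp h 2 ν) :
    variance (sampleMean h) (Measure.pi fun _ : κ => ν) ≤ (∫ ω, h ω ^ 2 ∂ν) / Fintype.card κ := by
  have hcard : (Fintype.card κ : ℝ) ≠ 0 := by simp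
  have hmean : sampleMean h =
      fun ω : κ → Ω => (Fintype.card κ : ℝ)⁻¹ * (∑ j, fun ω : κ → Ω => h (ω j)) ω := by
    ext ω
    simp [sampleMean, div_eq_inv_mul]
  calc variance (sampleMean h) (Measure.pi fun _ : κ => ν)
      = variance h ν / Fintype.card κ := by
        rw [hmean, variance_const_mul, variance_sum_pi fun _ => hh]
        simp only [Finset.sum_const, Finset.card_univ, nsmul_eq_mul]
        field_simp
    _ ≤ _ := by
        gcongr
        exact variance_le_expectation_sq hh.aestronglyMeasurable

lemma le_measureReal_abs_sampleMean_sub_le {h : Ω → ℝ} (hm : Measurable h) (hh : MemLp h 2 ν)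
    (t : ℝ) {ρ : ℝ} (hρ : 0 < ρ) :
    1 - ((∫ ω, h ω ^ 2 ∂ν) / Fintype.card κ + (∫ ω, h ω ∂ν - t) ^ 2) / ρ ^ 2 ≤
      (Measure.pi fun _ : κ => ν).real {ω | |sampleMean h ω - t| ≤ ρ} := by
  refine le_trans ?_ (one_sub_div_le_measureReal_abs_sub_le
    (by unfold sampleMean; fun_prop) (memLp_sampleMean hh) t hρ)
  rw [integral_sub_sq_eq_variance_add (memLp_sampleMean hh), integral_sampleMean hh]
  gcongr
  exact variance_sampleMean_le hh

end SampleMean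

section CounterPow

variable {V ι : Type*} [Fintype V] [DecidableEq V] [Fintype ι] {N : ℕ}

/-- The `q`-th power of the rounded total that reaches the root of `T` when the vertices hold the
sketches of the vectors `X v`, as a function of the uniform variables that generate the sketch
coefficients (`ω.1`) and drive the rounding (`ω.2`). -/
def counterPow (p q : ℝ) (T : ParentTree V) (g : ℕ → ℝ) (L : ℕ) (X : V → ι → ℝ)
    (ω : (ι × Fin N → ℝ) × (V → ℝ)) : ℝ :=
  g (T.treeIdx g L (fun v => sketch p N ω.1 (X v)) ω.2 T.root) ^ q

variable {p q r : ℝ} {L : ℕ} {T : ParentTree V} {τ γ B : ℝ} {X : V → ι → ℝ}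

lemma measurable_counterPow (p q : ℝ) (T : ParentTree V) (g : ℕ → ℝ) (L : ℕ) (X : V → ι → ℝ) :
    Measurable (counterPow (N := N) p q T g L X) := by
  have hsketch : Measurable fun ω : (ι × Fin N → ℝ) × (V → ℝ) =>
      ((fun v => sketch p N ω.1 (X v)), ω.2) :=
    (measurable_pi_lambda _ fun v => (measurable_sketch p N (X v)).comp measurable_fst).prodMk
      measurable_snd
  exact (measurable_of_countable fun i => g i ^ q).comp ((T.measurable_treeIdx g L T.root).comp
    hsketch)

lemma memLp_counterPow (p q : ℝ) (T : ParentTree V) (g : ℕ → ℝ) (L : ℕ) (X : V → ι → ℝ)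
    (s : ENNReal) (μ : Measure ((ι × Fin N → ℝ) × (V → ℝ))) [IsFiniteMeasure μ] :
    MemLp (counterPow p q T g L X) s μ :=
  MemLp.of_bound (measurable_counterPow p q T g L X).aestronglyMeasurable
    (∑ i ∈ Finset.range (L + 1), |g i ^ q|) <| .of_forall fun ω =>
      Finset.single_le_sum (f := fun i => |g i ^ q|) (fun _ _ => abs_nonneg _)
        (Finset.mem_range.2 (Nat.lt_succ_of_le (T.treeIdx_le g L _ ω.2 T.root)))

lemma integral_counterPow_sq_le (hτ : 0 < τ) (hγ : 0 < γ) (hq0 : 0 ≤ q) (hq1 : 2 * q ≤ 1)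
    (hX : ∀ v i, 0 ≤ X v i)
    (hint : Integrable (fun a => sketch p N a (∑ v, X v) ^ (2 * q)) (unitUniforms (ι × Fin N))) :
    ∫ ω, counterPow p q T (grid τ γ) L X ω ^ 2
        ∂(unitUniforms (ι × Fin N)).prod (unitUniforms V) ≤
      ∫ a, sketch p N a (∑ v, X v) ^ (2 * q) ∂unitUniforms (ι × Fin N) := by
  rw [integral_prod _ (memLp_counterPow p q T _ L X 2 _).integrable_sq]
  refine integral_mono_of_nonneg (.of_forall fun a => integral_nonneg fun b => sq_nonneg _) hint
    (.of_forall fun a => ?_)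
  simpa only [counterPow, rpow_two_mul (grid_nonneg hτ hγ _)] using
    ParentTree.integral_treeIdx_root_rpow_le (T := T) (L := L) hτ hγ
      (fun v => sketch_nonneg p (hX v) a) (sketch_sum p a Finset.univ X) (q := 2 * q)
      (by linarith) hq1

lemma integral_counterPow_sub_sq_le (hτ : 0 < τ) (hτ1 : τ ≤ 1) (hγ : 0 < γ) (hγ1 : γ ≤ 1)
    (hL : 0 < L) (hB : 1 ≤ B) (hBL : 6 * Fintype.card V * B / γ ≤ grid τ γ L)
    (hq0 : 0 < q) (hq1 : 2 * q ≤ 1) (hr : 0 ≤ r) (hX : ∀ v i, 0 ≤ X v i)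
    (hint : Integrable (fun a => sketch p N a (∑ v, X v) ^ (2 * q)) (unitUniforms (ι × Fin N)))
    (hintr : Integrable (fun a => sketch p N a (∑ v, X v) ^ (2 * q + r))
      (unitUniforms (ι × Fin N))) :
    (∫ ω, counterPow p q T (grid τ γ) L X ω ∂(unitUniforms (ι × Fin N)).prod (unitUniforms V) -
        ∫ a, sketch p N a (∑ v, X v) ^ q ∂unitUniforms (ι × Fin N)) ^ 2 ≤
      3 * γ * ∫ a, sketch p N a (∑ v, X v) ^ (2 * q) ∂unitUniforms (ι × Fin N) +
        (3 * τ ^ 2 / γ) ^ q +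
        2 * ((∫ a, sketch p N a (∑ v, X v) ^ (2 * q + r) ∂unitUniforms (ι × Fin N)) *
          B ^ (-r)) := by
  have hsketch0 (a : ι × Fin N → ℝ) : 0 ≤ sketch p N a (∑ v, X v) := by
    rw [sketch_sum]
    exact Finset.sum_nonneg fun v _ => sketch_nonneg p (hX v) a
  have hsketch : MemLp (fun a => sketch p N a (∑ v, X v) ^ q) 2 (unitUniforms (ι × Fin N)) := by
    rw [memLp_two_iff_integrable_sq ((measurable_sketch p N _).pow_const q).aestronglyMeasurable]
    simpa only [rpow_two_mul (hsketch0 _)] using hint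
  have hmid := hint.const_mul (3 * γ)
  have hhigh := (hintr.mul_const (B ^ (-r))).const_mul 2
  have hlow := integrable_const (μ := unitUniforms (ι × Fin N)) ((3 * τ ^ 2 / γ) ^ q)
  refine (sq_integral_prod_sub_le (memLp_counterPow p q T (grid τ γ) L X 2 _) hsketch).trans ?_
  refine (integral_mono_of_nonneg (.of_forall fun a => integral_nonneg fun b => sq_nonneg _)
    ((hmid.add hlow).add hhigh) (.of_forall fun a =>
      ParentTree.integral_treeIdx_root_rpow_sub_sq_le hτ hτ1 hγ hγ1
        (fun v => sketch_nonneg p (hX v) a) hL (sketch_sum p a Finset.univ X) hB hBL hq0 hq1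
        hr)).trans_eq ?_
  rw [integral_add' (hmid.add hlow) hhigh, integral_add' hmid hlow]
  simp only [integral_mul_const, integral_const_mul, integral_const, probReal_univ, one_smul]

end CounterPow

/-! ### Choice of parameters -/

section GridParameters

/-- The first grid point above `0` for relative spacing `γ`. The exponent makes the error caused by
totals of order `gridUnit p γ / γ` at most `γ`, see `gridUnit_error_le`. -/
def gridUnit (p γ : ℝ) : ℝ := γ ^ (1 + 3 / p)

/-- The total beyond which rounding need not be accurate when the `p`-th frequency moment is at most
`Q`. Its size makes the resulting error at most `γ`, see `rpow_mul_rangeCutoff_rpow_le`. -/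
def rangeCutoff (p γ Q : ℝ) : ℝ := (Q * γ ^ (-6 : ℝ)) ^ p⁻¹

/-- The number of bits of a grid index for relative spacing `γ` and frequency moments up to `Q`. The
maximum replaces `logb 2 Q` by `1` when `Q` is small. -/
def indexBits (p γ Q : ℝ) : ℕ :=
  ⌈Real.logb 2 (2 * (5 + 10 / p) * max 1 (Real.logb 2 Q) / γ ^ 2 + 2)⌉₊

variable {p γ Q : ℝ}

lemma gridUnit_pos (p : ℝ) (hγ : 0 < γ) : 0 < gridUnit p γ := Real.rpow_pos_of_pos hγ _

lemma gridUnit_le_one (hp : 0 < p) (hγ : 0 < γ) (hγ1 : γ ≤ 1) : gridUnit p γ ≤ 1 :=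
  Real.rpow_le_one hγ.le hγ1 (by positivity)

lemma gridUnit_error_le (hp : 0 < p) (hγ : 0 < γ) (hγ3 : γ ≤ 1 / 3) :
    (3 * gridUnit p γ ^ 2 / γ) ^ (p / 3) ≤ γ := by
  have hle1 : γ ^ (3 / p) ≤ 1 := Real.rpow_le_one hγ.le (by linarith) (by positivity)
  have hbase : 3 * gridUnit p γ ^ 2 / γ ≤ γ ^ (3 / p) := by
    calc 3 * gridUnit p γ ^ 2 / γ = 3 * γ * γ ^ (3 / p) * γ ^ (3 / p) := by
          rw [gridUnit, Real.rpow_add hγ, Real.rpow_one]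
          field_simp
      _ ≤ 1 * 1 * γ ^ (3 / p) := by
          gcongr
          linarith
      _ = γ ^ (3 / p) := by ring
  calc (3 * gridUnit p γ ^ 2 / γ) ^ (p / 3) ≤ (γ ^ (3 / p)) ^ (p / 3) :=
        Real.rpow_le_rpow (by positivity) hbase (by positivity)
    _ = γ := by rw [← Real.rpow_mul hγ.le, show 3 / p * (p / 3) = 1 by field_simp, Real.rpow_one]

lemma one_le_rangeCutoff (hp : 0 < p) (hγ : 0 < γ) (hγ1 : γ ≤ 1) (hQ : 1 ≤ Q) :
    1 ≤ rangeCutoff p γ Q :=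
  Real.one_le_rpow (one_le_mul_of_one_le_of_one_le hQ
    (Real.one_le_rpow_of_pos_of_le_one_of_nonpos hγ hγ1 (by norm_num))) (by positivity)

lemma rpow_mul_rangeCutoff_rpow_le {F : ℝ} (hp : 0 < p) (hγ : 0 < γ) (hF : 0 < F) (hFQ : F ≤ Q) :
    F ^ (1 / 6 : ℝ) * rangeCutoff p γ Q ^ (-(p / 6)) ≤ γ := by
  have hQ : 0 < Q := hF.trans_le hFQ
  have hcutoff : rangeCutoff p γ Q ^ (-(p / 6)) = (Q ^ (1 / 6 : ℝ))⁻¹ * γ := by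
    rw [rangeCutoff, ← Real.rpow_mul (by positivity),
      show p⁻¹ * (-(p / 6)) = -(1 / 6) by field_simp, Real.mul_rpow hQ.le (by positivity),
      Real.rpow_neg hQ.le, ← Real.rpow_mul hγ.le]
    norm_num
  rw [hcutoff, ← mul_assoc, ← div_eq_mul_inv]
  refine mul_le_of_le_one_left hγ.le ((div_le_one (by positivity)).2 ?_)
  exact Real.rpow_le_rpow hF.le hFQ (by norm_num)

lemma half_le_log_one_add (hγ : 0 < γ) (hγ1 : γ ≤ 1) : γ / 2 ≤ Real.log (1 + γ) := by
  refine le_trans ?_ (Real.one_sub_inv_le_log_of_pos (by linarith))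
  rw [show 1 - (1 + γ)⁻¹ = γ / (1 + γ) by field_simp; ring]
  exact div_le_div_of_nonneg_left hγ.le (by linarith) (by linarith)

lemma log_le_max_logb_two (hQ : 1 ≤ Q) : Real.log Q ≤ max 1 (Real.logb 2 Q) := by
  refine le_max_of_le_right ?_
  rw [Real.logb, le_div_iff₀ (Real.log_pos one_lt_two)]
  exact mul_le_of_le_one_right (Real.log_nonneg hQ) (by linarith [Real.log_two_lt_d9])

lemma log_six_le_two : Real.log 6 ≤ 2 := by
  rw [Real.log_le_iff_le_exp (by norm_num), show (2 : ℝ) = 1 + 1 by norm_num, Real.exp_add]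
  nlinarith [Real.exp_one_gt_d9]

lemma log_rangeCutoff_sub_log_gridUnit_le {s : ℝ} (hp : 0 < p) (hγ : 0 < γ) (hγ1 : γ ≤ 1)
    (hs : 0 < s) (hsQ : s ≤ Q) (hQ : 1 ≤ Q) :
    Real.log (6 * s * rangeCutoff p γ Q / γ) - Real.log (gridUnit p γ) ≤
      (5 + 10 / p) * (max 1 (Real.logb 2 Q) / γ) := by
  have hcutoff : 0 < rangeCutoff p γ Q := one_pos.trans_le (one_le_rangeCutoff hp hγ hγ1 hQ)
  have hlogs : Real.log s ≤ Real.log Q := Real.log_le_log hs hsQ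
  have hlogγ : -Real.log γ ≤ γ⁻¹ := by
    rw [← Real.log_inv]
    linarith [Real.log_le_sub_one_of_pos (inv_pos.2 hγ)]
  set Z := max 1 (Real.logb 2 Q)
  have hZ1 : 1 ≤ Z := le_max_left _ _
  have hγinv : 1 ≤ γ⁻¹ := (one_le_inv₀ hγ).2 hγ1
  have hZγ : Z ≤ Z / γ := le_mul_of_one_le_right (by linarith) hγinv
  have hlogQ : Real.log Q ≤ Z / γ := (log_le_max_logb_two hQ).trans hZγ
  have hloginv : -Real.log γ ≤ Z / γ := hlogγ.trans (le_mul_of_one_le_left (by linarith) hZ1)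
  rw [Real.log_div (by positivity) hγ.ne', Real.log_mul (by positivity) hcutoff.ne',
    Real.log_mul (by norm_num) hs.ne', rangeCutoff, Real.log_rpow (by positivity),
    Real.log_mul (by positivity) (by positivity), Real.log_rpow hγ, gridUnit, Real.log_rpow hγ]
  have hlogQp := mul_le_mul_of_nonneg_left hlogQ (inv_pos.2 hp).le
  have hloginvp := mul_le_mul_of_nonneg_left hloginv (inv_pos.2 hp).le
  rw [div_eq_mul_inv 3 p, div_eq_mul_inv 10 p]
  linarith [log_six_le_two]



lemma le_two_pow_indexBits (hp : 0 < p) (γ Q : ℝ) :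
    2 * (5 + 10 / p) * max 1 (Real.logb 2 Q) / γ ^ 2 + 2 ≤ 2 ^ indexBits p γ Q := by
  rw [← Real.rpow_natCast 2 (indexBits p γ Q),
    ← Real.logb_le_iff_le_rpow one_lt_two (by positivity)]
  exact Nat.le_ceil _

lemma two_le_two_pow_indexBits (hp : 0 < p) (γ Q : ℝ) : 2 ≤ 2 ^ indexBits p γ Q := by
  have h : (2 : ℝ) ≤ 2 ^ indexBits p γ Q :=
    (le_add_of_nonneg_left (by positivity)).trans (le_two_pow_indexBits hp γ Q)
  exact_mod_cast h

lemma rangeCutoff_le_grid {s : ℝ} (hp : 0 < p) (hγ : 0 < γ) (hγ1 : γ ≤ 1) (hs : 0 < s)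
    (hsQ : s ≤ Q) (hQ : 1 ≤ Q) :
    6 * s * rangeCutoff p γ Q / γ ≤ grid (gridUnit p γ) γ (2 ^ indexBits p γ Q - 1) := by
  obtain ⟨j, hj⟩ := Nat.exists_eq_add_of_le' (two_le_two_pow_indexBits hp γ Q)
  have hcutoff : 0 < rangeCutoff p γ Q := one_pos.trans_le (one_le_rangeCutoff hp hγ hγ1 hQ)
  have hunit := gridUnit_pos p hγ
  have hjle : 2 * (5 + 10 / p) * max 1 (Real.logb 2 Q) / γ ^ 2 ≤ j := by
    have hpow : (2 : ℝ) ^ indexBits p γ Q = j + 2 := by exact_mod_cast hj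
    linarith [le_two_pow_indexBits hp γ Q]
  have hstep : (5 + 10 / p) * (max 1 (Real.logb 2 Q) / γ) ≤ j * (γ / 2) := by
    refine le_trans (le_of_eq ?_) (mul_le_mul_of_nonneg_right hjle (by positivity))
    field_simp
  have hlog := mul_le_mul_of_nonneg_left (half_le_log_one_add hγ hγ1) (Nat.cast_nonneg (α := ℝ) j)
  rw [hj, show j + 2 - 1 = j + 1 by omega, grid_succ,
    ← Real.log_le_log_iff (by positivity) (by positivity),
    Real.log_mul hunit.ne' (by positivity), Real.log_pow]
  linarith [log_rangeCutoff_sub_log_gridUnit_le hp hγ hγ1 hs hsQ hQ]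

/-- For `Q = 1` this relies on `Real.logb 2 0 = 0`. -/
lemma logb_max_one_logb_natCast (Q : ℕ) :
    Real.logb 2 (max 1 (Real.logb 2 Q)) = Real.logb 2 (Real.logb 2 Q) := by
  rcases Nat.lt_or_ge Q 2 with hQ | hQ
  · interval_cases Q <;> simp
  · rw [max_eq_right]
    rw [Real.le_logb_iff_rpow_le one_lt_two (by positivity), Real.rpow_one]
    exact_mod_cast hQ

lemma indexBits_le (hp : 0 < p) (hγ : 0 < γ) (hγ1 : γ ≤ 1) (Q : ℕ) :
    (indexBits p γ Q : ℝ) ≤ Real.logb 2 (12 + 20 / p) + Real.logb 2 (Real.logb 2 Q) +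
      2 * Real.logb 2 (1 / γ) + 1 := by
  rw [← logb_max_one_logb_natCast]
  set Z := max 1 (Real.logb 2 Q)
  have hZ1 : 1 ≤ Z := le_max_left _ _
  have harg : 2 * (5 + 10 / p) * Z / γ ^ 2 + 2 ≤ (12 + 20 / p) * Z * (1 / γ) ^ 2 := by
    have hone : 1 ≤ Z / γ ^ 2 := by
      rw [le_div_iff₀ (by positivity), one_mul]
      exact (pow_le_one₀ hγ.le hγ1).trans hZ1
    calc 2 * (5 + 10 / p) * Z / γ ^ 2 + 2 ≤ 2 * (5 + 10 / p) * Z / γ ^ 2 + 2 * (Z / γ ^ 2) := by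
          linarith
      _ = (12 + 20 / p) * Z * (1 / γ) ^ 2 := by
          field_simp
          ring
  have hceil : (indexBits p γ Q : ℝ) ≤ Real.logb 2 (2 * (5 + 10 / p) * Z / γ ^ 2 + 2) + 1 :=
    (Nat.ceil_lt_add_one (Real.logb_nonneg one_lt_two
      (one_le_two.trans (le_add_of_nonneg_left (by positivity))))).le
  have hlog := Real.logb_le_logb_of_le one_lt_two (by positivity) harg
  rw [Real.logb_mul (by positivity) (by positivity), Real.logb_mul (by positivity) (by positivity),
    Real.logb_pow] at hlog
  push_cast at hlog
  linarith

end GridParameters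

section CubeEstimate

variable {ε F C : ℝ}

lemma abs_pow_three_sub_le {w f : ℝ} (hε : 0 ≤ ε) (hε1 : ε ≤ 1) (hf : 0 ≤ f)
    (h : |w - f| ≤ ε / 7 * f) : |w ^ 3 - f ^ 3| ≤ ε * f ^ 3 := by
  have hw : |w| ≤ 2 * f := by
    have htri : |w| ≤ |w - f| + |f| := by simpa using abs_add_le (w - f) f
    rw [abs_of_nonneg hf] at htri
    nlinarith
  have hfactor : |w ^ 2 + w * f + f ^ 2| ≤ 7 * f ^ 2 := by
    obtain ⟨hlower, hupper⟩ := abs_le.1 hw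
    rw [abs_le]
    constructor <;> nlinarith [mul_nonneg hf (sub_nonneg.2 hupper), sq_nonneg (w + f)]
  calc |w ^ 3 - f ^ 3| = |w - f| * |w ^ 2 + w * f + f ^ 2| := by
        rw [← abs_mul]
        congr 1
        ring
    _ ≤ (ε / 7 * f) * (7 * f ^ 2) := by gcongr
    _ = ε * f ^ 3 := by ring

lemma abs_div_pow_three_sub_le {y : ℝ} (hε : 0 ≤ ε) (hε1 : ε ≤ 1) (hC : 0 < C) (hF : 0 ≤ F)
    (h : |y - C * F ^ (1 / 3 : ℝ)| ≤ ε / 7 * (C * F ^ (1 / 3 : ℝ))) :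
    |(y / C) ^ 3 - F| ≤ ε * F := by
  have hcube : (F ^ (1 / 3 : ℝ)) ^ 3 = F := by
    rw [← Real.rpow_mul_natCast hF]
    norm_num
  have hdiv : |y / C - F ^ (1 / 3 : ℝ)| ≤ ε / 7 * F ^ (1 / 3 : ℝ) := by
    refine le_of_mul_le_mul_left ?_ hC
    calc C * |y / C - F ^ (1 / 3 : ℝ)| = |y - C * F ^ (1 / 3 : ℝ)| := by
          rw [← abs_of_pos hC, ← abs_mul, abs_of_pos hC, mul_sub, mul_div_cancel₀ y hC.ne']
      _ ≤ C * (ε / 7 * F ^ (1 / 3 : ℝ)) := h.trans_eq (by ring)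
  simpa only [hcube] using abs_pow_three_sub_le hε hε1 (Real.rpow_nonneg hF _) hdiv

variable {Ω κ : Type*} [MeasurableSpace Ω] [Fintype κ] [Nonempty κ] {ν : Measure Ω}
  [IsProbabilityMeasure ν] {h : Ω → ℝ}

lemma two_thirds_le_measureReal_abs_cube_sampleMean_sub_le (hε : 0 < ε) (hε1 : ε ≤ 1) (hC : 0 < C)
    (hF : 0 < F) (hm : Measurable h) (hh : MemLp h 2 ν)
    (hvar : (∫ ω, h ω ^ 2 ∂ν) / Fintype.card κ ≤ (ε / 7 * (C * F ^ (1 / 3 : ℝ))) ^ 2 / 6)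
    (hbias : (∫ ω, h ω ∂ν - C * F ^ (1 / 3 : ℝ)) ^ 2 ≤ (ε / 7 * (C * F ^ (1 / 3 : ℝ))) ^ 2 / 6) :
    2 / 3 ≤ (Measure.pi fun _ : κ => ν).real {ω | |(sampleMean h ω / C) ^ 3 - F| ≤ ε * F} := by
  have hρ : 0 < ε / 7 * (C * F ^ (1 / 3 : ℝ)) := by positivity
  calc (2 / 3 : ℝ) ≤ 1 - ((∫ ω, h ω ^ 2 ∂ν) / Fintype.card κ +
        (∫ ω, h ω ∂ν - C * F ^ (1 / 3 : ℝ)) ^ 2) / (ε / 7 * (C * F ^ (1 / 3 : ℝ))) ^ 2 := by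
        rw [le_sub_comm, div_le_iff₀ (by positivity)]
        linarith
    _ ≤ (Measure.pi fun _ : κ => ν).real
          {ω | |sampleMean h ω - C * F ^ (1 / 3 : ℝ)| ≤ ε / 7 * (C * F ^ (1 / 3 : ℝ))} :=
        le_measureReal_abs_sampleMean_sub_le hm hh _ hρ
    _ ≤ _ := measureReal_mono fun ω hω => abs_div_pow_three_sub_le hε.le hε1 hC hF.le hω

end CubeEstimate

section EstimatorParameters

variable {p ε : ℝ}

/-- The mean of the estimator of `F_p ^ (1 / 3)` is, in the limit, `meanConst p * F_p ^ (1 / 3)`. -/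
def meanConst (p : ℝ) : ℝ := stableMoment p (p / 3)

/-- The second moment of the estimator of `F_p ^ (1 / 3)` is at most
`sqMomentConst p * F_p ^ (2 / 3)`. -/
def sqMomentConst (p : ℝ) : ℝ := sketchMomentBound p (2 * (p / 3))

/-- The constant of the moment of order `5 * p / 6`, which controls the overflow of the grid. -/
def tailMomentConst (p : ℝ) : ℝ := sketchMomentBound p (2 * (p / 3) + p / 6)

/-- The ratio of the grid spacing to `ε ^ 2`. The second term of the minimum makes the squared
rounding bias at most `1 / 24` of the squared tolerance `(ε / 7) ^ 2`; note `1176 = 24 * 7 ^ 2`. -/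
def spacingConst (p : ℝ) : ℝ :=
  min (1 / 3) (meanConst p ^ 2 / (1176 * (3 * sqMomentConst p + 1 + 2 * tailMomentConst p)))

/-- The relative spacing of the grid for accuracy `ε`. -/
def spacing (p ε : ℝ) : ℝ := spacingConst p * ε ^ 2

/-- The ratio of the number of independent copies to `ε ^ (-2)`. It makes the variance of their mean
at most `1 / 6` of the squared tolerance `(ε / 7) ^ 2`; note `294 = 6 * 7 ^ 2`. -/
def copiesConst (p : ℝ) : ℝ := 294 * sqMomentConst p / meanConst p ^ 2

/-- The number of independent copies that are averaged for accuracy `ε`. -/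
def copies (p ε : ℝ) : ℕ := ⌈copiesConst p / ε ^ 2⌉₊

/-- The constant in the bound on the number of bits of a grid index for accuracy `ε`. -/
def bitsConst (p : ℝ) : ℝ := 5 + |Real.logb 2 ((12 + 20 / p) / spacingConst p ^ 2)|

lemma meanConst_pos (hp0 : 0 < p) (hp1 : p < 1) : 0 < meanConst p :=
  stableMoment_pos hp0 hp1 (by linarith) (by linarith)

lemma sqMomentConst_pos (hp0 : 0 < p) (hp1 : p < 1) : 0 < sqMomentConst p :=
  sketchMomentBound_pos hp0 hp1 (by linarith) (by linarith)

lemma tailMomentConst_pos (hp0 : 0 < p) (hp1 : p < 1) : 0 < tailMomentConst p :=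
  sketchMomentBound_pos hp0 hp1 (by linarith) (by linarith)

lemma spacingConst_pos (hp0 : 0 < p) (hp1 : p < 1) : 0 < spacingConst p := by
  have := meanConst_pos hp0 hp1
  have := sqMomentConst_pos hp0 hp1
  have := tailMomentConst_pos hp0 hp1
  exact lt_min (by norm_num) (by positivity)

lemma spacing_pos (hp0 : 0 < p) (hp1 : p < 1) (hε : 0 < ε) : 0 < spacing p ε :=
  mul_pos (spacingConst_pos hp0 hp1) (pow_pos hε 2)

lemma spacing_le (hp0 : 0 < p) (hp1 : p < 1) (hε : 0 < ε) (hε1 : ε ≤ 1) : spacing p ε ≤ 1 / 3 :=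
  (mul_le_of_le_one_right (spacingConst_pos hp0 hp1).le (pow_le_one₀ hε.le hε1)).trans
    (min_le_left _ _)

lemma spacing_mul_le (hp0 : 0 < p) (hp1 : p < 1) (ε : ℝ) :
    spacing p ε * (3 * sqMomentConst p + 1 + 2 * tailMomentConst p) ≤
      (ε / 7 * meanConst p) ^ 2 / 24 := by
  have := sqMomentConst_pos hp0 hp1
  have := tailMomentConst_pos hp0 hp1
  calc spacing p ε * (3 * sqMomentConst p + 1 + 2 * tailMomentConst p)
      ≤ meanConst p ^ 2 / (1176 * (3 * sqMomentConst p + 1 + 2 * tailMomentConst p)) * ε ^ 2 *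
          (3 * sqMomentConst p + 1 + 2 * tailMomentConst p) := by
        unfold spacing
        gcongr
        exact min_le_right _ _
    _ = (ε / 7 * meanConst p) ^ 2 / 24 := by
        field_simp
        ring

lemma copiesConst_pos (hp0 : 0 < p) (hp1 : p < 1) : 0 < copiesConst p := by
  have := meanConst_pos hp0 hp1
  have := sqMomentConst_pos hp0 hp1
  unfold copiesConst
  positivity

lemma copies_pos (hp0 : 0 < p) (hp1 : p < 1) (hε : 0 < ε) : 0 < copies p ε :=
  Nat.ceil_pos.2 (div_pos (copiesConst_pos hp0 hp1) (pow_pos hε 2))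

lemma sqMomentConst_div_copies_le (hp0 : 0 < p) (hp1 : p < 1) (hε : 0 < ε) :
    sqMomentConst p / copies p ε ≤ (ε / 7 * meanConst p) ^ 2 / 6 := by
  have hmean := meanConst_pos hp0 hp1
  have hceil : copiesConst p / ε ^ 2 ≤ copies p ε := Nat.le_ceil _
  rw [div_le_iff₀ (by exact_mod_cast copies_pos hp0 hp1 hε)]
  calc sqMomentConst p = (ε / 7 * meanConst p) ^ 2 / 6 * (copiesConst p / ε ^ 2) := by
        rw [copiesConst]
        field_simp
        ring
    _ ≤ (ε / 7 * meanConst p) ^ 2 / 6 * copies p ε := by gcongr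

lemma copies_le (hp0 : 0 < p) (hp1 : p < 1) (hε : 0 < ε) (hε1 : ε ≤ 1) :
    (copies p ε : ℝ) ≤ (copiesConst p + 1) / ε ^ 2 := by
  have hnonneg : 0 ≤ copiesConst p / ε ^ 2 := div_nonneg (copiesConst_pos hp0 hp1).le (sq_nonneg ε)
  have hone : 1 ≤ 1 / ε ^ 2 := (one_le_div (by positivity)).2 (pow_le_one₀ hε.le hε1)
  rw [add_div]
  exact (Nat.ceil_lt_add_one hnonneg).le.trans (by gcongr)

lemma bitsConst_pos (p : ℝ) : 0 < bitsConst p := by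
  unfold bitsConst
  positivity

lemma logb_logb_natCast_nonneg (Q : ℕ) : 0 ≤ Real.logb 2 (Real.logb 2 Q) := by
  rw [← logb_max_one_logb_natCast]
  exact Real.logb_nonneg one_lt_two (le_max_left _ _)

lemma indexBits_spacing_le (hp0 : 0 < p) (hp1 : p < 1) (hε : 0 < ε) (hε1 : ε ≤ 1) (Q : ℕ) :
    (indexBits p (spacing p ε) Q : ℝ) ≤
      bitsConst p * (Real.logb 2 (Real.logb 2 Q) + Real.logb 2 (2 / ε)) := by
  have hc := spacingConst_pos hp0 hp1
  have hbits := indexBits_le hp0 (spacing_pos hp0 hp1 hε)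
    ((spacing_le hp0 hp1 hε hε1).trans (by norm_num)) Q
  have hspacing : Real.logb 2 (12 + 20 / p) + 2 * Real.logb 2 (1 / spacing p ε) =
      Real.logb 2 ((12 + 20 / p) / spacingConst p ^ 2) + 4 * Real.logb 2 (1 / ε) := by
    rw [spacing, one_div, one_div, Real.logb_inv, Real.logb_inv,
      Real.logb_mul hc.ne' (by positivity), Real.logb_pow, Real.logb_div (by positivity)
      (by positivity), Real.logb_pow]
    push_cast
    ring
  have htwo : Real.logb 2 (2 / ε) = 1 + Real.logb 2 (1 / ε) := by
    rw [← mul_one_div, Real.logb_mul two_ne_zero (by positivity),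
      Real.logb_self_eq_one one_lt_two]
  have hlogε : 0 ≤ Real.logb 2 (1 / ε) := Real.logb_nonneg one_lt_two ((one_le_div hε).2 hε1)
  have hloglog := logb_logb_natCast_nonneg Q
  have habs := abs_nonneg (Real.logb 2 ((12 + 20 / p) / spacingConst p ^ 2))
  rw [htwo, bitsConst]
  nlinarith [mul_nonneg habs hlogε, mul_nonneg habs hloglog,
    le_abs_self (Real.logb 2 ((12 + 20 / p) / spacingConst p ^ 2))]

/-- The number of bits of a message: one grid index for each copy. -/
def messageLength (p ε Q : ℝ) : ℕ := indexBits p (spacing p ε) Q * copies p ε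

lemma messageLength_le (hp0 : 0 < p) (hp1 : p < 1) (hε : 0 < ε) (hε1 : ε ≤ 1) (Q : ℕ) :
    (messageLength p ε Q : ℝ) ≤ (copiesConst p + 1) * bitsConst p *
      (1 / ε ^ 2 * (Real.logb 2 (Real.logb 2 Q) + Real.logb 2 (2 / ε))) := by
  have hbits := indexBits_spacing_le hp0 hp1 hε hε1 Q
  rw [messageLength, Nat.cast_mul]
  calc (indexBits p (spacing p ε) Q : ℝ) * copies p ε
      ≤ bitsConst p * (Real.logb 2 (Real.logb 2 Q) + Real.logb 2 (2 / ε)) *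
          ((copiesConst p + 1) / ε ^ 2) :=
        mul_le_mul hbits (copies_le hp0 hp1 hε hε1) (Nat.cast_nonneg _)
          ((Nat.cast_nonneg _).trans hbits)
    _ = _ := by ring

end EstimatorParameters

section Accuracy

variable {V ι : Type*} [Fintype V] [DecidableEq V] [Fintype ι] {N : ℕ} {T : ParentTree V}
  {p γ Q F ε : ℝ} {X : V → ι → ℝ}

/-- The random variable whose mean the protocol estimates: `counterPow` with exponent `p / 3` for a
grid of relative spacing `γ` whose indices fit into `indexBits p γ Q` bits. -/
abbrev gridCounterPow (p γ Q : ℝ) (T : ParentTree V) (X : V → ι → ℝ) :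
    (ι × Fin N → ℝ) × (V → ℝ) → ℝ :=
  counterPow p (p / 3) T (grid (gridUnit p γ) γ) (2 ^ indexBits p γ Q - 1) X

lemma rpow_two_thirds (hF : 0 ≤ F) : F ^ (2 / 3 : ℝ) = (F ^ (1 / 3 : ℝ)) ^ 2 := by
  rw [← rpow_two_mul hF]
  norm_num

lemma integral_sketch_rpow_two_thirds_le (hp0 : 0 < p) (hp1 : p < 1) (hN : 0 < N) {x : ι → ℝ}
    (hx : ∀ i, 0 ≤ x i) :
    ∫ a, sketch p N a x ^ (2 * (p / 3)) ∂unitUniforms (ι × Fin N) ≤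
      sqMomentConst p * (∑ i, x i ^ p) ^ (2 / 3 : ℝ) := by
  have h := integral_sketch_rpow_le hp0 hp1 (q := 2 * (p / 3)) (by linarith) (by linarith) hN hx
  rwa [show 2 * (p / 3) / p = 2 / 3 by field_simp] at h

lemma integral_sketch_rpow_five_sixths_le (hp0 : 0 < p) (hp1 : p < 1) (hN : 0 < N) {x : ι → ℝ}
    (hx : ∀ i, 0 ≤ x i) :
    ∫ a, sketch p N a x ^ (2 * (p / 3) + p / 6) ∂unitUniforms (ι × Fin N) ≤
      tailMomentConst p * (∑ i, x i ^ p) ^ (5 / 6 : ℝ) := by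
  have h := integral_sketch_rpow_le hp0 hp1 (q := 2 * (p / 3) + p / 6) (by linarith) (by linarith)
    hN hx
  rwa [show (2 * (p / 3) + p / 6) / p = 5 / 6 by field_simp; norm_num] at h

lemma integral_gridCounterPow_sq_le (hp0 : 0 < p) (hp1 : p < 1) (hN : 0 < N) (hγ : 0 < γ)
    (hX : ∀ v i, 0 ≤ X v i) (hF : F = ∑ i, (∑ v, X v) i ^ p) :
    ∫ ω, gridCounterPow p γ Q T X ω ^ 2 ∂(unitUniforms (ι × Fin N)).prod (unitUniforms V) ≤
      sqMomentConst p * F ^ (2 / 3 : ℝ) := by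
  have hsum (i : ι) : 0 ≤ (∑ v, X v) i := by
    rw [Finset.sum_apply]
    exact Finset.sum_nonneg fun v _ => hX v i
  rw [hF]
  exact (integral_counterPow_sq_le (gridUnit_pos p hγ) hγ (by linarith) (by linarith) hX
    (integral_sketch_rpow_eq_laplace hp0 hp1 (by linarith) (by linarith) hN hsum).1).trans
      (integral_sketch_rpow_two_thirds_le hp0 hp1 hN hsum)

lemma integral_gridCounterPow_sub_sq_le [Nonempty V] (hp0 : 0 < p) (hp1 : p < 1) (hN : 0 < N)
    (hγ : 0 < γ) (hγ3 : γ ≤ 1 / 3) (hX : ∀ v i, 0 ≤ X v i) (hF : F = ∑ i, (∑ v, X v) i ^ p)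
    (hF1 : 1 ≤ F) (hFQ : F ≤ Q) (hVQ : Fintype.card V ≤ Q) :
    (∫ ω, gridCounterPow p γ Q T X ω ∂(unitUniforms (ι × Fin N)).prod (unitUniforms V) -
        ∫ a, sketch p N a (∑ v, X v) ^ (p / 3) ∂unitUniforms (ι × Fin N)) ^ 2 ≤
      γ * (3 * sqMomentConst p + 1 + 2 * tailMomentConst p) * F ^ (2 / 3 : ℝ) := by
  have hsum (i : ι) : 0 ≤ (∑ v, X v) i := by
    rw [Finset.sum_apply]
    exact Finset.sum_nonneg fun v _ => hX v i
  have hγ1 : γ ≤ 1 := hγ3.trans (by norm_num)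
  have hQ : 1 ≤ Q := hF1.trans hFQ
  have hF0 : 0 < F := one_pos.trans_le hF1
  have hcutoff := one_le_rangeCutoff hp0 hγ hγ1 hQ
  have htail := tailMomentConst_pos hp0 hp1
  have hsq := integral_sketch_rpow_two_thirds_le hp0 hp1 hN hsum
  have hfive := integral_sketch_rpow_five_sixths_le hp0 hp1 hN hsum
  rw [← hF] at hsq hfive
  have hrange : F ^ (5 / 6 : ℝ) * rangeCutoff p γ Q ^ (-(p / 6)) ≤ F ^ (2 / 3 : ℝ) * γ := by
    rw [show (5 / 6 : ℝ) = 2 / 3 + 1 / 6 by norm_num, Real.rpow_add hF0, mul_assoc]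
    gcongr
    exact rpow_mul_rangeCutoff_rpow_le hp0 hγ hF0 hFQ
  refine (integral_counterPow_sub_sq_le (r := p / 6) (gridUnit_pos p hγ)
    (gridUnit_le_one hp0 hγ hγ1) hγ hγ1 (Nat.sub_pos_of_lt (two_le_two_pow_indexBits hp0 γ Q))
    hcutoff (rangeCutoff_le_grid hp0 hγ hγ1 (by exact_mod_cast Fintype.card_pos) hVQ hQ)
    (by linarith) (by linarith) (by linarith) hX
    (integral_sketch_rpow_eq_laplace hp0 hp1 (by linarith) (by linarith) hN hsum).1
    (integral_sketch_rpow_eq_laplace hp0 hp1 (by linarith) (by linarith) hN hsum).1).trans ?_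
  calc _ ≤ 3 * γ * (sqMomentConst p * F ^ (2 / 3 : ℝ)) + γ * F ^ (2 / 3 : ℝ) +
        2 * (tailMomentConst p * F ^ (5 / 6 : ℝ) * rangeCutoff p γ Q ^ (-(p / 6))) := by
        gcongr
        exact (gridUnit_error_le hp0 hγ hγ3).trans
          (le_mul_of_one_le_right hγ.le (Real.one_le_rpow hF1 (by norm_num)))
    _ ≤ 3 * γ * (sqMomentConst p * F ^ (2 / 3 : ℝ)) + γ * F ^ (2 / 3 : ℝ) +
        2 * (tailMomentConst p * (F ^ (2 / 3 : ℝ) * γ)) := by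
        rw [mul_assoc (tailMomentConst p)]
        gcongr
    _ = _ := by ring

lemma integral_gridCounterPow_sub_meanConst_sq_le [Nonempty V] (hp0 : 0 < p) (hp1 : p < 1)
    (hε : 0 < ε) (hε1 : ε ≤ 1) (hN : 0 < N) (hX : ∀ v i, 0 ≤ X v i)
    (hF : F = ∑ i, (∑ v, X v) i ^ p) (hF1 : 1 ≤ F) (hFQ : F ≤ Q) (hVQ : Fintype.card V ≤ Q)
    (hmean : |∫ a, sketch p N a (∑ v, X v) ^ (p / 3) ∂unitUniforms (ι × Fin N) -
      meanConst p * F ^ (1 / 3 : ℝ)| ≤ ε / 35 * meanConst p) :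
    (∫ ω, gridCounterPow p (spacing p ε) Q T X ω
        ∂(unitUniforms (ι × Fin N)).prod (unitUniforms V) - meanConst p * F ^ (1 / 3 : ℝ)) ^ 2 ≤
      (ε / 7 * (meanConst p * F ^ (1 / 3 : ℝ))) ^ 2 / 6 := by
  have hround := (integral_gridCounterPow_sub_sq_le (T := T) hp0 hp1 hN (spacing_pos hp0 hp1 hε)
    (spacing_le hp0 hp1 hε hε1) hX hF hF1 hFQ hVQ).trans (mul_le_mul_of_nonneg_right
      (spacing_mul_le hp0 hp1 ε) (Real.rpow_nonneg (zero_le_one.trans hF1) _))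
  rw [rpow_two_thirds (zero_le_one.trans hF1)] at hround
  have hf : 1 ≤ (F ^ (1 / 3 : ℝ)) ^ 2 := one_le_pow₀ (Real.one_le_rpow hF1 (by norm_num))
  set f := F ^ (1 / 3 : ℝ)
  set R := ∫ ω, gridCounterPow p (spacing p ε) Q T X ω
    ∂(unitUniforms (ι × Fin N)).prod (unitUniforms V)
  set S := ∫ a, sketch p N a (∑ v, X v) ^ (p / 3) ∂unitUniforms (ι × Fin N)
  have hlimit : (S - meanConst p * f) ^ 2 ≤ (ε / 7 * meanConst p) ^ 2 / 24 * f ^ 2 := by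
    calc (S - meanConst p * f) ^ 2 ≤ (ε / 35 * meanConst p) ^ 2 :=
          sq_le_sq' (abs_le.1 hmean).1 (abs_le.1 hmean).2
      _ ≤ (ε / 7 * meanConst p) ^ 2 / 24 := by linarith [sq_nonneg (ε * meanConst p)]
      _ ≤ (ε / 7 * meanConst p) ^ 2 / 24 * f ^ 2 := le_mul_of_one_le_right (by positivity) hf
  calc (R - meanConst p * f) ^ 2 = ((R - S) + (S - meanConst p * f)) ^ 2 := by ring
    _ ≤ 2 * ((R - S) ^ 2 + (S - meanConst p * f) ^ 2) := add_sq_le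
    _ ≤ 2 * ((ε / 7 * meanConst p) ^ 2 / 24 * f ^ 2 + (ε / 7 * meanConst p) ^ 2 / 24 * f ^ 2) := by
        gcongr
    _ = (ε / 7 * (meanConst p * f)) ^ 2 / 6 := by ring

lemma two_thirds_le_measureReal_gridCounterPow [Nonempty V] (hp0 : 0 < p) (hp1 : p < 1)
    (hε : 0 < ε) (hε1 : ε ≤ 1) (hN : 0 < N) (hX : ∀ v i, 0 ≤ X v i)
    (hF : F = ∑ i, (∑ v, X v) i ^ p) (hF1 : 1 ≤ F) (hFQ : F ≤ Q) (hVQ : Fintype.card V ≤ Q)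
    (hmean : |∫ a, sketch p N a (∑ v, X v) ^ (p / 3) ∂unitUniforms (ι × Fin N) -
      meanConst p * F ^ (1 / 3 : ℝ)| ≤ ε / 35 * meanConst p) :
    2 / 3 ≤ (Measure.pi fun _ : Fin (copies p ε) =>
        (unitUniforms (ι × Fin N)).prod (unitUniforms V)).real
      {ω | |(sampleMean (gridCounterPow p (spacing p ε) Q T X) ω / meanConst p) ^ 3 - F| ≤
        ε * F} := by
  have : Nonempty (Fin (copies p ε)) := Fin.pos_iff_nonempty.1 (copies_pos hp0 hp1 hε)
  refine two_thirds_le_measureReal_abs_cube_sampleMean_sub_le hε hε1 (meanConst_pos hp0 hp1)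
    (one_pos.trans_le hF1) (measurable_counterPow _ _ _ _ _ _) (memLp_counterPow _ _ _ _ _ _ _ _) ?_
    (integral_gridCounterPow_sub_meanConst_sq_le hp0 hp1 hε hε1 hN hX hF hF1 hFQ hVQ hmean)
  have hsecond := integral_gridCounterPow_sq_le (T := T) (Q := Q) hp0 hp1 hN
    (spacing_pos hp0 hp1 hε) hX hF
  rw [rpow_two_thirds (zero_le_one.trans hF1)] at hsecond
  set f := F ^ (1 / 3 : ℝ)
  rw [Fintype.card_fin]
  calc _ ≤ sqMomentConst p * f ^ 2 / copies p ε := by gcongr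
    _ = sqMomentConst p / copies p ε * f ^ 2 := by ring
    _ ≤ (ε / 7 * meanConst p) ^ 2 / 6 * f ^ 2 :=
        mul_le_mul_of_nonneg_right (sqMomentConst_div_copies_le hp0 hp1 hε) (sq_nonneg f)
    _ = (ε / 7 * (meanConst p * f)) ^ 2 / 6 := by ring

end Accuracy

/-! ### The accurate protocol -/

section Inputs

open Filter Topology

variable {p ε : ℝ} {m n M N : ℕ} {G : SimpleGraph (Fin m)}

/-- The input of a player as a real vector. -/
def inputVec (x : Input n M) (i : Fin n) : ℝ := (x i : ℕ)

lemma sum_inputVec (X : Fin m → Input n M) (i : Fin n) :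
    (∑ v, inputVec (X v)) i = ((∑ v, (X v i : ℕ) : ℕ) : ℝ) := by
  simp [inputVec]

lemma frequencyMoment_eq_sum_inputVec (p : ℝ) (X : Fin m → Input n M) :
    frequencyMoment p X = ∑ i, (∑ v, inputVec (X v)) i ^ p := by
  simp only [frequencyMoment, sum_inputVec]

lemma sum_input_le (X : Fin m → Input n M) (i : Fin n) : ∑ v, (X v i : ℕ) ≤ m * M := by
  calc ∑ v, (X v i : ℕ) ≤ ∑ _v : Fin m, M := Finset.sum_le_sum fun v _ => Fin.is_le (X v i)
    _ = m * M := by simp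

lemma natCast_rpow_le_self (hp0 : 0 < p) (hp1 : p ≤ 1) (a : ℕ) : (a : ℝ) ^ p ≤ a := by
  rcases a.eq_zero_or_pos with rfl | ha
  · simp [Real.zero_rpow hp0.ne']
  · exact Real.rpow_le_self_of_one_le (by exact_mod_cast ha) hp1

lemma frequencyMoment_le (hp0 : 0 < p) (hp1 : p ≤ 1) (X : Fin m → Input n M) :
    frequencyMoment p X ≤ ((n * m * M : ℕ) : ℝ) := by
  calc frequencyMoment p X ≤ ∑ _i : Fin n, ((m * M : ℕ) : ℝ) := Finset.sum_le_sum fun i _ =>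
        (natCast_rpow_le_self hp0 hp1 _).trans (by exact_mod_cast sum_input_le X i)
    _ = ((n * m * M : ℕ) : ℝ) := by simp [mul_assoc]

lemma frequencyMoment_zero (hp0 : 0 < p) : frequencyMoment p (0 : Fin m → Input n M) = 0 := by
  simp [frequencyMoment, Real.zero_rpow hp0.ne']

lemma one_le_frequencyMoment (hp0 : 0 ≤ p) {X : Fin m → Input n M} (hX : X ≠ 0) :
    1 ≤ frequencyMoment p X := by
  obtain ⟨v, hv⟩ := Function.ne_iff.1 hX
  obtain ⟨i, hi⟩ := Function.ne_iff.1 hv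
  have hentry : 1 ≤ ∑ w, (X w i : ℕ) :=
    (Nat.one_le_iff_ne_zero.2 (Fin.val_ne_zero_iff.2 hi)).trans
      (Finset.single_le_sum (f := fun w => (X w i : ℕ)) (fun _ _ => Nat.zero_le _)
        (Finset.mem_univ v))
  calc (1 : ℝ) ≤ ((∑ w, (X w i : ℕ) : ℕ) : ℝ) ^ p :=
        Real.one_le_rpow (by exact_mod_cast hentry) hp0
    _ ≤ frequencyMoment p X := Finset.single_le_sum
        (f := fun i => ((∑ w, (X w i : ℕ) : ℕ) : ℝ) ^ p) (fun _ _ => by positivity)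
        (Finset.mem_univ i)

/-- A single `N` serves all inputs, since there are only finitely many. -/
lemma exists_forall_abs_integral_sketch_sub_le (hp0 : 0 < p) (hp1 : p < 1) (m n M : ℕ) {η : ℝ}
    (hη : 0 < η) :
    ∃ N : ℕ, 0 < N ∧ ∀ X : Fin m → Input n M,
      |∫ a, sketch p N a (∑ v, inputVec (X v)) ^ (p / 3) ∂unitUniforms (Fin n × Fin N) -
        meanConst p * frequencyMoment p X ^ (1 / 3 : ℝ)| ≤ η := by
  have hclose (X : Fin m → Input n M) : ∀ᶠ N : ℕ in atTop,
      |∫ a, sketch p N a (∑ v, inputVec (X v)) ^ (p / 3) ∂unitUniforms (Fin n × Fin N) -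
        meanConst p * frequencyMoment p X ^ (1 / 3 : ℝ)| ≤ η := by
    have hlim := tendsto_integral_sketch_rpow hp0 hp1 (q := p / 3) (by linarith) (by linarith)
      (x := ∑ v, inputVec (X v)) fun i => by rw [sum_inputVec]; exact Nat.cast_nonneg _
    rw [← frequencyMoment_eq_sum_inputVec, ← meanConst, show p / 3 / p = 1 / 3 by field_simp]
      at hlim
    simpa only [Metric.mem_closedBall, Real.dist_eq] using
      hlim.eventually (Metric.closedBall_mem_nhds _ hη)
  exact ((eventually_gt_atTop 0).and (eventually_all.2 hclose)).exists

lemma gridCounterPow_zero (hp0 : 0 < p) {γ : ℝ} (hγ : 0 < γ) (Q : ℝ) (T : ParentTree (Fin m))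
    (ω : (Fin n × Fin N → ℝ) × (Fin m → ℝ)) :
    gridCounterPow p γ Q T (fun v => inputVec ((0 : Fin m → Input n M) v)) ω = 0 := by
  have hvec : inputVec (0 : Input n M) = 0 := by
    ext i
    simp [inputVec]
  simp only [gridCounterPow, counterPow, Pi.zero_apply, hvec, sketch_zero]
  rw [ParentTree.treeIdx_zero _ _ _ _ (grid_strictMono (gridUnit_pos p hγ) hγ).monotone
    (grid_zero _ _), grid_zero, Real.zero_rpow (by positivity)]

lemma two_thirds_le_measureReal_input [Nonempty (Fin m)] (hp0 : 0 < p) (hp1 : p < 1) (hε : 0 < ε)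
    (hε1 : ε ≤ 1) (hn : 0 < n) (hM : 0 < M) (hN : 0 < N) (T : ParentTree (Fin m))
    (X : Fin m → Input n M)
    (hmean : |∫ a, sketch p N a (∑ v, inputVec (X v)) ^ (p / 3) ∂unitUniforms (Fin n × Fin N) -
      meanConst p * frequencyMoment p X ^ (1 / 3 : ℝ)| ≤ ε / 35 * meanConst p) :
    2 / 3 ≤ (Measure.pi fun _ : Fin (copies p ε) =>
        (unitUniforms (Fin n × Fin N)).prod (unitUniforms (Fin m))).real
      {ω | |(sampleMean (gridCounterPow p (spacing p ε) (n * m * M : ℕ) T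
        fun v => inputVec (X v)) ω / meanConst p) ^ 3 - frequencyMoment p X| ≤
          ε * frequencyMoment p X} := by
  rcases eq_or_ne X 0 with rfl | hX
  · have hzero := gridCounterPow_zero (M := M) (N := N) (n := n) hp0 (spacing_pos hp0 hp1 hε)
      (n * m * M : ℕ) T
    simp only [sampleMean, hzero, frequencyMoment_zero hp0]
    norm_num
  · have hcard : (Fintype.card (Fin m) : ℝ) ≤ (n * m * M : ℕ) := by
      rw [Fintype.card_fin]
      exact_mod_cast (Nat.le_mul_of_pos_left m hn).trans (Nat.le_mul_of_pos_right _ hM)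
    exact two_thirds_le_measureReal_gridCounterPow hp0 hp1 hε hε1 hN
      (fun v i => Nat.cast_nonneg _) (frequencyMoment_eq_sum_inputVec p X)
      (one_le_frequencyMoment hp0.le hX) (frequencyMoment_le hp0 hp1.le X) hcard hmean

lemma exists_treeProtocolData_result_eq (p ε Q : ℝ) {T : ParentTree (Fin m)}
    (hT : ∀ v, v ≠ T.root → G.Adj v (T.parent v))
    {f : Coins → Fin (copies p ε) → (Fin n × Fin N → ℝ) × (Fin m → ℝ)} (hf : Measurable f) :
    ∃ A : TreeProtocolData G n M, A.tree = T ∧ A.len = messageLength p ε Q ∧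
      ∀ X ω, A.protocol.result X ω =
        (sampleMean (gridCounterPow p (spacing p ε) Q T fun v => inputVec (X v)) (f ω) /
          meanConst p) ^ 3 := by
  obtain ⟨code, hcode, hlength⟩ := exists_injective_forall_length_eq
    (α := Fin (copies p ε) → Fin (2 ^ indexBits p (spacing p ε) Q - 1 + 1))
    (ℓ := messageLength p ε Q)
    (by simp [messageLength, pow_mul, Nat.sub_add_cancel Nat.one_le_two_pow])
  let A : TreeProtocolData G n M :=
    { k := copies p ε
      L := 2 ^ indexBits p (spacing p ε) Q - 1
      len := messageLength p ε Q
      g := grid (gridUnit p (spacing p ε)) (spacing p ε)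
      tree := T
      adj_parent := hT
      value := fun ω x j => sketch p N (f ω j).1 (inputVec x)
      measurable_value := fun x j => (measurable_sketch p N (inputVec x)).comp
        (measurable_fst.comp ((measurable_pi_apply j).comp hf))
      rnd := fun ω j => (f ω j).2
      measurable_rnd := fun j v => (measurable_pi_apply v).comp
        (measurable_snd.comp ((measurable_pi_apply j).comp hf))
      code := code
      injective_code := hcode
      length_code := hlength
      est := fun i => ((∑ j, grid (gridUnit p (spacing p ε)) (spacing p ε) (i j) ^ (p / 3)) /
        Fintype.card (Fin (copies p ε)) / meanConst p) ^ 3 }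
  exact ⟨A, rfl, rfl, A.result_eq⟩

lemma exists_treeProtocolData_accurate (hp0 : 0 < p) (hp1 : p < 1) (hε : 0 < ε) (hε1 : ε ≤ 1)
    (hn : 0 < n) (hM : 0 < M) (hG : G.Connected) :
    ∃ A : TreeProtocolData G n M, A.protocol.rounds ≤ G.diam ∧
      A.len = messageLength p ε (n * m * M : ℕ) ∧
      ∀ X : Fin m → Input n M, 2 / 3 ≤ fairCoins.real
        {ω | |A.protocol.result X ω - frequencyMoment p X| ≤ ε * frequencyMoment p X} := by
  have : Nonempty (Fin m) := hG.nonempty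
  have : Nonempty (Fin (copies p ε)) := Fin.pos_iff_nonempty.1 (copies_pos hp0 hp1 hε)
  obtain ⟨N, hN, hmean⟩ := exists_forall_abs_integral_sketch_sub_le hp0 hp1 m n M
    (η := ε / 35 * meanConst p) (mul_pos (by positivity) (meanConst_pos hp0 hp1))
  obtain ⟨T, hadj, hdepth⟩ := exists_parentTree_adj_maxDepth_le_diam hG
  obtain ⟨f, hf⟩ := exists_measurePreserving_pi_prod (Fin (copies p ε)) (Fin n × Fin N) (Fin m)
  obtain ⟨A, rfl, hlen, hresult⟩ :=
    exists_treeProtocolData_result_eq (M := M) p ε (n * m * M : ℕ) hadj hf.measurable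
  refine ⟨A, hdepth, hlen, fun X => ?_⟩
  have haccurate := two_thirds_le_measureReal_input hp0 hp1 hε hε1 hn hM hN A.tree X (hmean X)
  rw [← hf.measureReal_preimage] at haccurate
  · simpa only [Set.preimage_ofPred_eq, hresult] using haccurate
  · have hcounter := measurable_counterPow p (p / 3) (N := N) A.tree
      (grid (gridUnit p (spacing p ε)) (spacing p ε))
      (2 ^ indexBits p (spacing p ε) (n * m * M : ℕ) - 1) fun v => inputVec (X v)
    refine (measurableSet_le ?_ measurable_const).nullMeasurableSet
    unfold sampleMean gridCounterPow
    fun_prop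

end Inputs

end MessagePassing

end

open MessagePassing in
theorem theorem4p5 (p : ℝ) (hp0 : 0 < p) (hp1 : p < 1) :
    ∃ K : ℝ, 0 < K ∧
      ∀ (n m M : ℕ), 0 < n → 0 < M →
      ∀ ε : ℝ, 0 < ε → ε < 1 →
      ∀ G : SimpleGraph (Fin m), G.Connected →
      ∃ P : Protocol G n M,
        P.rounds ≤ G.diam ∧
        P.IsOneShot ∧
        ∀ X : Fin m → Input n M,
          (2 / 3 : ℝ) ≤
            fairCoins.real {ω | |P.result X ω - frequencyMoment p X| ≤ ε * frequencyMoment p X} ∧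
          ∀ ω : Coins,
            (P.maxCommunication X ω : ℝ) ≤
              K * (1 / ε ^ 2 *
                (Real.logb 2 (Real.logb 2 ((n : ℝ) * m * M)) + Real.logb 2 (2 / ε))) ∧
            (P.totalCommunication X ω : ℝ) ≤
              K * (m / ε ^ 2 *
                (Real.logb 2 (Real.logb 2 ((n : ℝ) * m * M)) + Real.logb 2 (2 / ε))) := by
  have hcopies := copiesConst_pos hp0 hp1
  have hbits := bitsConst_pos p
  refine ⟨2 * ((copiesConst p + 1) * bitsConst p), by positivity,
    fun n m M hn hM ε hε hε1 G hG => ?_⟩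
  obtain ⟨A, hrounds, hlen, haccurate⟩ :=
    exists_treeProtocolData_accurate hp0 hp1 hε hε1.le hn hM hG
  refine ⟨A.protocol, hrounds, A.isOneShot, fun X => ⟨haccurate X, fun ω => ?_⟩⟩
  have hlength := messageLength_le hp0 hp1 hε hε1.le (n * m * M)
  rw [← hlen, Nat.cast_mul, Nat.cast_mul] at hlength
  have hmax : (A.protocol.maxCommunication X ω : ℝ) ≤ 2 * A.len := by
    exact_mod_cast A.maxCommunication_le X ω
  have htotal : (A.protocol.totalCommunication X ω : ℝ) ≤ m * A.len := by
    exact_mod_cast A.totalCommunication_le X ω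
  refine ⟨by linarith, htotal.trans ?_⟩
  calc (m : ℝ) * A.len ≤ 2 * (m * A.len) := le_mul_of_one_le_left (by positivity) one_le_two
    _ ≤ 2 * (m * ((copiesConst p + 1) * bitsConst p * (1 / ε ^ 2 *
          (Real.logb 2 (Real.logb 2 ((n : ℝ) * m * M)) + Real.logb 2 (2 / ε))))) := by gcongr
    _ = _ := by ring
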